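/- **Hamiltonian simulation cost.** Let $H\neq 0$ be a Hermitian matrix on $n$ qubits that is $d$-sparse (at most $d$ nonzero entries in every row), $d\ge 2$, and let $t>0$, $\varepsilon>0$. Put $\|H\|_1=\max_q\sum_p|H_{pq}|$, $\|H\|_{\max}=\max_{p,q}|H_{pq}|$, $$\gamma=\frac{\varepsilon}{\sqrt2\,d^3t},\qquad \varepsilon_{\rm seg}=\frac13\cdot\frac{1}{6d^2\lceil\|H\|_{\max}/\gamma\rceil}\cdot\frac{\varepsilon}{5\gamma t},$$ and let $w$ be the least positive integer with $e^w/w^w\le\varepsilon_{\rm seg}^2/2$. *The algorithm* (fractional-query algorithm of Berry et al., 2014). 1. By a proper edge coloring with $n_c\le d^2$ colors of the graph of nonzero entries of $H$ (a nonzero diagonal entry is a loop), write $H=\sum_{j=1}^{n_c}H_j$ with one-sparse Hermitian $H_j$. 2. Split each $H_j$ into its real off-diagonal, imaginary off-diagonal and diagonal parts, round the entries (real and imaginary parts) to the closest multiple of $2\gamma$, ties away from zero, and write the result as $\gamma\sum_k C_{jk}$ with self-inverse Hermitian $C_{jk}$. A part whose largest rounded entry is $2\gamma K$ in absolute value contributes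 $2K$ matrices: for each level $l=1,\dots,K$ two matrices, which have the sign of the entry (times $i$ for imaginary parts) where the rounded entry is at least $2\gamma l$ in absolute value, and the diagonal entry $+1$ (respectively $-1$) in the rows without such an entry. Let $\Omega$ be the total number of the $C_{jk}$, and $G_{jk}=\frac\pi2(1+C_{jk})$, which has eigenvalues in $\{0,\pi\}$. 3. The oracle is $Q=\sum_{j,k}|j,k\rangle\langle j,k|\otimes e^{iG_{jk}}$, with an index register of $\lceil\log_2(\Omega+1)\rceil$ qubits, in which one value is reserved for an idle query; $Q$ is the identity on all unused values. It is implemented by applying, for each $(j,k)$, the unitary $e^{iG_{jk}}$ controlled on the index register, where the conjunction of the control qubits is computed into ancillas, and uncomputed, by Toffoli gates. 4. The evolution is divided into $N=\lceil5\gamma t\Omega\rceil$ segments. A segment is the Lie product $\bigl(\prod_{j,k}e^{-i\theta C_{jk}}\bigr)^r$ with $\theta=\gamma t/(rN)$. Each factor is realized up to the amplitude $1/(c+s)$, $c=\cos\theta$, $s=\sin\theta$, by a control qubit prepared in $(\sqrt c\,|0\rangle+\sqrt s\,|1\rangle)/\sqrt{c+s}$, a controlled query, a phase gate $\mathrm{diag}(1,i)$,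 and the inverse preparation. In each segment only the queries of the first $w$ control qubits in state $|1\rangle$ are made, by $w$ uses of $Q$ whose index is loaded from the control qubits. A flag qubit lowers the success amplitude to $1/2$, and one round $-ARA^\dagger RA$ of oblivious amplitude amplification is applied. All steps are compiled into one-qubit, two-qubit and Toffoli gates, with arbitrary costs $C_1,C_2,C_T\ge0$. The way in which the index loading, the reflection $R$ and the singly controlled $e^{iG_{jk}}$ are compiled (with work qubits that start and end in $|0\rangle$) is arbitrary. The cost $\mathcal C[\cdot]$ of a circuit is the sum of the costs of its gates. *Claim.* Colorings as in step 1 exist. For every such coloring the following holds. * There is $r_0$ such that for all $r\ge r_0$ and all compilations the algorithm simulates $e^{-iHt}$ up to error $\varepsilon$: for every state $\psi$, the output on $\psi$, with all other qubits in $|0\rangle$, is within $\varepsilon\|\psi\|$ of $e^{-iHt}\psi$, with all other qubits in $|0\rangle$. * For all $r$ and all compilations, the cost of the algorithm satisfies $$\mathcal C(e^{-iHt})\ \ge\ 5t\,(\|H\|_1-d^2\gamma)\,w\,\mathcal C[Q].$$ * For all $r$ and all compilations, the circuit for the oracle implements $Q$ (on inputs whose ancilla and work qubits are $|0\rangle$),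 and, if $\|H\|_1/\gamma>d^2$, $$\mathcal C[Q]\ \ge\ 2\Bigl(\bigl\lceil\log_2(\|H\|_1/\gamma-d^2)\bigr\rceil-1\Bigr)C_T .$$ -/

import Mathlib

open scoped NNReal

noncomputable section

namespace HamSim

/-! ### Gates, circuits and their cost -/

/-- Computational basis states of a set `W` of qubits; `false` is `|0⟩` and `true` is `|1⟩`. -/
abbrev BitState (W : Type) : Type := W → Bool

/-- The elementary gates: arbitrary one-qubit and two-qubit unitaries, and the Toffoli gate
(controls `a`, `b`, target `c`). -/
inductive Gate (W : Type) : Type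
  | one (u : Matrix.unitaryGroup Bool ℂ) (a : W)
  | two (u : Matrix.unitaryGroup (Bool × Bool) ℂ) (a b : W) (hab : a ≠ b)
  | toffoli (a b c : W) (hab : a ≠ b) (hac : a ≠ c) (hbc : b ≠ c)

/-- The linear map that sends the basis state `|x⟩` to `|f x⟩`. -/
def basisMap {S : Type} [DecidableEq S] (f : S → S) : Matrix S S ℂ :=
  Matrix.of fun y x => if y = f x then 1 else 0

/-- The matrix of a gate on the register `W`. -/
def Gate.mat {W : Type} [Fintype W] [DecidableEq W] :
    Gate W → Matrix (BitState W) (BitState W) ℂ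
  | .one u a => Matrix.of fun y x =>
      if ∀ v, v ≠ a → y v = x v then u.1 (y a) (x a) else 0
  | .two u a b _ => Matrix.of fun y x =>
      if ∀ v, v ≠ a → v ≠ b → y v = x v then u.1 (y a, y b) (x a, x b) else 0
  | .toffoli a b c _ _ _ =>
      basisMap fun x => Function.update x c (xor (x c) (x a && x b))

/-- The inverse gate. -/
def Gate.inv {W : Type} : Gate W → Gate W
  | .one u a => .one u⁻¹ a
  | .two u a b hab => .two u⁻¹ a b hab
  | .toffoli a b c hab hac hbc => .toffoli a b c hab hac hbc

/-- A circuit is a list of gates; the head of the list is applied first. -/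
abbrev Circuit (W : Type) : Type := List (Gate W)

/-- The matrix of a circuit. -/
def Circuit.mat {W : Type} [Fintype W] [DecidableEq W] :
    Circuit W → Matrix (BitState W) (BitState W) ℂ
  | [] => 1
  | g :: c => Circuit.mat c * g.mat

/-- The inverse circuit. -/
def Circuit.inv {W : Type} (c : Circuit W) : Circuit W := (c.map Gate.inv).reverse

/-- The circuit repeated `k` times. -/
def Circuit.rep {W : Type} (c : Circuit W) (k : ℕ) : Circuit W := (List.replicate k c).flatten

/-- The costs of a one-qubit gate, a two-qubit gate and a Toffoli gate. -/
structure GateCosts : Type where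
  one : ℝ≥0
  two : ℝ≥0
  toffoli : ℝ≥0

/-- The cost of a gate. -/
def Gate.cost {W : Type} (κ : GateCosts) : Gate W → ℝ
  | .one _ _ => κ.one
  | .two _ _ _ _ => κ.two
  | .toffoli _ _ _ _ _ _ => κ.toffoli

/-- The cost of a circuit: the sum of the costs of its gates. -/
def Circuit.cost {W : Type} (κ : GateCosts) (c : Circuit W) : ℝ := (c.map (Gate.cost κ)).sum

/-- The circuit `c` acts as `T` on all inputs in which the qubits in `anc` are `|0⟩`. -/
def Circuit.Implements {W : Type} [Fintype W] [DecidableEq W] (c : Circuit W)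
    (anc : W → Prop) (T : Matrix (BitState W) (BitState W) ℂ) : Prop :=
  ∀ x : BitState W, (∀ v, anc v → x v = false) → ∀ y, c.mat y x = T y x

/-! ### Explicit one-qubit gates -/

/-- The real reflection with `|0⟩ ↦ cos φ |0⟩ + sin φ |1⟩`, `|1⟩ ↦ sin φ |0⟩ - cos φ |1⟩`. -/
def reflectionGate (φ : ℝ) : Matrix.unitaryGroup Bool ℂ :=
  ⟨Matrix.of fun y x => match y, x with
    | false, false => (Real.cos φ : ℂ)
    | true, true => (-Real.cos φ : ℂ)
    | _, _ => (Real.sin φ : ℂ), by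
    rw [Matrix.mem_unitaryGroup_iff]
    have h : Complex.cos (φ : ℂ) ^ 2 + Complex.sin (φ : ℂ) ^ 2 = 1 := by
      rw [add_comm]; exact Complex.sin_sq_add_cos_sq _
    ext y x
    cases y <;> cases x <;>
      simp [Matrix.mul_apply, Matrix.star_apply, ← Complex.cos_conj, ← Complex.sin_conj] <;>
      first
        | ring1
        | linear_combination h⟩

/-- The gate `|0⟩ ↦ |0⟩`, `|1⟩ ↦ i |1⟩`. -/
def phaseGate : Matrix.unitaryGroup Bool ℂ :=
  ⟨Matrix.diagonal fun b => if b then Complex.I else 1, by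
    rw [Matrix.mem_unitaryGroup_iff]
    ext y x
    cases y <;> cases x <;> simp [Matrix.mul_apply, Matrix.star_apply]⟩

/-- The gate that exchanges `|0⟩` and `|1⟩`. -/
def notGate : Matrix.unitaryGroup Bool ℂ :=
  ⟨Matrix.of fun y x => if y = x then 0 else 1, by
    rw [Matrix.mem_unitaryGroup_iff]
    ext y x
    cases y <;> cases x <;> simp [Matrix.mul_apply, Matrix.star_apply]⟩

/-- The gate `-1` (a global phase). -/
def negGate : Matrix.unitaryGroup Bool ℂ :=
  ⟨-1, by
    rw [Matrix.mem_unitaryGroup_iff]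
    simp⟩

/-! ### Sparse matrices, norms and one-sparse decompositions -/

/-- Every row (hence, for a Hermitian matrix, every column) has at most `d` nonzero entries. -/
def IsSparse {S : Type} [Fintype S] (d : ℕ) (H : Matrix S S ℂ) : Prop :=
  ∀ p, {q | H p q ≠ 0}.ncard ≤ d

/-- The largest absolute column sum. -/
def oneNorm {S : Type} [Fintype S] (H : Matrix S S ℂ) : ℝ := ⨆ q, ∑ p, ‖H p q‖

/-- The largest absolute value of an entry. -/
def maxNorm {S : Type} (H : Matrix S S ℂ) : ℝ := ⨆ p, ⨆ q, ‖H p q‖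

/-- An edge coloring, with colors `0, …, nc - 1`, of the graph whose edges (and loops) are the
positions of the nonzero entries of `H`. -/
structure EdgeColoring {S : Type} (H : Matrix S S ℂ) (nc : ℕ) : Type where
  color : S → S → Fin nc
  symm : ∀ p q, color p q = color q p
  proper : ∀ p q q', H p q ≠ 0 → H p q' ≠ 0 → color p q = color p q' → q = q'

/-- The one-sparse matrix `H_j`: the entries of `H` of color `j`. -/
def EdgeColoring.piece {S : Type} {H : Matrix S S ℂ} {nc : ℕ} (χ : EdgeColoring H nc)
    (j : Fin nc) : Matrix S S ℂ :=
  Matrix.of fun p q => if χ.color p q = j then H p q else 0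

/-! ### Decomposition of a one-sparse matrix into self-inverse matrices -/

/-- Off-diagonal real part, off-diagonal imaginary part, diagonal part. -/
inductive Part : Type
  | X
  | Y
  | Z

/-- The real number that stands at the position `(p, q)` of the given part of `A`. -/
def Part.val {S : Type} [DecidableEq S] (A : Matrix S S ℂ) : Part → S → S → ℝ
  | .X, p, q => if p = q then 0 else (A p q).re
  | .Y, p, q => if p = q then 0 else (A p q).im
  | .Z, p, q => if p = q then (A p q).re else 0

/-- The unit in which the entries of a part are expressed. -/
def Part.unit : Part → ℂ
  | .X => 1
  | .Y => Complex.I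
  | .Z => 1

/-- The natural number `k` for which `2 γ k` is the multiple of `2 γ` closest to `|v|`. -/
def level (γ v : ℝ) : ℕ := ⌊|v| / (2 * γ) + 1 / 2⌋₊

/-- The largest level that occurs in a part of `A`. -/
def maxLevel {S : Type} [Fintype S] [DecidableEq S] (γ : ℝ) (A : Matrix S S ℂ) (ξ : Part) : ℕ :=
  Finset.univ.sup fun pq : S × S => level γ (ξ.val A pq.1 pq.2)

/-- For a Hermitian one-sparse matrix `A`: the Hermitian matrix with eigenvalues `±1` whose
entry is the sign of the entry of the part `ξ` of `A` where the level of this entry exceeds `l`;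
a row without such an entry gets the diagonal entry `1` (for `σ = true`) or `-1`
(for `σ = false`). The mean of the two matrices for `σ = true, false` has the entries `0`, `±1`
or `0`, `±i`, and `γ` times the sum of all matrices over `ξ`, `l < maxLevel γ A ξ` and `σ` is `A`
with the real and imaginary parts of its entries rounded to multiples of `2 γ`. -/
def signMatrix {S : Type} [Fintype S] [DecidableEq S] (γ : ℝ) (A : Matrix S S ℂ) (ξ : Part)
    (l : ℕ) (σ : Bool) : Matrix S S ℂ :=
  Matrix.of fun p q =>
    if p = q ∧ ∀ q', level γ (ξ.val A p q') ≤ l then (if σ then 1 else -1)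
    else if l < level γ (ξ.val A p q) then (Real.sign (ξ.val A p q) : ℂ) * ξ.unit
    else 0

/-! ### The parameters of the algorithm -/

/-- The precision `γ = ε / (√2 d³ t)` to which the entries of `H` are rounded. -/
def precision (d : ℕ) (ε t : ℝ) : ℝ := ε / (Real.sqrt 2 * (d : ℝ) ^ 3 * t)

/-- The precision of one segment of the algorithm. -/
def segmentPrecision {S : Type} (H : Matrix S S ℂ) (d : ℕ) (ε t : ℝ) : ℝ :=
  1 / 3 * (1 / (6 * (d : ℝ) ^ 2 * ⌈maxNorm H / precision d ε t⌉)) *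
    (ε / (5 * precision d ε t * t))

/-- `w` is the least positive integer with `e ^ w / w ^ w ≤ δ ^ 2 / 2`. -/
def IsTruncationOrder (δ : ℝ) (w : ℕ) : Prop :=
  IsLeast {k : ℕ | 0 < k ∧ Real.exp k / (k : ℝ) ^ k ≤ δ ^ 2 / 2} w

/-- The data of a run of the algorithm on `n` qubits: the Hamiltonian, an edge coloring, the
precision `γ`, the simulation time `t`, the number `w` of queries kept in a segment, and the
number `r` of Lie product steps in a segment. -/
structure Run (n : ℕ) : Type where
  H : Matrix (BitState (Fin n)) (BitState (Fin n)) ℂ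
  nc : ℕ
  χ : EdgeColoring H nc
  γ : ℝ
  t : ℝ
  w : ℕ
  r : ℕ

namespace Run

variable {n : ℕ} (D : Run n)

/-- The matrices `C_{jk}` with eigenvalues `±1`, listed color by color. -/
def signMatrices : List (Matrix (BitState (Fin n)) (BitState (Fin n)) ℂ) :=
  (List.finRange D.nc).flatMap fun j =>
    [Part.X, Part.Y, Part.Z].flatMap fun ξ =>
      (List.range (maxLevel D.γ (D.χ.piece j) ξ)).flatMap fun l =>
        [signMatrix D.γ (D.χ.piece j) ξ l true, signMatrix D.γ (D.χ.piece j) ξ l false]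

/-- The total number `Ω` of matrices. -/
def Ω : ℕ := D.signMatrices.length

/-- The `k`-th matrix `G = (π / 2) (1 + C)`, with eigenvalues `0` and `π`. -/
def G (k : Fin D.Ω) : Matrix (BitState (Fin n)) (BitState (Fin n)) ℂ :=
  ((Real.pi / 2 : ℝ) : ℂ) • (1 + D.signMatrices.get k)

/-- The unitary `exp (i G)` of the `k`-th matrix. -/
def queryUnitary (k : Fin D.Ω) : Matrix (BitState (Fin n)) (BitState (Fin n)) ℂ :=
  NormedSpace.exp (Complex.I • D.G k)

/-- The number of segments, `⌈5 γ t Ω⌉`. -/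
def numSegments : ℕ := ⌈5 * D.γ * D.t * D.Ω⌉₊

/-- The angle `θ` of one factor `exp (-i θ C)` of the Lie product. -/
def angle : ℝ := D.γ * D.t / (D.r * D.numSegments)

/-- The number of factors of the Lie product in one segment. -/
def numFactors : ℕ := D.r * D.Ω

/-- The number of qubits of the register that holds the index of a query. The value `0` of this
register means that the query is idle, the value `k + 1` stands for the `k`-th matrix. -/
def indexBits : ℕ := Nat.clog 2 (D.Ω + 1)

theorem indexBits_pos (k : Fin D.Ω) : 0 < D.indexBits :=
  Nat.clog_pos (by norm_num) (by have := k.pos; omega)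

end Run

/-! ### Registers -/

/-- The qubits of the algorithm: the system, one control qubit for every factor of the Lie product
in a segment, a flag qubit that adjusts the success amplitude to `1 / 2`, the index register of a
query, the ancillas for the conjunction of the index qubits, and work qubits. -/
inductive Wire (n m L K : ℕ) : Type
  | sys (i : Fin n)
  | ctrl (i : Fin m)
  | flag
  | idx (i : Fin L)
  | anc (i : Fin (L - 1))
  | work (i : Fin K)
  deriving DecidableEq, Fintype

namespace Wire

variable {n m L K : ℕ}

/-- The system qubits. -/
def IsSys : Wire n m L K → Prop
  | .sys _ => True
  | _ => False

/-- The work qubits. -/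
def IsWork : Wire n m L K → Prop
  | .work _ => True
  | _ => False

/-- The work qubits and the ancillas for conjunctions. -/
def IsAncilla : Wire n m L K → Prop
  | .anc _ => True
  | .work _ => True
  | _ => False

instance : DecidablePred (IsSys (n := n) (m := m) (L := L) (K := K)) := fun v => by
  cases v <;> unfold IsSys <;> infer_instance

/-- The qubit that holds the conjunction of the index qubits `0, …, i`. -/
def conj : (i : ℕ) → i < L → Wire n m L K
  | 0, h => .idx ⟨0, h⟩
  | i + 1, h => .anc ⟨i, by omega⟩

/-- The part of a basis state that belongs to the system. -/
def sysPart (x : BitState (Wire n m L K)) : BitState (Fin n) := fun i => x (.sys i)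

/-- The operator that applies the matrix `f x` to the system and keeps the other qubits, where
`x` is the input (`f` is to depend on the qubits outside the system only). -/
def onSystem (f : BitState (Wire n m L K) → Matrix (BitState (Fin n)) (BitState (Fin n)) ℂ) :
    Matrix (BitState (Wire n m L K)) (BitState (Wire n m L K)) ℂ :=
  Matrix.of fun y x =>
    if ∀ v, ¬ v.IsSys → y v = x v then f x (sysPart y) (sysPart x) else 0

/-- The integer in the index register. -/
def indexValue (x : BitState (Wire n m L K)) : ℕ :=
  ∑ i : Fin L, if x (.idx i) then 2 ^ (i : ℕ) else 0

/-- The state `|0 … 0⟩ ⊗ ψ` with the system in the state `ψ`. -/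
def initState (ψ : BitState (Fin n) → ℂ) : BitState (Wire n m L K) → ℂ := fun x =>
  if ∀ v, ¬ v.IsSys → x v = false then ψ (sysPart x) else 0

end Wire

namespace Run

variable {n : ℕ} (D : Run n)

/-- The qubits of a run with `K` work qubits. -/
abbrev W (K : ℕ) : Type := Wire n D.numFactors D.indexBits K

/-- The `k`-th matrix in the Lie product; the factors run through all matrices, `r` times. -/
def factorMatrix (i : Fin D.numFactors) : Fin D.Ω := Fin.modNat (m := D.r) i

/-- The oracle `Q = ∑ₖ |k⟩⟨k| ⊗ exp (i Gₖ)`, which is the identity on the unused index values. -/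
def oracle (K : ℕ) : Matrix (BitState (D.W K)) (BitState (D.W K)) ℂ :=
  Wire.onSystem fun x =>
    if h : 0 < Wire.indexValue x ∧ Wire.indexValue x ≤ D.Ω then
      D.queryUnitary ⟨Wire.indexValue x - 1, by omega⟩
    else 1

/-- The operator `exp (i Gₖ)` on the system, controlled by the qubit that holds the conjunction of
all index qubits. -/
def controlledQuery (K : ℕ) (k : Fin D.Ω) : Matrix (BitState (D.W K)) (BitState (D.W K)) ℂ :=
  Wire.onSystem fun x =>
    if x (Wire.conj (D.indexBits - 1) (Nat.sub_lt (D.indexBits_pos k) one_pos)) then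
      D.queryUnitary k
    else 1

/-- The index value that the `s`-th query of a segment has to use when the control qubits are in
the state `x`: the one of the `s`-th factor whose control qubit is `|1⟩`, or `0` if there is no
such factor. -/
def slotIndex {K : ℕ} (s : ℕ) (x : BitState (D.W K)) : ℕ :=
  match ((List.finRange D.numFactors).filter fun i => x (.ctrl i))[s]? with
  | some i => D.factorMatrix i + 1
  | none => 0

/-- The permutation of basis states that adds the index of the `s`-th query bitwise to the index
register. It is its own inverse. -/
def loadMap {K : ℕ} (s : ℕ) (x : BitState (D.W K)) : BitState (D.W K)
  | .idx i => xor (x (.idx i)) ((D.slotIndex s x).testBit i)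
  | v => x v

/-- The reflection `2 P - 1`, where `P` projects on the state `|0 … 0⟩` of the control qubits and
the flag. -/
def zeroReflection (K : ℕ) : Matrix (BitState (D.W K)) (BitState (D.W K)) ℂ :=
  Matrix.diagonal fun x => if (∀ i, x (.ctrl i) = false) ∧ x .flag = false then 1 else -1

/-- Circuits, with work qubits that start and end in `|0⟩`, for those steps of the algorithm that
are not spelled out gate by gate: loading the index of a query, the reflection of the amplitude
amplification, and the unitaries `exp (i Gₖ)` with one control qubit. -/
structure Compilation (K : ℕ) : Type where
  load : Fin D.w → Circuit (D.W K)
  load_spec : ∀ s, (load s).Implements Wire.IsWork (basisMap (D.loadMap s))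
  reflect : Circuit (D.W K)
  reflect_spec : reflect.Implements Wire.IsWork (D.zeroReflection K)
  query : Fin D.Ω → Circuit (D.W K)
  query_spec : ∀ k, (query k).Implements Wire.IsWork (D.controlledQuery K k)

/-! ### The circuits of the algorithm -/

/-- The NOT gates on the index qubits in which the binary expansion of `k + 1` has a `0`. -/
def flips (K : ℕ) (k : Fin D.Ω) : Circuit (D.W K) :=
  ((List.finRange D.indexBits).filter fun (i : Fin D.indexBits) =>
    !((k : ℕ) + 1).testBit i).map fun (i : Fin D.indexBits) => Gate.one notGate (.idx i)

/-- The Toffoli gates that compute the conjunction of the index qubits. -/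
def ladder (K : ℕ) : Circuit (D.W K) :=
  (List.finRange (D.indexBits - 1)).map fun (i : Fin (D.indexBits - 1)) =>
    Gate.toffoli (Wire.conj i (by omega)) (.idx ⟨i + 1, by omega⟩) (.anc i)
      (by
        obtain ⟨i, hi⟩ := i
        cases i <;> simp [Wire.conj])
      (by
        obtain ⟨i, hi⟩ := i
        cases i <;> simp [Wire.conj])
      (by simp)

variable {D} {K : ℕ} (S : D.Compilation K)

namespace Compilation

/-- The circuit for the oracle `Q`: for each `k`, the unitary `exp (i Gₖ)` controlled on the value
`k + 1` of the index register. -/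
def oracleCircuit : Circuit (D.W K) :=
  (List.finRange D.Ω).flatMap fun k =>
    D.flips K k ++ D.ladder K ++ S.query k ++ (D.ladder K).inv ++ D.flips K k

/-- The reflections `|0⟩ ↦ (√c |0⟩ + √s |1⟩) / √(c + s)`, with `c = cos θ` and `s = sin θ`, on all
control qubits. -/
def prepare (_S : D.Compilation K) : Circuit (D.W K) :=
  (List.finRange D.numFactors).map fun i =>
    Gate.one (reflectionGate (Real.arccos (Real.sqrt
      (Real.cos D.angle / (Real.cos D.angle + Real.sin D.angle))))) (.ctrl i)

/-- The phase gates on all control qubits. -/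
def phases (_S : D.Compilation K) : Circuit (D.W K) :=
  (List.finRange D.numFactors).map fun i => Gate.one phaseGate (.ctrl i)

/-- The gate on the flag that lowers the success amplitude of the segment to `1 / 2`. -/
def flagGate (_S : D.Compilation K) : Gate (D.W K) :=
  Gate.one (reflectionGate (Real.arccos
    ((Real.cos D.angle + Real.sin D.angle) ^ D.numFactors / 2))) .flag

/-- A segment before amplitude amplification: the fractional queries of the segment are replaced
by controlled queries, of which only the first `w` are carried out. -/
def trial : Circuit (D.W K) :=
  S.prepare ++ [S.flagGate] ++
    ((List.finRange D.w).flatMap fun s => S.load s ++ S.oracleCircuit ++ S.load s) ++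
    S.phases ++ S.prepare

/-- A segment: one round `-A R A† R A` of oblivious amplitude amplification. -/
def segment : Circuit (D.W K) :=
  S.trial ++ S.reflect ++ S.trial.inv ++ S.reflect ++ S.trial ++ [Gate.one negGate .flag]

/-- The whole algorithm. -/
def algorithm : Circuit (D.W K) := Circuit.rep S.segment D.numSegments

/-- The algorithm simulates `exp (-i H t)` with error at most `ε`, as an operator from the system
(with all other qubits in `|0⟩`) to the whole register. -/
def Simulates (ε : ℝ) : Prop :=
  ∀ ψ : BitState (Fin n) → ℂ,
    ‖WithLp.toLp 2 (S.algorithm.mat.mulVec (Wire.initState ψ) -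
        Wire.initState ((NormedSpace.exp ((-(Complex.I * D.t)) • D.H)).mulVec ψ))‖
      ≤ ε * ‖WithLp.toLp 2 ψ‖

end Compilation

end Run

end HamSim

end

/-! Correctness. Let `J` be the isometry that puts all qubits outside the system into `|0⟩`, let `A`
be the trial circuit of a segment, and let `V = 2 J† A J`. Since `exp (i G) = -C`, a control qubit
contributes `c + i s (-C) = exp (-i θ C)` up to the factor `1 / (c + s)`, and the flag replaces the
product of these factors by `1 / 2`. So `V` is the Lie product `L` of a segment, expanded over the
values of the control qubits, with only the first `w` queries kept in each term (`trialBlock_eq`,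
`two_smul_trialBlock`). An induction along Pascal's rule bounds `‖V - L‖` by `2 s ^ (w + 1)` times
the binomial coefficient of `m` over `w + 1`, where `m` is the number of factors
(`norm_truncatedProduct_sub_le`).

The algebra of the reflection `2 J J† - 1` gives `-A R A† R A J = J V + A J (1 - V† V)`
(`segment_mul_embedding`). As `L` is unitary, `1 - V† V` is of first order in `V - L`, so a segment
acts as `L` up to about three times the truncation error. Telescoping over the `N` segments,
together with the choice of `w` and the upper bound `Ω_le`, keeps this contribution below `ε / 10`.

What remains is a power of the Lie step with `r N` repetitions. It is compared directly with `exp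
(-i H t)` through derivatives at `0`. The rounding of `H` enters as the difference of the two
derivatives, which the Schur test bounds by `3 d γ t ≤ 3 ε / 5`. The error of the Lie formula is
below `ε / 10` once `r` is large. The total is at most `4 ε / 5`.

At the level of gates, every operator either acts on one tensor factor under conditions on the
others (`Splitting.op`) or permutes basis states. The freely compiled pieces are known only on
inputs with work qubits in `|0⟩`, so this subspace has to be preserved, also by `A†`. That follows
from unitarity in finite dimension (`PreservesZeros.conjTranspose`).

Cost. The entries of one column of `H` have different colors, and each color supplies two matrices
per level, so `γ Ω ≥ ‖H‖₁ - d² γ` (`oneNorm_sub_le`). The first cost bound counts segments and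
queries in a segment. The second counts the Toffoli gates of one ladder and its inverse, whose
length is governed by `Ω < 2 ^ indexBits`. Colorings exist by the greedy method, since an edge meets
at most `2 d - 1 < d²` others. -/

open scoped NNReal

noncomputable section

namespace HamSim

set_option linter.unusedSectionVars false

open Matrix

/-! ### Operators that act on a factor of the state space -/

/-- A splitting of the basis states `S` into a factor `T`, read off by `proj` and overwritten by
`lift`, and a complementary factor, whose values are compared by `rel`. -/
structure Splitting (S T : Type) : Type where
  rel : S → S → Prop
  dec : DecidableRel rel
  proj : S → T
  lift : S → T → S
  equivalence : Equivalence rel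
  rel_lift : ∀ x t, rel (lift x t) x
  proj_lift : ∀ x t, proj (lift x t) = t
  lift_proj : ∀ z x, rel z x → lift x (proj z) = z

namespace Splitting

variable {S T : Type} (F : Splitting S T)

instance : DecidableRel F.rel := F.dec

/-- The operator that acts as `f x` on the factor `T` and keeps the complementary factor. -/
def op (f : S → Matrix T T ℂ) : Matrix S S ℂ :=
  Matrix.of fun y x => if F.rel y x then f x (F.proj y) (F.proj x) else 0

theorem op_apply (f : S → Matrix T T ℂ) (y x : S) :
    F.op f y x = if F.rel y x then f x (F.proj y) (F.proj x) else 0 := rfl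

/-- Only states with the same complementary factor as `x` contribute to the product, and `lift x`
parametrizes them by `T`. The left operator is evaluated at such an intermediate state, which is why
`f`, but not `g`, has to ignore the factor `T`. -/
theorem op_mul [Fintype S] [Fintype T] (f g : S → Matrix T T ℂ)
    (hf : ∀ y x, F.rel y x → f y = f x) : F.op f * F.op g = F.op fun x => f x * g x := by
  classical
  ext y x
  rw [Matrix.mul_apply, op_apply]
  have h1 : ∑ z, F.op f y z * F.op g z x =
      ∑ t, F.op f y (F.lift x t) * F.op g (F.lift x t) x := by
    have hinj : Function.Injective (F.lift x) := fun s t h => by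
      rw [← F.proj_lift x s, h, F.proj_lift]
    rw [← Finset.sum_image (s := Finset.univ) (g := F.lift x)
      (f := fun z => F.op f y z * F.op g z x) (fun a _ b _ h => hinj h)]
    symm
    apply Finset.sum_subset (Finset.subset_univ _)
    intro z _ hz
    have : ¬ F.rel z x := fun h => hz (Finset.mem_image.2 ⟨F.proj z, Finset.mem_univ _,
      F.lift_proj z x h⟩)
    simp [op_apply, this]
  rw [h1]
  have hrel : ∀ t, F.rel y (F.lift x t) ↔ F.rel y x := fun t =>
    ⟨fun h => F.equivalence.trans h (F.rel_lift x t),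
      fun h => F.equivalence.trans h (F.equivalence.symm (F.rel_lift x t))⟩
  by_cases h : F.rel y x
  · simp [op_apply, hrel, h, F.rel_lift, F.proj_lift, Matrix.mul_apply, hf _ _ (F.rel_lift x _)]
  · simp [op_apply, hrel, h]

theorem op_one [DecidableEq S] [DecidableEq T] : F.op (fun _ => 1) = 1 := by
  ext y x
  rw [op_apply, Matrix.one_apply, Matrix.one_apply]
  by_cases h : F.rel y x
  · have : F.proj y = F.proj x ↔ y = x := ⟨fun e => by
      rw [← F.lift_proj y x h, e, F.lift_proj x x (F.equivalence.refl x)], fun e => e ▸ rfl⟩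
    simp [h, this]
  · have : y ≠ x := fun e => h (e ▸ F.equivalence.refl x)
    simp [h, this]

theorem op_conjTranspose (f : S → Matrix T T ℂ) (hf : ∀ y x, F.rel y x → f y = f x) :
    (F.op f)ᴴ = F.op fun x => (f x)ᴴ := by
  ext y x
  simp only [op_apply, Matrix.conjTranspose_apply]
  by_cases h : F.rel y x
  · simp [h, F.equivalence.symm h, hf y x h]
  · have : ¬ F.rel x y := fun h' => h (F.equivalence.symm h')
    simp [h, this]

/-- The splitting of a register into one qubit and the others. -/
def oneQubit {W : Type} [Fintype W] [DecidableEq W] (a : W) : Splitting (BitState W) Bool where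
  rel y x := ∀ v, v ≠ a → y v = x v
  dec := fun _ _ => inferInstance
  proj x := x a
  lift x t := Function.update x a t
  equivalence := ⟨fun _ _ _ => rfl, fun h v hv => (h v hv).symm,
    fun h h' v hv => (h v hv).trans (h' v hv)⟩
  rel_lift x t v hv := by simp [hv]
  proj_lift x t := by simp
  lift_proj z x h := by
    ext v
    by_cases hv : v = a
    · subst hv; simp
    · simp [hv, h v hv]

/-- The splitting of a register into two qubits and the others. -/
def twoQubits {W : Type} [Fintype W] [DecidableEq W] (a b : W) (hab : a ≠ b) :
    Splitting (BitState W) (Bool × Bool) where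
  rel y x := ∀ v, v ≠ a → v ≠ b → y v = x v
  dec := fun _ _ => inferInstance
  proj x := (x a, x b)
  lift x t := Function.update (Function.update x a t.1) b t.2
  equivalence := ⟨fun _ _ _ _ => rfl, fun h v hv hv' => (h v hv hv').symm,
    fun h h' v hv hv' => (h v hv hv').trans (h' v hv hv')⟩
  rel_lift x t v hv hv' := by simp [hv, hv']
  proj_lift x t := by simp [hab]
  lift_proj z x h := by
    ext v
    by_cases hv : v = b
    · subst hv; simp
    · by_cases hv' : v = a
      · subst hv'; simp [hv]
      · simp [hv, hv', h v hv' hv]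

/-- The splitting of the register of the algorithm into the system and the other qubits. -/
def system (n m L K : ℕ) : Splitting (BitState (Wire n m L K)) (BitState (Fin n)) where
  rel y x := ∀ v, ¬ v.IsSys → y v = x v
  dec := fun _ _ => inferInstance
  proj x := Wire.sysPart x
  lift x t := fun v => match v with
    | .sys i => t i
    | v => x v
  equivalence := ⟨fun _ _ _ => rfl, fun h v hv => (h v hv).symm,
    fun h h' v hv => (h v hv).trans (h' v hv)⟩
  rel_lift x t v hv := by
    cases v <;> simp_all [Wire.IsSys]
  proj_lift x t := rfl
  lift_proj z x h := by
    ext v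
    have := h v
    cases v <;> simp_all [Wire.IsSys, Wire.sysPart]

end Splitting

theorem onSystem_eq_op {n m L K : ℕ}
    (f : BitState (Wire n m L K) → Matrix (BitState (Fin n)) (BitState (Fin n)) ℂ) :
    Wire.onSystem f = (Splitting.system n m L K).op f := rfl

/-! ### Permutations of the basis states -/

section basisMap

variable {S : Type} [DecidableEq S]

theorem basisMap_apply (f : S → S) (y x : S) : basisMap f y x = if y = f x then 1 else 0 := rfl

theorem mul_basisMap_apply [Fintype S] (A : Matrix S S ℂ) (f : S → S) (y x : S) :
    (A * basisMap f) y x = A y (f x) := by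
  simp [Matrix.mul_apply, basisMap_apply]

theorem basisMap_mul [Fintype S] (f g : S → S) :
    basisMap f * basisMap g = basisMap (f ∘ g) := by
  ext y x
  rw [mul_basisMap_apply]
  rfl

theorem basisMap_id : basisMap (id : S → S) = 1 := by
  ext y x
  simp [basisMap_apply, Matrix.one_apply]

theorem _root_.Function.Involutive.basisMap_conjTranspose {f : S → S}
    (h : Function.Involutive f) : (basisMap f)ᴴ = basisMap f := by
  ext y x
  rw [Matrix.conjTranspose_apply, basisMap_apply, basisMap_apply]
  have : x = f y ↔ y = f x := ⟨fun e => by rw [e, h], fun e => by rw [e, h]⟩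
  simp [this]

theorem conjTranspose_basisMap_mul_apply [Fintype S] (A : Matrix S S ℂ) (f : S → S) (y x : S) :
    ((basisMap f)ᴴ * A) y x = A (f y) x := by
  simp [Matrix.mul_apply, basisMap_apply, Matrix.conjTranspose_apply, apply_ite]

theorem conjTranspose_basisMap_mul_basisMap [Fintype S] (A : Matrix S S ℂ) (f : S → S)
    (y x : S) : ((basisMap f)ᴴ * A * basisMap f) y x = A (f y) (f x) := by
  rw [mul_basisMap_apply, conjTranspose_basisMap_mul_apply]

end basisMap

/-! ### Circuits -/

theorem toffoli_involutive {W : Type} [DecidableEq W] {a b c : W} (hac : a ≠ c) (hbc : b ≠ c) :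
    Function.Involutive fun x : BitState W =>
      Function.update x c (xor (x c) (x a && x b)) := by
  intro x
  ext v
  by_cases h : v = c
  · subst h; simp [hac, hbc]
  · simp [h]

section circuits

variable {W : Type} [Fintype W] [DecidableEq W]

theorem Gate.mat_one (u : Matrix.unitaryGroup Bool ℂ) (a : W) :
    (Gate.one u a).mat = (Splitting.oneQubit a).op fun _ => u.1 := rfl

theorem Gate.mat_two (u : Matrix.unitaryGroup (Bool × Bool) ℂ) (a b : W) (hab : a ≠ b) :
    (Gate.two u a b hab).mat = (Splitting.twoQubits a b hab).op fun _ => u.1 := rfl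

theorem Gate.mat_toffoli (a b c : W) (hab : a ≠ b) (hac : a ≠ c) (hbc : b ≠ c) :
    (Gate.toffoli a b c hab hac hbc).mat =
      basisMap fun x => Function.update x c (xor (x c) (x a && x b)) := rfl

theorem Gate.mat_inv (g : Gate W) : g.inv.mat = g.matᴴ := by
  cases g with
  | one u a =>
    rw [Gate.inv, Gate.mat_one, Gate.mat_one, Splitting.op_conjTranspose _ _ fun _ _ _ => rfl]
    rfl
  | two u a b hab =>
    rw [Gate.inv, Gate.mat_two, Gate.mat_two, Splitting.op_conjTranspose _ _ fun _ _ _ => rfl]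
    rfl
  | toffoli a b c hab hac hbc =>
    rw [Gate.inv, Gate.mat_toffoli, (toffoli_involutive hac hbc).basisMap_conjTranspose]

theorem Gate.conjTranspose_mul_self (g : Gate W) : g.matᴴ * g.mat = 1 := by
  cases g with
  | one u a =>
    rw [Gate.mat_one, Splitting.op_conjTranspose _ _ fun _ _ _ => rfl,
      Splitting.op_mul _ _ _ fun _ _ _ => rfl]
    have := (Matrix.mem_unitaryGroup_iff').1 u.2
    rw [Matrix.star_eq_conjTranspose] at this
    simp only [this, Splitting.op_one]
  | two u a b hab =>
    rw [Gate.mat_two, Splitting.op_conjTranspose _ _ fun _ _ _ => rfl,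
      Splitting.op_mul _ _ _ fun _ _ _ => rfl]
    have := (Matrix.mem_unitaryGroup_iff').1 u.2
    rw [Matrix.star_eq_conjTranspose] at this
    simp only [this, Splitting.op_one]
  | toffoli a b c hab hac hbc =>
    rw [Gate.mat_toffoli, (toffoli_involutive hac hbc).basisMap_conjTranspose, basisMap_mul, (toffoli_involutive hac hbc).comp_self,
      basisMap_id]

namespace Circuit

@[simp]
theorem mat_nil : mat ([] : Circuit W) = 1 := rfl

theorem mat_cons (g : Gate W) (c : Circuit W) : mat (g :: c) = c.mat * g.mat := rfl

theorem mat_singleton (g : Gate W) : mat [g] = g.mat := by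
  rw [mat_cons, mat_nil, one_mul]

theorem mat_append (c c' : Circuit W) : mat (c ++ c') = mat c' * mat c := by
  induction c with
  | nil => simp
  | cons g c ih => rw [List.cons_append, mat_cons, mat_cons, ih, mul_assoc]

theorem mat_rep (c : Circuit W) (k : ℕ) : (c.rep k).mat = c.mat ^ k := by
  induction k with
  | zero => simp [rep]
  | succ k ih =>
    have : c.rep (k + 1) = c ++ c.rep k := by simp [rep, List.replicate_succ]
    rw [this, mat_append, ih, pow_succ]

theorem conjTranspose_mul_self (c : Circuit W) : (mat c)ᴴ * mat c = 1 := by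
  induction c with
  | nil => simp
  | cons g c ih =>
    rw [mat_cons, Matrix.conjTranspose_mul, mul_assoc, ← mul_assoc _ (mat c), ih, one_mul,
      g.conjTranspose_mul_self]

theorem mul_conjTranspose_self (c : Circuit W) : mat c * (mat c)ᴴ = 1 :=
  mul_eq_one_comm.1 c.conjTranspose_mul_self

theorem mat_inv (c : Circuit W) : mat (inv c) = (mat c)ᴴ := by
  induction c with
  | nil => simp [inv]
  | cons g c ih =>
    have : inv (g :: c) = inv c ++ [g.inv] := by simp [inv]
    rw [this, mat_append, mat_singleton, ih, g.mat_inv, mat_cons, Matrix.conjTranspose_mul]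


end Circuit

/-! ### Operators that keep qubits in the state zero -/

/-- The basis state `x` has `|0⟩` on all qubits of `a`. -/
def IsZeroOn (a : W → Prop) (x : BitState W) : Prop := ∀ v, a v → x v = false

/-- The operator `A` maps states with `|0⟩` on the qubits of `a` to such states. -/
def PreservesZeros (a : W → Prop) (A : Matrix (BitState W) (BitState W) ℂ) : Prop :=
  ∀ y x, IsZeroOn a x → A y x ≠ 0 → IsZeroOn a y

/-- The columns of `X` are states with `|0⟩` on the qubits of `a`. -/
def SupportedOnZeros {ι : Type} (a : W → Prop) (X : Matrix (BitState W) ι ℂ) : Prop :=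
  ∀ y j, X y j ≠ 0 → IsZeroOn a y

theorem PreservesZeros.mul_supported {ι : Type} {a : W → Prop}
    {A : Matrix (BitState W) (BitState W) ℂ} (hA : PreservesZeros a A)
    {X : Matrix (BitState W) ι ℂ} (hX : SupportedOnZeros a X) : SupportedOnZeros a (A * X) := by
  intro y j h
  rw [Matrix.mul_apply] at h
  obtain ⟨z, -, hz⟩ := Finset.exists_ne_zero_of_sum_ne_zero h
  exact hA y z (hX z j (right_ne_zero_of_mul hz)) (left_ne_zero_of_mul hz)

theorem PreservesZeros.mul {a : W → Prop} {A B : Matrix (BitState W) (BitState W) ℂ}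
    (hA : PreservesZeros a A) (hB : PreservesZeros a B) : PreservesZeros a (A * B) := by
  intro y x hx h
  rw [Matrix.mul_apply] at h
  obtain ⟨z, -, hz⟩ := Finset.exists_ne_zero_of_sum_ne_zero h
  exact hA y z (hB z x hx (right_ne_zero_of_mul hz)) (left_ne_zero_of_mul hz)

theorem PreservesZeros.basisMap {a : W → Prop} {f : BitState W → BitState W}
    (hf : ∀ x, IsZeroOn a x → IsZeroOn a (f x)) : PreservesZeros a (basisMap f) := by
  intro y x hx h
  rw [basisMap_apply] at h
  have : y = f x := by by_contra h'; simp [h'] at h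
  exact this ▸ hf x hx

theorem PreservesZeros.op {T : Type} {a : W → Prop} {F : Splitting (BitState W) T}
    (hF : ∀ y x, F.rel y x → ∀ v, a v → y v = x v) (f : BitState W → Matrix T T ℂ) :
    PreservesZeros a (F.op f) := by
  intro y x hx h v hv
  rw [Splitting.op_apply] at h
  have : F.rel y x := by by_contra h'; simp [h'] at h
  rw [hF y x this v hv, hx v hv]

theorem PreservesZeros.gate_one {a : W → Prop} (u : Matrix.unitaryGroup Bool ℂ) {v : W}
    (hv : ¬ a v) : PreservesZeros a (Gate.one u v).mat := by
  rw [Gate.mat_one]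
  exact PreservesZeros.op (F := Splitting.oneQubit v)
    (fun y x h w hw => h w fun e => hv (e ▸ hw)) _

/-- A unitary operator that maps a coordinate subspace to itself does not map states outside of
this subspace into it. -/
theorem PreservesZeros.conjTranspose {a : W → Prop} {A : Matrix (BitState W) (BitState W) ℂ}
    (hA : PreservesZeros a A) (h : Aᴴ * A = 1) : PreservesZeros a Aᴴ := by
  classical
  have h' : A * Aᴴ = 1 := mul_eq_one_comm.1 h
  have hcol : ∀ x, ∑ y, ‖A y x‖ ^ 2 = 1 := fun x => by
    have := congr_fun (congr_fun h x) x
    rw [Matrix.mul_apply, Matrix.one_apply_eq] at this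
    simp only [Matrix.conjTranspose_apply, Complex.star_def, Complex.conj_mul'] at this
    exact_mod_cast this
  have hrow : ∀ x, ∑ y, ‖A x y‖ ^ 2 = 1 := fun x => by
    have := congr_fun (congr_fun h' x) x
    rw [Matrix.mul_apply, Matrix.one_apply_eq] at this
    simp only [Matrix.conjTranspose_apply, Complex.star_def, Complex.mul_conj'] at this
    exact_mod_cast this
  set s : Finset (BitState W) := Finset.univ.filter (IsZeroOn a) with hs
  -- The columns over `s` have all their weight inside the block `s × s`, so this block has weight
  -- `|s|`. The rows over `s` also have total weight `|s|`, so nothing is left for the entries to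
  -- the right of the block.
  have hsum : ∑ x ∈ s, ∑ y ∈ s, ‖A y x‖ ^ 2 = s.card := by
    rw [Finset.card_eq_sum_ones, Nat.cast_sum]
    refine Finset.sum_congr rfl fun x hx => ?_
    rw [Nat.cast_one, ← hcol x]
    refine Finset.sum_subset (Finset.subset_univ _) fun y _ hy => ?_
    by_contra hne
    have : A y x ≠ 0 := fun e => hne (by simp [e])
    exact hy (by simpa [hs] using hA y x (by simpa [hs] using hx) this)
  have hsum' : ∑ x ∈ s, ∑ y ∈ sᶜ, ‖A x y‖ ^ 2 = 0 := by
    have h1 : ∑ x ∈ s, ∑ y, ‖A x y‖ ^ 2 = s.card := by simp [hrow]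
    simp_rw [← Finset.sum_add_sum_compl s, Finset.sum_add_distrib] at h1
    rw [Finset.sum_comm, hsum] at h1
    linarith
  intro y x hx hne
  by_contra hy
  rw [Finset.sum_eq_zero_iff_of_nonneg fun _ _ => Finset.sum_nonneg fun _ _ => by positivity]
    at hsum'
  have h1 := hsum' x (by simpa [hs] using hx)
  rw [Finset.sum_eq_zero_iff_of_nonneg fun _ _ => by positivity] at h1
  have h2 := h1 y (by simpa [hs] using hy)
  apply hne
  rw [Matrix.conjTranspose_apply]
  have : A x y = 0 := by simpa using h2
  simp [this]

namespace Circuit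

theorem implements_mat (c : Circuit W) (a : W → Prop) : c.Implements a c.mat :=
  fun _ _ _ => rfl

theorem Implements.mono {c : Circuit W} {a b : W → Prop}
    {T : Matrix (BitState W) (BitState W) ℂ} (hc : c.Implements a T) (h : ∀ v, a v → b v) :
    c.Implements b T := fun x hx y => hc x (fun v hv => hx v (h v hv)) y

theorem Implements.congr {c : Circuit W} {a : W → Prop}
    {T T' : Matrix (BitState W) (BitState W) ℂ} (hc : c.Implements a T)
    (h : ∀ x, IsZeroOn a x → ∀ y, T y x = T' y x) : c.Implements a T' :=
  fun x hx y => (hc x hx y).trans (h x hx y)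

theorem Implements.preservesZeros {c : Circuit W} {a : W → Prop}
    {T : Matrix (BitState W) (BitState W) ℂ} (hc : c.Implements a T) (hT : PreservesZeros a T) :
    PreservesZeros a c.mat := fun y x hx h => hT y x hx (by rwa [hc x hx y] at h)

theorem Implements.mul_eq {ι : Type} {c : Circuit W} {a : W → Prop}
    {T : Matrix (BitState W) (BitState W) ℂ} (hc : c.Implements a T)
    {X : Matrix (BitState W) ι ℂ} (hX : SupportedOnZeros a X) : c.mat * X = T * X := by
  ext y j
  rw [Matrix.mul_apply, Matrix.mul_apply]
  refine Finset.sum_congr rfl fun z _ => ?_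
  by_cases h : X z j = 0
  · simp [h]
  · rw [hc z (hX z j h) y]

/-- The second circuit is known only on zeroed inputs, so the intermediate states of the first must
be of this kind. -/
theorem Implements.append {c c' : Circuit W} {a : W → Prop}
    {T T' : Matrix (BitState W) (BitState W) ℂ} (hc : c.Implements a T)
    (hT : PreservesZeros a T) (hc' : c'.Implements a T') :
    Circuit.Implements (c ++ c') a (T' * T) := by
  intro x hx y
  rw [mat_append, Matrix.mul_apply, Matrix.mul_apply]
  refine Finset.sum_congr rfl fun z _ => ?_
  rw [hc x hx z]
  by_cases h : T z x = 0
  · simp [h]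
  · rw [hc' z (hT z x hx h) y]

end Circuit

end circuits

/-! ### The cost of a circuit -/

namespace Circuit

variable {W : Type} (κ : GateCosts)

theorem cost_append (c c' : Circuit W) : cost κ (c ++ c') = cost κ c + cost κ c' := by
  simp [cost]

theorem cost_nonneg (c : Circuit W) : 0 ≤ cost κ c := by
  refine List.sum_nonneg fun x hx => ?_
  obtain ⟨g, -, rfl⟩ := List.mem_map.1 hx
  cases g <;> simp [Gate.cost]

theorem cost_inv (c : Circuit W) : cost κ (inv c) = cost κ c := by
  have : Gate.cost κ ∘ Gate.inv = (Gate.cost κ : Gate W → ℝ) := by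
    funext g; cases g <;> rfl
  simp [cost, inv, List.sum_reverse, this]

theorem cost_flatMap {ι : Type} (l : List ι) (f : ι → Circuit W) :
    cost κ (l.flatMap f) = (l.map fun i => cost κ (f i)).sum := by
  induction l with
  | nil => simp [cost]
  | cons i l ih => rw [List.flatMap_cons, cost_append, ih, List.map_cons, List.sum_cons]

theorem cost_rep (c : Circuit W) (k : ℕ) : cost κ (c.rep k) = k * cost κ c := by
  induction k with
  | zero => simp [rep, cost]
  | succ k ih =>
    have : c.rep (k + 1) = c ++ c.rep k := by simp [rep, List.replicate_succ]
    rw [this, cost_append, ih]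
    push_cast
    ring

end Circuit

end HamSim
end

open scoped NNReal

noncomputable section

namespace HamSim

set_option linter.unusedSectionVars false

open Matrix

/-! ### Permutations of the basis states that do not act on a factor -/

/-- The injective map `f` commutes with overwriting the factor `T`. -/
structure Splitting.Blind {S T : Type} (F : Splitting S T) (f : S → S) : Prop where
  injective : Function.Injective f
  lift : ∀ x t, f (F.lift x t) = F.lift (f x) t

namespace Splitting.Blind

variable {S T : Type} {F : Splitting S T} {f g : S → S}

theorem id : F.Blind id := ⟨Function.injective_id, fun _ _ => rfl⟩

theorem comp (hf : F.Blind f) (hg : F.Blind g) : F.Blind (f ∘ g) :=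
  ⟨hf.injective.comp hg.injective, fun x t => by
    rw [Function.comp_apply, hg.lift, hf.lift, Function.comp_apply]⟩

theorem proj_eq (hf : F.Blind f) (x : S) : F.proj (f x) = F.proj x := by
  conv_lhs => rw [← F.lift_proj x x (F.equivalence.refl x)]
  rw [hf.lift, F.proj_lift]

theorem rel_iff (hf : F.Blind f) (y x : S) : F.rel (f y) (f x) ↔ F.rel y x := by
  constructor
  · intro h
    have h1 := F.lift_proj _ _ h
    rw [← hf.lift] at h1
    rw [← hf.injective h1]
    exact F.rel_lift _ _
  · intro h
    rw [← F.lift_proj y x h, hf.lift]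
    exact F.rel_lift _ _

theorem op_apply (hf : F.Blind f) (g : S → Matrix T T ℂ) (y x : S) :
    F.op g (f y) (f x) = F.op (fun x => g (f x)) y x := by
  simp only [Splitting.op_apply, hf.rel_iff, hf.proj_eq]

end Splitting.Blind

theorem blind_update {n m L K : ℕ} {v : Wire n m L K} (hv : ¬ v.IsSys)
    (φ : BitState (Wire n m L K) → Bool)
    (hφ : ∀ x t, φ ((Splitting.system n m L K).lift x t) = φ x)
    (hinv : Function.Involutive fun x => Function.update x v (φ x)) :
    (Splitting.system n m L K).Blind fun x => Function.update x v (φ x) := by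
  refine ⟨hinv.injective, fun x t => ?_⟩
  ext u
  by_cases hu : u = v
  · subst hu
    rw [Function.update_self, hφ]
    cases u <;> simp_all [Splitting.system, Wire.IsSys]
  · rw [Function.update_of_ne hu]
    cases u <;> simp_all [Splitting.system]

theorem mat_not {W : Type} [Fintype W] [DecidableEq W] (a : W) :
    (Gate.one notGate a).mat = basisMap fun x => Function.update x a (!x a) := by
  ext y x
  rw [basisMap_apply]
  change (if ∀ v, v ≠ a → y v = x v then (if y a = x a then (0 : ℂ) else 1) else 0) = _
  by_cases h : ∀ v, v ≠ a → y v = x v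
  · have : y = Function.update x a (!x a) ↔ y a ≠ x a := by
      constructor
      · intro e; rw [e]; simp
      · intro e
        ext v
        by_cases hv : v = a
        · subst hv
          rw [Function.update_self]
          revert e
          cases y v <;> cases x v <;> simp
        · simp [hv, h v hv]
    rw [if_pos h]
    by_cases h' : y a = x a <;> simp [this, h']
  · have : y ≠ Function.update x a (!x a) := fun e => h fun v hv => by simp [e, hv]
    simp [h, this]

/-! ### The index register and the oracle circuit -/

namespace Wire

variable {n m L K : ℕ}

theorem indexValue_eq_ofBits (x : BitState (Wire n m L K)) :
    indexValue x = Nat.ofBits fun i => x (.idx i) := by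
  have key : ∀ (l : ℕ) (f : Fin l → Bool),
      (∑ i : Fin l, if f i then 2 ^ (i : ℕ) else 0) = Nat.ofBits f := by
    intro l
    induction l with
    | zero => intro f; simp
    | succ l ih =>
      intro f
      rw [Nat.ofBits_succ, Fin.sum_univ_succ, ← ih, Finset.mul_sum, add_comm]
      congr 1
      · refine Finset.sum_congr rfl fun i _ => ?_
        by_cases h : f i.succ <;> simp [h, pow_succ, mul_comm]
      · cases f 0 <;> simp
  exact key L fun i => x (.idx i)

theorem indexValue_eq_iff (x : BitState (Wire n m L K)) {k : ℕ} (hk : k < 2 ^ L) :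
    indexValue x = k ↔ ∀ i : Fin L, x (.idx i) = k.testBit i := by
  rw [indexValue_eq_ofBits]
  constructor
  · rintro rfl i
    rw [Nat.testBit_ofBits_lt _ _ i.2]
  · intro h
    simp_rw [h]
    rw [Nat.ofBits_testBit, Nat.mod_eq_of_lt hk]

end Wire

namespace Run

variable {n : ℕ} (D : Run n)

theorem Ω_lt_two_pow : D.Ω < 2 ^ D.indexBits := by
  have := Nat.le_pow_clog (b := 2) (by norm_num) (D.Ω + 1)
  exact this

/-- The permutation of basis states that is carried out by `flips`. -/
def flipMap (K : ℕ) (k : Fin D.Ω) (x : BitState (D.W K)) : BitState (D.W K)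
  | .idx i => xor (x (.idx i)) (!((k : ℕ) + 1).testBit i)
  | v => x v

theorem flipMap_involutive (K : ℕ) (k : Fin D.Ω) : Function.Involutive (D.flipMap K k) := by
  intro x
  ext v
  cases v <;> simp [flipMap]

theorem flips_mat (K : ℕ) (k : Fin D.Ω) : (D.flips K k).mat = basisMap (D.flipMap K k) := by
  have key : ∀ l : List (Fin D.indexBits), l.Nodup →
      Circuit.mat (l.map fun i => Gate.one notGate (Wire.idx i : D.W K)) =
        basisMap fun x v => match v with
          | .idx i => xor (x (.idx i)) (decide (i ∈ l))
          | v => x v := by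
    intro l
    induction l with
    | nil =>
      intro _
      rw [List.map_nil, Circuit.mat_nil, ← basisMap_id]
      congr 1
      funext x v
      cases v <;> simp
    | cons i l ih =>
      intro hl
      rw [List.map_cons, Circuit.mat_cons, ih hl.of_cons, mat_not, basisMap_mul]
      congr 1
      funext x v
      have hi : i ∉ l := (List.nodup_cons.1 hl).1
      cases v with
      | idx j =>
        by_cases h : j = i
        · subst h; simp [hi]
        · simp [h]
      | _ => simp
  rw [flips, key _ ((List.nodup_finRange _).filter _)]
  congr 1
  funext x v
  cases v <;> simp [flipMap]

theorem flipMap_blind (K : ℕ) (k : Fin D.Ω) :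
    (Splitting.system n D.numFactors D.indexBits K).Blind (D.flipMap K k) := by
  refine ⟨(D.flipMap_involutive K k).injective, fun x t => ?_⟩
  ext v
  cases v <;> rfl

/-- A Toffoli gate adds the conjunction of its controls to its target, hence writes it when the
target is `false`. The spec also records that the permutation ignores the system, so that it can be
conjugated through a controlled query. -/
theorem ladder_spec (K : ℕ) : ∃ f, (D.ladder K).mat = basisMap f ∧
    (Splitting.system n D.numFactors D.indexBits K).Blind f ∧
    ∀ x, IsZeroOn Wire.IsAncilla x → (∀ v, (∀ i, v ≠ .anc i) → f x v = x v) ∧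
      ∀ i (hi : i < D.indexBits),
        f x (Wire.conj i hi) = decide (∀ i' : Fin D.indexBits, (i' : ℕ) ≤ i → x (.idx i')) := by
  -- Induction over initial pieces of the ladder; the invariant that ancillas not yet reached are
  -- still `false` is what makes the next gate write rather than add.
  have key : ∀ j ≤ D.indexBits - 1, ∃ f, Circuit.mat ((D.ladder K).take j) = basisMap f ∧
      (Splitting.system n D.numFactors D.indexBits K).Blind f ∧
      ∀ x, IsZeroOn Wire.IsAncilla x → (∀ v, (∀ i, v ≠ .anc i) → f x v = x v) ∧
        (∀ i : Fin (D.indexBits - 1), j ≤ i → f x (.anc i) = false) ∧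
        ∀ i (hi : i < D.indexBits), i ≤ j →
          f x (Wire.conj i hi) =
            decide (∀ i' : Fin D.indexBits, (i' : ℕ) ≤ i → x (.idx i')) := by
    intro j
    induction j with
    | zero =>
      intro _
      refine ⟨id, by rw [basisMap_id]; simp, .id, fun x hx => ⟨fun _ _ => rfl,
        fun i _ => hx _ trivial, fun i hi hi0 => ?_⟩⟩
      obtain rfl : i = 0 := by omega
      rw [Bool.eq_iff_iff, decide_eq_true_iff]
      constructor
      · intro h i' hi'
        obtain rfl : i' = ⟨0, hi⟩ := Fin.ext (by simpa using hi')
        exact h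
      · intro h
        exact h ⟨0, hi⟩ le_rfl
    | succ j ih =>
      intro hj
      obtain ⟨f, hmat, hf, hx⟩ := ih (by omega)
      have hlen : j < (D.ladder K).length := by simp [ladder]; omega
      have hL : j + 1 < D.indexBits := by omega
      set g : BitState (D.W K) → BitState (D.W K) := fun x =>
        Function.update x (.anc ⟨j, by omega⟩) (xor (x (.anc ⟨j, by omega⟩))
          (x (Wire.conj j (by omega)) && x (.idx ⟨j + 1, hL⟩))) with hg
      have hca : (Wire.conj j (by omega) : D.W K) ≠ .anc ⟨j, by omega⟩ := by
        cases j <;> simp [Wire.conj]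
      have hgate : (D.ladder K)[j].mat = basisMap g := by
        simp only [ladder, List.getElem_map, List.getElem_finRange, Gate.mat_toffoli]
        rfl
      have hgb : (Splitting.system n D.numFactors D.indexBits K).Blind g := by
        refine blind_update (by simp [Wire.IsSys]) _ ?_ (toffoli_involutive hca (by simp))
        intro x t
        cases j <;> rfl
      refine ⟨g ∘ f, ?_, hgb.comp hf, fun x hx0 => ?_⟩
      · rw [List.take_succ_eq_append_getElem hlen, Circuit.mat_append, Circuit.mat_singleton,
          hmat, hgate, basisMap_mul]
      · obtain ⟨h1, h2, h3⟩ := hx x hx0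
        refine ⟨fun v hv => ?_, fun i hi => ?_, fun i hi hij => ?_⟩
        · simp only [hg, Function.comp_apply]
          rw [Function.update_of_ne (hv _), h1 v hv]
        · simp only [hg, Function.comp_apply]
          rw [Function.update_of_ne (by rintro ⟨⟩; simp at hi), h2 i (by omega)]
        · simp only [hg, Function.comp_apply]
          rcases Nat.lt_or_ge j i with h | h
          · obtain rfl : i = j + 1 := by omega
            have hc : (Wire.conj (j + 1) hi : D.W K) = .anc ⟨j, by omega⟩ := rfl
            rw [hc, Function.update_self, h2 ⟨j, by omega⟩ le_rfl, h3 j (by omega) le_rfl, h1 _ (by simp),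
              Bool.false_xor, Bool.eq_iff_iff, Bool.and_eq_true, decide_eq_true_iff,
              decide_eq_true_iff]
            constructor
            · rintro ⟨ha, hb⟩ i' hi'
              rcases Nat.lt_or_ge j i' with h' | h'
              · obtain rfl : i' = ⟨j + 1, hL⟩ := Fin.ext (by simp; omega)
                exact hb
              · exact ha i' h'
            · intro ha
              exact ⟨fun i' hi' => ha i' (by omega), ha ⟨j + 1, hL⟩ le_rfl⟩
          · rw [Function.update_of_ne, h3 i hi h]
            cases i with
            | zero => simp [Wire.conj]
            | succ i =>
              simp only [Wire.conj, ne_eq, Wire.anc.injEq, Fin.mk.injEq]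
              omega
  obtain ⟨f, hmat, hf, hx⟩ := key _ le_rfl
  refine ⟨f, ?_, hf, fun x hx0 => ⟨(hx x hx0).1, fun i hi => (hx x hx0).2.2 i hi (by omega)⟩⟩
  rwa [List.take_of_length_le (by simp [ladder])] at hmat

/-- The operator that a single index value contributes to the oracle. -/
def indexedQuery (K : ℕ) (k : Fin D.Ω) (x : BitState (D.W K)) :
    Matrix (BitState (Fin n)) (BitState (Fin n)) ℂ :=
  if Wire.indexValue x = k + 1 then D.queryUnitary k else 1

end Run

namespace Wire

variable {n m L K : ℕ}

theorem indexValue_congr {y x : BitState (Wire n m L K)}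
    (h : (Splitting.system n m L K).rel y x) : indexValue y = indexValue x := by
  unfold indexValue
  refine Finset.sum_congr rfl fun i _ => ?_
  rw [h (.idx i) (by simp [IsSys])]

theorem preservesZeros_onSystem {a : Wire n m L K → Prop} (ha : ∀ v, a v → ¬ v.IsSys)
    (f : BitState (Wire n m L K) → Matrix (BitState (Fin n)) (BitState (Fin n)) ℂ) :
    PreservesZeros a (onSystem f) :=
  PreservesZeros.op (F := Splitting.system n m L K) (fun _ _ h v hv => h v (ha v hv)) f

theorem onSystem_mul
    (f g : BitState (Wire n m L K) → Matrix (BitState (Fin n)) (BitState (Fin n)) ℂ)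
    (hf : ∀ y x, (Splitting.system n m L K).rel y x → f y = f x) :
    onSystem f * onSystem g = onSystem fun x => f x * g x :=
  (Splitting.system n m L K).op_mul f g hf

theorem onSystem_one : onSystem (fun _ => 1) = (1 : Matrix (BitState (Wire n m L K)) _ ℂ) :=
  (Splitting.system n m L K).op_one

/-- Circuits that act on the system, conditioned on the other qubits, one after the other. -/
theorem implements_flatMap {ι : Type} {a : Wire n m L K → Prop} (ha : ∀ v, a v → ¬ v.IsSys)
    (c : ι → Circuit (Wire n m L K))
    (f : ι → BitState (Wire n m L K) → Matrix (BitState (Fin n)) (BitState (Fin n)) ℂ)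
    (hf : ∀ i y x, (Splitting.system n m L K).rel y x → f i y = f i x)
    (hc : ∀ i, (c i).Implements a (onSystem (f i))) (l : List ι) :
    Circuit.Implements (l.flatMap c) a
      (onSystem fun x => (l.map fun i => f i x).reverse.prod) := by
  induction l with
  | nil =>
    simp only [List.flatMap_nil, List.map_nil, List.reverse_nil, List.prod_nil, onSystem_one]
    exact Circuit.implements_mat _ _
  | cons i l ih =>
    rw [List.flatMap_cons]
    refine ((hc i).append (preservesZeros_onSystem ha _) ih).congr fun x hx y => ?_
    rw [onSystem_mul]
    · simp
    · intro y x h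
      simp only [hf _ y x h]

end Wire

namespace Run

variable {n : ℕ} {D : Run n} {K : ℕ} (S : D.Compilation K)

/-- The block is the controlled query conjugated by the permutation `π` made of the flips and the
ladder, so its entry at `(y, x)` is that of the query at `(π y, π x)`. As `π` does not see the
system, only the control condition changes: after the flips all index bits are `1` exactly when the
index was `k + 1`. -/
theorem queryBlock_implements (k : Fin D.Ω) :
    Circuit.Implements
      (D.flips K k ++ D.ladder K ++ S.query k ++ (D.ladder K).inv ++ D.flips K k)
      Wire.IsAncilla (Wire.onSystem (D.indexedQuery K k)) := by
  obtain ⟨f, hmat, hf, hx⟩ := D.ladder_spec K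
  intro x hx0 y
  have hmat' : Circuit.mat
      (D.flips K k ++ D.ladder K ++ S.query k ++ (D.ladder K).inv ++ D.flips K k) =
      (basisMap (f ∘ D.flipMap K k))ᴴ * (S.query k).mat * basisMap (f ∘ D.flipMap K k) := by
    simp only [Circuit.mat_append, Circuit.mat_inv]
    rw [← basisMap_mul, Matrix.conjTranspose_mul, hmat, D.flips_mat,
      (D.flipMap_involutive K k).basisMap_conjTranspose]
    simp only [mul_assoc]
  rw [hmat', conjTranspose_basisMap_mul_basisMap]
  have hflip : IsZeroOn Wire.IsAncilla (D.flipMap K k x) := by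
    intro v hv
    have := hx0 v hv
    cases v <;> simp_all [flipMap, Wire.IsAncilla]
  obtain ⟨h1, h2⟩ := hx _ hflip
  -- The conjunction ancillas now carry data; only the work qubits are still `|0⟩`, which is all
  -- that `query_spec` requires.
  have hwork : IsZeroOn Wire.IsWork (f (D.flipMap K k x)) := by
    intro v hv
    have : ∀ i, v ≠ .anc i := by cases v <;> simp_all [Wire.IsWork]
    rw [h1 v this]
    refine hflip v ?_
    cases v <;> simp_all [Wire.IsWork, Wire.IsAncilla]
  refine (S.query_spec k _ hwork _).trans ?_
  rw [controlledQuery, onSystem_eq_op, onSystem_eq_op]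
  refine ((hf.comp (D.flipMap_blind K k)).op_apply _ y x).trans ?_
  rw [Splitting.op_apply, Splitting.op_apply]
  have hcond : f (D.flipMap K k x)
      (Wire.conj (D.indexBits - 1) (Nat.sub_lt (D.indexBits_pos k) one_pos)) = true ↔
      Wire.indexValue x = k + 1 := by
    rw [h2, decide_eq_true_iff, Wire.indexValue_eq_iff]
    · refine ⟨fun h i => ?_, fun h i _ => ?_⟩
      · have := h i (by omega)
        simp only [flipMap] at this
        cases hb : x (.idx i) <;> simp_all
      · simp only [flipMap, h i]
        cases ((k : ℕ) + 1).testBit i <;> rfl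
    · have := D.Ω_lt_two_pow
      omega
  have hU : (if f (D.flipMap K k x)
      (Wire.conj (D.indexBits - 1) (Nat.sub_lt (D.indexBits_pos k) one_pos)) = true then
      D.queryUnitary k else 1) = D.indexedQuery K k x := if_congr hcond rfl rfl
  rw [← hU]
  rfl

theorem indexedQuery_congr (k : Fin D.Ω) {y x : BitState (D.W K)}
    (h : (Splitting.system n D.numFactors D.indexBits K).rel y x) :
    D.indexedQuery K k y = D.indexedQuery K k x := by
  unfold indexedQuery
  rw [Wire.indexValue_congr h]

/-- The unitary that the oracle applies for the index value `v`. -/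
def valueUnitary (D : Run n) (v : ℕ) : Matrix (BitState (Fin n)) (BitState (Fin n)) ℂ :=
  if h : 0 < v ∧ v ≤ D.Ω then D.queryUnitary ⟨v - 1, by omega⟩ else 1

theorem oracle_eq : D.oracle K = Wire.onSystem fun x => D.valueUnitary (Wire.indexValue x) := rfl

theorem oracleCircuit_implements :
    S.oracleCircuit.Implements Wire.IsAncilla (D.oracle K) := by
  refine (Wire.implements_flatMap ?_ _ (D.indexedQuery K)
    (fun k y x h => indexedQuery_congr k h) (queryBlock_implements S) _).congr ?_
  · intro v hv
    cases v <;> simp_all [Wire.IsAncilla, Wire.IsSys]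
  · intro x _ y
    rw [oracle_eq, onSystem_eq_op, onSystem_eq_op, Splitting.op_apply, Splitting.op_apply]
    congr 2
    -- At most one block of a duplicate-free list matches the index value, so the order of the
    -- product is irrelevant.
    have key : ∀ l : List (Fin D.Ω), l.Nodup →
        (l.map fun k => D.indexedQuery K k x).reverse.prod =
          if ∃ k ∈ l, Wire.indexValue x = k + 1 then D.valueUnitary (Wire.indexValue x)
          else 1 := by
      intro l
      induction l with
      | nil => simp
      | cons k l ih =>
        intro hl
        rw [List.map_cons, List.reverse_cons, List.prod_append, ih hl.of_cons,
          List.prod_singleton, indexedQuery]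
        have hk : k ∉ l := (List.nodup_cons.1 hl).1
        by_cases h : Wire.indexValue x = k + 1
        · have h1 : ¬ ∃ k ∈ l, Wire.indexValue x = k + 1 := by
            rintro ⟨k', hk', h'⟩
            have : k = k' := Fin.ext (by omega)
            exact hk (this ▸ hk')
          have h2 : ∃ k' ∈ k :: l, Wire.indexValue x = k' + 1 := ⟨k, by simp, h⟩
          rw [if_neg h1, if_pos h2, if_pos h, one_mul, valueUnitary,
            dif_pos ⟨by omega, by omega⟩]
          congr 1
          exact Fin.ext (by simp [h])
        · have : (∃ k' ∈ k :: l, Wire.indexValue x = k' + 1) ↔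
              ∃ k ∈ l, Wire.indexValue x = k + 1 := by simp [h]
          simp only [if_neg h, mul_one, this]
    rw [key _ (List.nodup_finRange _)]
    by_cases h : 0 < Wire.indexValue x ∧ Wire.indexValue x ≤ D.Ω
    · rw [if_pos ⟨⟨Wire.indexValue x - 1, by omega⟩, by simp, by simp; omega⟩]
    · have h' : ¬ ∃ k ∈ List.finRange D.Ω, Wire.indexValue x = (k : ℕ) + 1 := by
        rintro ⟨k, -, hk⟩
        exact h ⟨by omega, by omega⟩
      rw [if_neg h', valueUnitary, dif_neg h]

end Run

end HamSim
end

open scoped NNReal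

noncomputable section

namespace HamSim

set_option linter.unusedSectionVars false

open Matrix

/-! ### Layers of one-qubit gates -/

theorem mat_layer {W ι : Type} [Fintype W] [DecidableEq W] {e : ι → W}
    (he : Function.Injective e) (u : ι → Matrix.unitaryGroup Bool ℂ) :
    ∀ l : List ι, l.Nodup → ∀ y x : BitState W,
      Circuit.mat (l.map fun i => Gate.one (u i) (e i)) y x =
        if ∀ v, (∀ i ∈ l, v ≠ e i) → y v = x v then
          (l.map fun i => (u i).1 (y (e i)) (x (e i))).prod else 0
  | [], _, y, x => by
    simp only [List.map_nil, Circuit.mat_nil, Matrix.one_apply, List.not_mem_nil,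
      false_imp_iff, implies_true, true_imp_iff, List.prod_nil]
    exact if_congr funext_iff rfl rfl
  | i :: l, hl, y, x => by
    have hi : i ∉ l := (List.nodup_cons.1 hl).1
    rw [List.map_cons, Circuit.mat_cons, Matrix.mul_apply,
      -- The first gate changes only the qubit `e i`, and the later gates do not touch it, so it
      -- must already have its final value.
      Finset.sum_eq_single (Function.update x (e i) (y (e i)))]
    · rw [mat_layer he u l hl.of_cons]
      have h1 : (Gate.one (u i) (e i)).mat (Function.update x (e i) (y (e i))) x =
          (u i).1 (y (e i)) (x (e i)) := by
        rw [Gate.mat_one, Splitting.op_apply, if_pos]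
        · simp [Splitting.oneQubit]
        · intro v hv; simp [hv]
      have h2 : (∀ v, (∀ j ∈ l, v ≠ e j) → y v = Function.update x (e i) (y (e i)) v) ↔
          ∀ v, (∀ j ∈ i :: l, v ≠ e j) → y v = x v := by
        constructor
        · intro h v hv
          rw [h v fun j hj => hv j (List.mem_cons_of_mem _ hj),
            Function.update_of_ne (hv i List.mem_cons_self)]
        · intro h v hv
          by_cases hvi : v = e i
          · subst hvi; simp
          · rw [Function.update_of_ne hvi]
            exact h v fun j hj => by
              rcases List.mem_cons.1 hj with rfl | hj
              · exact hvi
              · exact hv j hj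
      rw [h1, List.map_cons, List.prod_cons, mul_comm, mul_ite, mul_zero, if_congr h2 rfl rfl]
      congr 2
      congr 1
      refine List.map_congr_left fun j hj => ?_
      rw [Function.update_of_ne]
      exact fun h => hi (he h ▸ hj)
    · intro z _ hz
      rw [mat_layer he u l hl.of_cons]
      by_cases h1 : ∀ v, (∀ j ∈ l, v ≠ e j) → y v = z v
      · have h2 : (Gate.one (u i) (e i)).mat z x = 0 := by
          rw [Gate.mat_one, Splitting.op_apply, if_neg]
          intro h
          apply hz
          ext v
          by_cases hv : v = e i
          · subst hv
            rw [Function.update_self, h1 _ fun j hj h => hi (by rwa [he h])]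
          · rw [Function.update_of_ne hv]
            exact h v hv
        rw [h2, mul_zero]
      · rw [if_neg h1, zero_mul]
    · simp

/-! ### Embeddings of the system, one for each value of the control qubits -/

namespace Wire

variable {n m L K : ℕ}

/-- The qubits that are in the state `|0⟩` between the queries. -/
def IsScratch : Wire n m L K → Prop
  | .idx _ => True
  | .anc _ => True
  | .work _ => True
  | _ => False

theorem not_isSys_of_isScratch (v : Wire n m L K) (h : v.IsScratch) : ¬ v.IsSys := by
  cases v <;> simp_all [IsScratch, IsSys]

/-- The basis state with the given values of the system and of the control qubits and with all
other qubits in `|0⟩`. -/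
def basisState (b : Fin m → Bool) (p : BitState (Fin n)) : BitState (Wire n m L K)
  | .sys i => p i
  | .ctrl i => b i
  | _ => false

theorem basisState_injective {b b' : Fin m → Bool} {p p' : BitState (Fin n)}
    (h : (basisState b p : BitState (Wire n m L K)) = basisState b' p') : b = b' ∧ p = p' :=
  ⟨funext fun i => congr_fun h (.ctrl i), funext fun i => congr_fun h (.sys i)⟩

theorem isZeroOn_basisState (b : Fin m → Bool) (p : BitState (Fin n)) :
    IsZeroOn IsScratch (basisState b p : BitState (Wire n m L K)) := by
  intro v hv
  cases v <;> simp_all [IsScratch, basisState]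

/-- The isometry `|p⟩ ↦ |b⟩ ⊗ |p⟩` from the system to the whole register. -/
def embedding (n L K : ℕ) (b : Fin m → Bool) :
    Matrix (BitState (Wire n m L K)) (BitState (Fin n)) ℂ :=
  Matrix.of fun x p => if x = basisState b p then 1 else 0

theorem embedding_apply (b : Fin m → Bool) (x : BitState (Wire n m L K)) (p : BitState (Fin n)) :
    embedding n L K b x p = if x = basisState b p then 1 else 0 := rfl

theorem mul_embedding_apply {ι : Type} (A : Matrix ι (BitState (Wire n m L K)) ℂ)
    (b : Fin m → Bool) (i : ι) (p : BitState (Fin n)) :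
    (A * embedding n L K b) i p = A i (basisState b p) := by
  simp [Matrix.mul_apply, embedding_apply]

theorem embedding_mul_apply {ι : Type} (A : Matrix (BitState (Wire n m L K)) ι ℂ)
    (b : Fin m → Bool) (q : BitState (Fin n)) (i : ι) :
    ((embedding n L K b)ᴴ * A) q i = A (basisState b q) i := by
  simp [Matrix.mul_apply, embedding_apply, Matrix.conjTranspose_apply, apply_ite]

theorem embedding_isometry (b : Fin m → Bool) :
    (embedding n L K b)ᴴ * (embedding n L K b) = (1 : Matrix (BitState (Fin n)) _ ℂ) := by
  ext q p
  rw [embedding_mul_apply, embedding_apply, Matrix.one_apply]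
  exact if_congr ⟨fun h => (basisState_injective h).2, fun h => h ▸ rfl⟩ rfl rfl

theorem supportedOnZeros_embedding (b : Fin m → Bool) :
    SupportedOnZeros IsScratch (embedding n L K b) := by
  intro y p h
  rw [embedding_apply] at h
  have : y = basisState b p := by by_contra h'; simp [h'] at h
  exact this ▸ isZeroOn_basisState b p

theorem embedding_mulVec (ψ : BitState (Fin n) → ℂ) :
    (embedding n L K fun _ : Fin m => false) *ᵥ ψ = initState ψ := by
  ext x
  simp only [Matrix.mulVec, dotProduct, embedding_apply, ite_mul, one_mul, zero_mul, initState]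
  by_cases h : ∀ v, ¬ v.IsSys → x v = false
  · rw [if_pos h, Finset.sum_eq_single (sysPart x), if_pos]
    · ext v
      have := h v
      cases v <;> simp_all [IsSys, basisState, sysPart]
    · intro p _ hp
      rw [if_neg]
      rintro rfl
      exact hp rfl
    · simp
  · rw [if_neg h]
    refine Finset.sum_eq_zero fun p _ => if_neg ?_
    rintro rfl
    apply h
    intro v hv
    cases v <;> simp_all [IsSys, basisState]

/-- A state agrees with `basisState b p` if it does so on the control qubits and off them. -/
theorem eq_basisState_iff (b b' : Fin m → Bool) (p : BitState (Fin n))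
    (x : BitState (Wire n m L K)) :
    x = basisState b p ↔
      (∀ v, (∀ i, v ≠ .ctrl i) → x v = basisState b' p v) ∧ b = fun i => x (.ctrl i) := by
  constructor
  · rintro rfl
    refine ⟨fun v hv => ?_, rfl⟩
    cases v <;> simp_all [basisState]
  · rintro ⟨h, rfl⟩
    ext v
    have := h v
    cases v <;> simp_all [basisState]

/-- A layer of equal gates on the control qubits. -/
def ctrlLayer (n m L K : ℕ) (u : Matrix.unitaryGroup Bool ℂ) : Circuit (Wire n m L K) :=
  (List.finRange m).map fun i => Gate.one u (.ctrl i)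

theorem ctrlLayer_mat (u : Matrix.unitaryGroup Bool ℂ) (y x : BitState (Wire n m L K)) :
    (ctrlLayer n m L K u).mat y x =
      if ∀ v, (∀ i, v ≠ .ctrl i) → y v = x v then ∏ i, u.1 (y (.ctrl i)) (x (.ctrl i))
      else 0 := by
  rw [ctrlLayer, mat_layer (e := Wire.ctrl) (fun i j h => by injection h) (fun _ => u) _
    (List.nodup_finRange _), Fin.prod_univ_def]
  simp

theorem ctrlLayer_mul_embedding (u : Matrix.unitaryGroup Bool ℂ) (b : Fin m → Bool) :
    (ctrlLayer n m L K u).mat * embedding n L K b =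
      ∑ b', (∏ i, u.1 (b' i) (b i)) • embedding n L K b' := by
  ext x p
  rw [mul_embedding_apply, ctrlLayer_mat, Matrix.sum_apply]
  simp only [Matrix.smul_apply, embedding_apply, eq_basisState_iff _ b, smul_eq_mul, mul_ite,
    mul_one, mul_zero, ite_and]
  by_cases h : ∀ v, (∀ i, v ≠ .ctrl i) → x v = basisState b p v
  · have hb : ∀ i, (basisState b p : BitState (Wire n m L K)) (.ctrl i) = b i := fun _ => rfl
    simp [eq_true h, hb, -ne_eq]
  · simp [h]

theorem embedding_mul_ctrlLayer (u : Matrix.unitaryGroup Bool ℂ) (b : Fin m → Bool) :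
    (embedding n L K b)ᴴ * (ctrlLayer n m L K u).mat =
      ∑ b', (∏ i, u.1 (b i) (b' i)) • (embedding n L K b')ᴴ := by
  ext p x
  rw [embedding_mul_apply, ctrlLayer_mat, Matrix.sum_apply]
  have hcomm : (∀ v, (∀ i, v ≠ .ctrl i) → basisState b p v = x v) ↔
      ∀ v, (∀ i, v ≠ .ctrl i) → x v = basisState b p v :=
    forall₂_congr fun _ _ => eq_comm
  simp only [Matrix.smul_apply, Matrix.conjTranspose_apply, embedding_apply,
    eq_basisState_iff _ b, smul_eq_mul, ite_and, hcomm]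
  by_cases h : ∀ v, (∀ i, v ≠ .ctrl i) → x v = basisState b p v
  · have hb : ∀ i, (basisState b p : BitState (Wire n m L K)) (.ctrl i) = b i := fun _ => rfl
    simp [eq_true h, hb, -ne_eq, apply_ite]
  · simp [h]

theorem embedding_mul_diagonalLayer (u : Matrix.unitaryGroup Bool ℂ)
    (hu : ∀ y x, y ≠ x → u.1 y x = 0) (b : Fin m → Bool) :
    (embedding n L K b)ᴴ * (ctrlLayer n m L K u).mat =
      (∏ i, u.1 (b i) (b i)) • (embedding n L K b)ᴴ := by
  rw [embedding_mul_ctrlLayer, Finset.sum_eq_single b]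
  · intro b' _ hb
    obtain ⟨i, hi⟩ := Function.ne_iff.1 hb
    rw [Finset.prod_eq_zero (Finset.mem_univ i) (hu _ _ hi.symm), zero_smul]
  · simp

/-- On the range of the embedding for `b` the condition has a fixed value, so the operator passes to
the system as a single matrix. The system bits `false` at which `f` is evaluated are a placeholder.
-/
theorem embedding_mul_onSystem
    (f : BitState (Wire n m L K) → Matrix (BitState (Fin n)) (BitState (Fin n)) ℂ)
    (hf : ∀ y x, (Splitting.system n m L K).rel y x → f y = f x) (b : Fin m → Bool) :
    (embedding n L K b)ᴴ * onSystem f =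
      f (basisState b fun _ => false) * (embedding n L K b)ᴴ := by
  have hrel : ∀ p q, (Splitting.system n m L K).rel (basisState b p) (basisState b q) := by
    intro p q v hv
    cases v <;> simp_all [basisState, IsSys]
  ext q x
  rw [embedding_mul_apply, Matrix.mul_apply, onSystem_eq_op, Splitting.op_apply]
  simp only [Matrix.conjTranspose_apply, embedding_apply]
  have hx : ∀ p, x = basisState b p ↔
      (Splitting.system n m L K).rel (basisState b q) x ∧ p = sysPart x := by
    intro p
    constructor
    · rintro rfl
      exact ⟨hrel _ _, rfl⟩
    · rintro ⟨h, rfl⟩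
      ext v
      have := h v
      cases v <;> simp_all [basisState, IsSys, sysPart]
  by_cases h : (Splitting.system n m L K).rel (basisState b q) x
  · simp only [hx, h, true_and, if_true]
    rw [← hf _ _ h, hf _ _ (hrel q fun _ => false)]
    simp [apply_ite]
    rfl
  · simp [hx, h]

theorem embedding_mul_flag_mul_embedding (u : Matrix.unitaryGroup Bool ℂ)
    (b b' : Fin m → Bool) :
    (embedding n L K b)ᴴ * ((Gate.one u (Wire.flag : Wire n m L K)).mat * embedding n L K b') =
      if b = b' then u.1 false false • (1 : Matrix (BitState (Fin n)) (BitState (Fin n)) ℂ)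
      else 0 := by
  ext q p
  rw [embedding_mul_apply, mul_embedding_apply, Gate.mat_one, Splitting.op_apply]
  have hrel : (Splitting.oneQubit (Wire.flag : Wire n m L K)).rel
      (basisState b q) (basisState b' p) ↔ b = b' ∧ q = p := by
    constructor
    · intro h
      exact ⟨funext fun i => h (.ctrl i) (by simp), funext fun i => h (.sys i) (by simp)⟩
    · rintro ⟨rfl, rfl⟩
      exact fun _ _ => rfl
  by_cases hb : b = b'
  · by_cases hq : q = p
    · rw [if_pos (hrel.2 ⟨hb, hq⟩), if_pos hb, hq]
      simp [Splitting.oneQubit, basisState]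
    · rw [if_neg fun h => hq (hrel.1 h).2, if_pos hb]
      simp [hq]
  · rw [if_neg fun h => hb (hrel.1 h).1, if_neg hb]
    rfl

theorem preservesZeros_ctrlLayer (u : Matrix.unitaryGroup Bool ℂ) :
    PreservesZeros IsScratch (ctrlLayer n m L K u).mat := by
  intro y x hx h v hv
  rw [ctrlLayer_mat] at h
  have h' : ∀ v, (∀ i, v ≠ .ctrl i) → y v = x v := by by_contra h'; simp [h'] at h
  rw [h' v (by rintro i rfl; exact hv), hx v hv]

end Wire

end HamSim
end

open scoped NNReal

noncomputable section

namespace HamSim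

set_option linter.unusedSectionVars false

open Matrix

/-! ### Closure properties of states with zeroed qubits -/

section support

variable {W ι : Type} [Fintype W] [DecidableEq W] {a : W → Prop}

theorem SupportedOnZeros.mul_right {κ : Type} [Fintype ι] {X : Matrix (BitState W) ι ℂ}
    (hX : SupportedOnZeros a X) (B : Matrix ι κ ℂ) : SupportedOnZeros a (X * B) := by
  intro y j h
  rw [Matrix.mul_apply] at h
  obtain ⟨z, -, hz⟩ := Finset.exists_ne_zero_of_sum_ne_zero h
  exact hX y z (left_ne_zero_of_mul hz)

theorem SupportedOnZeros.sub {X Y : Matrix (BitState W) ι ℂ}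
    (hX : SupportedOnZeros a X) (hY : SupportedOnZeros a Y) : SupportedOnZeros a (X - Y) := by
  intro y j h
  by_cases h1 : X y j = 0
  · exact hY y j fun h2 => h (by simp [h1, h2])
  · exact hX y j h1

theorem SupportedOnZeros.smul {X : Matrix (BitState W) ι ℂ}
    (hX : SupportedOnZeros a X) (c : ℂ) : SupportedOnZeros a (c • X) :=
  fun y j h => hX y j fun h' => h (by simp [h'])

theorem SupportedOnZeros.mono {b : W → Prop} (h : ∀ v, a v → b v) {X : Matrix (BitState W) ι ℂ}
    (hX : SupportedOnZeros b X) : SupportedOnZeros a X :=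
  fun y j hy v hv => hX y j hy v (h v hv)

end support

/-- A list read off by position up to a given length, as a product. -/
theorem prod_map_finRange_getElem? {M ι : Type} [Monoid M] (g : ι → M) :
    ∀ (w : ℕ) (l : List ι),
      ((List.finRange w).map fun s : Fin w => (l[(s : ℕ)]?).elim 1 g).reverse.prod =
        ((l.take w).map g).reverse.prod
  | 0, l => by simp
  | w + 1, [] => by simp
  | w + 1, i :: l => by
    have ih := prod_map_finRange_getElem? g w l
    rw [List.finRange_succ, List.map_cons, List.reverse_cons, List.prod_append, List.map_map,
      List.take_succ_cons, List.map_cons, List.reverse_cons, List.prod_append]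
    simp only [Function.comp_def, Fin.val_succ, List.getElem?_cons_succ, Fin.val_zero,
      List.getElem?_cons_zero, Option.elim_some]
    rw [ih]

/-! ### The trial circuit and its amplification -/

namespace Run

variable {n : ℕ} {D : Run n} {K : ℕ} (S : D.Compilation K)

theorem slotIndex_congr (s : ℕ) {y x : BitState (D.W K)}
    (h : ∀ i, y (.ctrl i) = x (.ctrl i)) : D.slotIndex s y = D.slotIndex s x := by
  unfold slotIndex
  simp only [h]

theorem slotIndex_le (s : ℕ) (x : BitState (D.W K)) : D.slotIndex s x ≤ D.Ω := by
  unfold slotIndex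
  split
  · have := (D.factorMatrix ‹_›).2
    omega
  · omega

theorem loadMap_involutive (s : ℕ) : Function.Involutive (D.loadMap (K := K) s) := by
  intro x
  have h : D.slotIndex s (D.loadMap s x) = D.slotIndex s x := slotIndex_congr s fun _ => rfl
  ext v
  cases v <;> simp [loadMap, h]

theorem loadMap_blind (s : ℕ) :
    (Splitting.system n D.numFactors D.indexBits K).Blind (D.loadMap s) := by
  refine ⟨(loadMap_involutive s).injective, fun x t => ?_⟩
  have h : D.slotIndex s ((Splitting.system n D.numFactors D.indexBits K).lift x t) =
      D.slotIndex s x := slotIndex_congr s fun _ => rfl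
  ext v
  cases v <;> simp only [loadMap, h] <;> rfl

theorem indexValue_loadMap (s : ℕ) {x : BitState (D.W K)} (hx : IsZeroOn Wire.IsScratch x) :
    Wire.indexValue (D.loadMap s x) = D.slotIndex s x := by
  rw [Wire.indexValue_eq_iff _ (lt_of_le_of_lt (slotIndex_le s x) D.Ω_lt_two_pow)]
  intro i
  have : x (.idx i) = false := hx _ trivial
  simp [loadMap, this]

/-- This is the oracle conjugated by the self-inverse `loadMap`. On a zeroed index register, loading
writes the slot index itself, and since neither the oracle nor the loading changes the control
qubits, the second loading erases it. -/
theorem queryStep_implements (s : Fin D.w) :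
    Circuit.Implements (S.load s ++ S.oracleCircuit ++ S.load s) Wire.IsScratch
      (Wire.onSystem fun x => D.valueUnitary (D.slotIndex s x)) := by
  have hload : (S.load s).Implements Wire.IsAncilla (basisMap (D.loadMap s)) :=
    Circuit.Implements.mono (S.load_spec s) fun v hv => by
      cases v <;> simp_all [Wire.IsWork, Wire.IsAncilla]
  have hpres : PreservesZeros Wire.IsAncilla (basisMap (D.loadMap (K := K) s)) :=
    PreservesZeros.basisMap fun x hx v hv => by
      have := hx v hv
      cases v <;> simp_all [loadMap, Wire.IsAncilla]
  have hpres' : PreservesZeros Wire.IsAncilla (D.oracle K) :=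
    Wire.preservesZeros_onSystem (fun v hv => by
      cases v <;> simp_all [Wire.IsAncilla, Wire.IsSys]) _
  have h := ((hload.append hpres (oracleCircuit_implements S)).append (hpres'.mul hpres)
    hload).mono (b := Wire.IsScratch)
      fun v hv => by cases v <;> simp_all [Wire.IsScratch, Wire.IsAncilla]
  refine h.congr fun x hx y => ?_
  rw [← mul_assoc]
  nth_rewrite 1 [← (loadMap_involutive s).basisMap_conjTranspose]
  rw [conjTranspose_basisMap_mul_basisMap, oracle_eq, onSystem_eq_op]
  refine ((loadMap_blind s).op_apply _ y x).trans ?_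
  rw [onSystem_eq_op, Splitting.op_apply, Splitting.op_apply, indexValue_loadMap _ hx]

/-- The product of the first `w` queries that the control qubits `b` ask for. -/
def keptQueries (D : Run n) (b : Fin D.numFactors → Bool) :
    Matrix (BitState (Fin n)) (BitState (Fin n)) ℂ :=
  ((((List.finRange D.numFactors).filter fun i => b i).take D.w).map
    fun i => D.queryUnitary (D.factorMatrix i)).reverse.prod

theorem queries_implements :
    Circuit.Implements
      ((List.finRange D.w).flatMap fun s => S.load s ++ S.oracleCircuit ++ S.load s)
      Wire.IsScratch (Wire.onSystem fun x => D.keptQueries fun i => x (.ctrl i)) := by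
  refine (Wire.implements_flatMap Wire.not_isSys_of_isScratch _
    (fun (s : Fin D.w) x => D.valueUnitary (D.slotIndex s x)) (fun s y x h => ?_)
    (queryStep_implements S) _).congr fun x _ y => ?_
  · rw [slotIndex_congr _ fun i => h (.ctrl i) (by simp [Wire.IsSys])]
  · have key : ∀ s : Fin D.w, D.valueUnitary (D.slotIndex s x) =
        (((List.finRange D.numFactors).filter fun i => x (.ctrl i))[(s : ℕ)]?).elim 1
          fun i => D.queryUnitary (D.factorMatrix i) := by
      intro s
      unfold slotIndex
      cases h : ((List.finRange D.numFactors).filter fun i => x (.ctrl i))[(s : ℕ)]? with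
      | none => simp [valueUnitary]
      | some i =>
        have : (D.factorMatrix i : ℕ) + 1 ≤ D.Ω := (D.factorMatrix i).2
        simp [valueUnitary, this]
    rw [onSystem_eq_op, onSystem_eq_op, Splitting.op_apply, Splitting.op_apply, keptQueries,
      ← prod_map_finRange_getElem?]
    simp only [key]

/-- The isometry from the system to the register that prepares all other qubits in `|0⟩`. -/
abbrev zeroEmbedding (D : Run n) (K : ℕ) : Matrix (BitState (D.W K)) (BitState (Fin n)) ℂ :=
  Wire.embedding n D.indexBits K fun _ : Fin D.numFactors => false

/-- The reflection tests only the control qubits and the flag. On states with zeroed scratch qubits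
this already singles out the range of `J`, so there it equals `2 J J† - 1`. -/
theorem zeroReflection_mul {ι : Type} {X : Matrix (BitState (D.W K)) ι ℂ}
    (hX : SupportedOnZeros Wire.IsScratch X) :
    D.zeroReflection K * X =
      (2 : ℂ) • (D.zeroEmbedding K *
        ((D.zeroEmbedding K)ᴴ * X)) - X := by
  ext y j
  rw [zeroReflection, Matrix.diagonal_mul, Matrix.sub_apply, Matrix.smul_apply,
    Matrix.mul_apply]
  simp only [Wire.embedding_mul_apply, Wire.embedding_apply, ite_mul, one_mul, zero_mul]
  by_cases hy : IsZeroOn Wire.IsScratch y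
  · by_cases h : (∀ i, y (.ctrl i) = false) ∧ y .flag = false
    · have hyp : ∀ p, y = Wire.basisState (fun _ => false) p ↔ p = Wire.sysPart y := by
        intro p
        constructor
        · rintro rfl; rfl
        · rintro rfl
          ext v
          have := hy v
          cases v <;> simp_all [Wire.basisState, Wire.IsScratch, Wire.sysPart]
      have hyy : Wire.basisState (fun _ => false) (Wire.sysPart y) = y := ((hyp _).2 rfl).symm
      simp only [hyp, Finset.sum_ite_eq', Finset.mem_univ, if_true, if_pos h, hyy, smul_eq_mul]
      ring
    · have hyp : ∀ p, y ≠ Wire.basisState (fun _ => false) p := by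
        rintro p rfl
        exact h ⟨fun _ => rfl, rfl⟩
      simp [hyp, h]
  · have h0 : X y j = 0 := by_contra fun h => hy (hX y j h)
    have hyp : ∀ p, y ≠ Wire.basisState (fun _ => false) p := by
      rintro p rfl
      exact hy (Wire.isZeroOn_basisState _ _)
    simp [hyp, h0]

theorem reflect_mul {ι : Type} {X : Matrix (BitState (D.W K)) ι ℂ}
    (hX : SupportedOnZeros Wire.IsScratch X) :
    S.reflect.mat * X =
      (2 : ℂ) • (D.zeroEmbedding K *
        ((D.zeroEmbedding K)ᴴ * X)) - X := by
  rw [← zeroReflection_mul hX]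
  exact Circuit.Implements.mul_eq (a := Wire.IsWork) S.reflect_spec
    (hX.mono fun v hv => by cases v <;> simp_all [Wire.IsWork, Wire.IsScratch])

/-- The one-qubit gate of `prepare`. -/
def prepareGate (D : Run n) : Matrix.unitaryGroup Bool ℂ :=
  reflectionGate (Real.arccos (Real.sqrt
    (Real.cos D.angle / (Real.cos D.angle + Real.sin D.angle))))

/-- The one-qubit gate of `flagGate`. -/
def flagUnitary (D : Run n) : Matrix.unitaryGroup Bool ℂ :=
  reflectionGate (Real.arccos ((Real.cos D.angle + Real.sin D.angle) ^ D.numFactors / 2))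

theorem trial_mat : S.trial.mat =
    (Wire.ctrlLayer n D.numFactors D.indexBits K D.prepareGate).mat *
      ((Wire.ctrlLayer n D.numFactors D.indexBits K phaseGate).mat *
        (Circuit.mat
            ((List.finRange D.w).flatMap fun s => S.load s ++ S.oracleCircuit ++ S.load s) *
          ((Gate.one D.flagUnitary (Wire.flag : D.W K)).mat *
            (Wire.ctrlLayer n D.numFactors D.indexBits K D.prepareGate).mat))) := by
  have h1 : S.prepare = Wire.ctrlLayer n D.numFactors D.indexBits K D.prepareGate := rfl
  have h2 : S.phases = Wire.ctrlLayer n D.numFactors D.indexBits K phaseGate := rfl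
  have h3 : S.flagGate = Gate.one D.flagUnitary (Wire.flag : D.W K) := rfl
  rw [Compilation.trial, h1, h2, h3]
  simp only [Circuit.mat_append, Circuit.mat_singleton]

theorem preservesZeros_trial : PreservesZeros Wire.IsScratch S.trial.mat := by
  rw [trial_mat]
  refine (Wire.preservesZeros_ctrlLayer _).mul ((Wire.preservesZeros_ctrlLayer _).mul
    (((queries_implements S).preservesZeros
      (Wire.preservesZeros_onSystem Wire.not_isSys_of_isScratch _)).mul
        ((PreservesZeros.gate_one _ ?_).mul (Wire.preservesZeros_ctrlLayer _))))
  simp [Wire.IsScratch]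

/-- The block of the trial circuit that belongs to the control qubits and the flag in `|0⟩`. -/
def trialBlock : Matrix (BitState (Fin n)) (BitState (Fin n)) ℂ :=
  (D.zeroEmbedding K)ᴴ *
    (S.trial.mat * D.zeroEmbedding K)

/-- Both preparations are expanded over values of the control qubits. Phases, queries and the flag
gate do not mix these values, so only equal ones on the two sides survive. -/
theorem trialBlock_eq : trialBlock S = ∑ b : Fin D.numFactors → Bool,
    ((∏ i, D.prepareGate.1 false (b i)) * (∏ i, phaseGate.1 (b i) (b i)) *
      (D.flagUnitary.1 false false) * ∏ i, D.prepareGate.1 (b i) false) •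
      D.keptQueries b := by
  have hX : SupportedOnZeros Wire.IsScratch
      ((Gate.one D.flagUnitary (Wire.flag : D.W K)).mat *
        ((Wire.ctrlLayer n D.numFactors D.indexBits K D.prepareGate).mat *
          D.zeroEmbedding K)) := by
    refine (PreservesZeros.gate_one _ ?_).mul_supported
      ((Wire.preservesZeros_ctrlLayer _).mul_supported (Wire.supportedOnZeros_embedding _))
    simp [Wire.IsScratch]
  rw [trialBlock, trial_mat]
  rw [Matrix.mul_assoc, Matrix.mul_assoc, Matrix.mul_assoc, Matrix.mul_assoc,
    (queries_implements S).mul_eq hX]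
  rw [← Matrix.mul_assoc, Wire.embedding_mul_ctrlLayer, Matrix.sum_mul]
  refine Finset.sum_congr rfl fun b _ => ?_
  rw [Matrix.smul_mul, ← Matrix.mul_assoc, Wire.embedding_mul_diagonalLayer _ _ b,
    Matrix.smul_mul, ← Matrix.mul_assoc, Wire.embedding_mul_onSystem _ _ b,
    Wire.ctrlLayer_mul_embedding, Matrix.mul_sum, Matrix.mul_sum, Finset.sum_eq_single b]
  · simp only [Matrix.mul_smul, Matrix.mul_assoc]
    rw [Wire.embedding_mul_flag_mul_embedding, if_pos rfl, Matrix.mul_smul, Matrix.mul_one]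
    simp only [smul_smul, Wire.basisState]
    congr 1
    ring
  · intro b' _ hb
    simp only [Matrix.mul_smul, Matrix.mul_assoc]
    rw [Wire.embedding_mul_flag_mul_embedding, if_neg hb.symm, Matrix.mul_zero, smul_zero]
  · simp
  · intro y x h
    have : ∀ i, y (.ctrl i) = x (.ctrl i) := fun i => h (.ctrl i) (by simp [Wire.IsSys])
    simp only [this]
  · intro y x h
    cases y <;> cases x <;> simp_all [phaseGate]

/-- One round of oblivious amplitude amplification. -/
theorem segment_mul_embedding :
    S.segment.mat * D.zeroEmbedding K =
      D.zeroEmbedding K * ((2 : ℂ) • trialBlock S) +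
      S.trial.mat * D.zeroEmbedding K *
        (1 - ((2 : ℂ) • trialBlock S)ᴴ * ((2 : ℂ) • trialBlock S)) := by
  set J := D.zeroEmbedding K with hJ
  set A := S.trial.mat with hA
  have hAA : A * Aᴴ = 1 := Circuit.mul_conjTranspose_self _
  have hAA' : Aᴴ * A = 1 := Circuit.conjTranspose_mul_self _
  have hJJ : Jᴴ * J = 1 := Wire.embedding_isometry _
  have hneg : (Gate.one negGate (Wire.flag : D.W K)).mat = -1 := by
    rw [Gate.mat_one, ← (Splitting.oneQubit (Wire.flag : D.W K)).op_one]
    ext y x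
    rw [Matrix.neg_apply, Splitting.op_apply, Splitting.op_apply]
    by_cases h : (Splitting.oneQubit (Wire.flag : D.W K)).rel y x <;> simp [h, negGate]
  have hJs : SupportedOnZeros Wire.IsScratch J := Wire.supportedOnZeros_embedding _
  have hAJ : SupportedOnZeros Wire.IsScratch (A * J) :=
    (preservesZeros_trial S).mul_supported hJs
  -- The second reflection acts after `A†`, whose subcircuits are not specified as inverses; that
  -- `A†` keeps the scratch qubits zeroed comes from the unitarity of `A`.
  have hX : SupportedOnZeros Wire.IsScratch (Aᴴ * ((2 : ℂ) • (J * trialBlock S) - A * J)) :=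
    ((preservesZeros_trial S).conjTranspose hAA').mul_supported
      (((hJs.mul_right _).smul _).sub hAJ)
  have hM : Jᴴ * (A * J) = trialBlock S := rfl
  have hM' : Jᴴ * (Aᴴ * J) = (trialBlock S)ᴴ := by
    rw [← hM, Matrix.conjTranspose_mul, Matrix.conjTranspose_mul, Matrix.conjTranspose_conjTranspose,
      Matrix.mul_assoc]
  have hseg : S.segment.mat = -(A * (S.reflect.mat * (Aᴴ * (S.reflect.mat * A)))) := by
    rw [Compilation.segment]
    simp only [Circuit.mat_append, Circuit.mat_singleton, Circuit.mat_inv, hneg, ← hA]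
    rw [neg_one_mul]
  have hcancel : Aᴴ * (A * J) = J := by rw [← Matrix.mul_assoc, hAA', Matrix.one_mul]
  have hcancel' : ∀ B : Matrix (BitState (D.W K)) (BitState (Fin n)) ℂ, A * (Aᴴ * B) = B :=
    fun B => by rw [← Matrix.mul_assoc, hAA, Matrix.one_mul]
  rw [hseg, Matrix.neg_mul, Matrix.mul_assoc, Matrix.mul_assoc, Matrix.mul_assoc,
    Matrix.mul_assoc, reflect_mul S hAJ, hM, reflect_mul S hX]
  -- With `M = J† A J`: the first reflection gives `2 J M - A J`, and `A†` turns it into `2 A† J M -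
  -- J`. Its component along `J` is `2 M† M - 1`, because `J† A† J = M†`.
  have h1 : Jᴴ * (Aᴴ * ((2 : ℂ) • (J * trialBlock S) - A * J)) =
      (2 : ℂ) • ((trialBlock S)ᴴ * trialBlock S) - 1 := by
    rw [Matrix.mul_sub, hcancel, Matrix.mul_sub, hJJ, Matrix.mul_smul, Matrix.mul_smul,
      ← Matrix.mul_assoc, ← Matrix.mul_assoc, Matrix.mul_assoc Jᴴ, hM']
  rw [h1, Matrix.mul_sub, Matrix.mul_sub, Matrix.mul_smul A, Matrix.mul_sub]
  simp only [← hJ, Matrix.mul_sub, Matrix.mul_smul, hcancel', Matrix.mul_one,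
    Matrix.conjTranspose_smul, Matrix.smul_mul, smul_smul, smul_sub, Complex.star_def,
    Complex.conj_ofNat, Matrix.mul_assoc]
  module

end Run

end HamSim
end

open scoped NNReal

noncomputable section

namespace HamSim

set_option linter.unusedSectionVars false

/-! ### Norms of products and powers -/

section products

variable {𝔸 : Type*} [NormedRing 𝔸] [NormOneClass 𝔸]

theorem norm_pow_le_one {a : 𝔸} (ha : ‖a‖ ≤ 1) (k : ℕ) : ‖a ^ k‖ ≤ 1 :=
  (norm_pow_le a k).trans (pow_le_one₀ (norm_nonneg a) ha)

theorem norm_list_prod_le_one {l : List 𝔸} (hl : ∀ a ∈ l, ‖a‖ ≤ 1) : ‖l.prod‖ ≤ 1 := by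
  induction l with
  | nil => simp
  | cons a l ih =>
    rw [List.prod_cons]
    exact (norm_mul_le _ _).trans (mul_le_one₀ (hl a List.mem_cons_self) (norm_nonneg _)
      (ih fun b hb => hl b (List.mem_cons_of_mem _ hb)))

theorem norm_pow_sub_pow_le {a b : 𝔸} (ha : ‖a‖ ≤ 1) (hb : ‖b‖ ≤ 1) (k : ℕ) :
    ‖a ^ k - b ^ k‖ ≤ k * ‖a - b‖ := by
  induction k with
  | zero => simp
  | succ k ih =>
    have h : a ^ (k + 1) - b ^ (k + 1) = a * (a ^ k - b ^ k) + (a - b) * b ^ k := by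
      rw [pow_succ', pow_succ']; noncomm_ring
    rw [h]
    calc ‖a * (a ^ k - b ^ k) + (a - b) * b ^ k‖
        ≤ ‖a‖ * ‖a ^ k - b ^ k‖ + ‖a - b‖ * ‖b ^ k‖ :=
          (norm_add_le _ _).trans (add_le_add (norm_mul_le _ _) (norm_mul_le _ _))
      _ ≤ 1 * (k * ‖a - b‖) + ‖a - b‖ * 1 := by
          gcongr
          exact norm_pow_le_one hb k
      _ = (k + 1 : ℕ) * ‖a - b‖ := by push_cast; ring

end products

/-! ### Products in which only the first factors are kept -/

section truncation

variable {𝔸 : Type*} [NormedRing 𝔸] [NormOneClass 𝔸] [NormedAlgebra ℂ 𝔸]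

/-- The expansion of the product of the `c + z U i`, with at most `w` of the factors `U i` kept in
each term. -/
def truncatedProduct (c z : ℂ) (w m : ℕ) (U : Fin m → 𝔸) : 𝔸 :=
  ∑ b : Fin m → Bool, (∏ i, if b i then z else c) •
    ((((List.finRange m).filter fun i => b i).take w).map U).reverse.prod

/-- The product of the `c + z U i`, the first factor on the right. -/
def fullProduct (c z : ℂ) (m : ℕ) (U : Fin m → 𝔸) : 𝔸 :=
  ((List.finRange m).map fun i => c • (1 : 𝔸) + z • U i).reverse.prod

theorem fullProduct_succ (c z : ℂ) (m : ℕ) (U : Fin (m + 1) → 𝔸) :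
    fullProduct c z (m + 1) U =
      fullProduct c z m (fun i => U i.succ) * (c • (1 : 𝔸) + z • U 0) := by
  simp [fullProduct, List.finRange_succ, Function.comp_def]

theorem sum_cons_bool {m : ℕ} {M : Type*} [AddCommMonoid M] (f : (Fin (m + 1) → Bool) → M) :
    ∑ b, f b = ∑ b : Fin m → Bool, f (Fin.cons false b) + ∑ b : Fin m → Bool,
      f (Fin.cons true b) := by
  rw [← (Fin.consEquiv fun _ => Bool).sum_comp, Fintype.sum_prod_type, Fintype.sum_bool, add_comm]
  rfl

theorem filter_finRange_cons {m : ℕ} (a : Bool) (b : Fin m → Bool) :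
    ((List.finRange (m + 1)).filter fun i => (Fin.cons a b : Fin (m + 1) → Bool) i) =
      (if a then [0] else []) ++ ((List.finRange m).filter fun i => b i).map Fin.succ := by
  rw [List.finRange_succ, List.filter_cons, List.filter_map]
  cases a <;> simp [Function.comp_def]

theorem truncatedProduct_zero_succ (c z : ℂ) (m : ℕ) (U : Fin (m + 1) → 𝔸) :
    truncatedProduct c z 0 (m + 1) U =
      c • truncatedProduct c z 0 m (fun i => U i.succ) +
        z • truncatedProduct c z 0 m (fun i => U i.succ) := by
  simp only [truncatedProduct, sum_cons_bool, Fin.prod_univ_succ, Fin.cons_zero, Fin.cons_succ,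
    Finset.smul_sum, smul_smul, List.take_zero, List.map_nil]
  simp

/-- Split off the first bit. If it is set, its factor is kept on the right and uses up one of the `w
+ 1` places. -/
theorem truncatedProduct_succ_succ (c z : ℂ) (w m : ℕ) (U : Fin (m + 1) → 𝔸) :
    truncatedProduct c z (w + 1) (m + 1) U =
      c • truncatedProduct c z (w + 1) m (fun i => U i.succ) +
        z • (truncatedProduct c z w m (fun i => U i.succ) * U 0) := by
  simp only [truncatedProduct, sum_cons_bool, Fin.prod_univ_succ, Fin.cons_zero, Fin.cons_succ,
    Finset.smul_sum, smul_smul, Finset.sum_mul, filter_finRange_cons]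
  simp [List.map_take, Function.comp_def, smul_smul]

variable {c s : ℝ}

theorem norm_truncatedProduct_zero_le (hcs : ‖(c : ℂ) + s * Complex.I‖ ≤ 1) :
    ∀ (m : ℕ) (U : Fin m → 𝔸), ‖truncatedProduct (c : ℂ) (s * Complex.I) 0 m U‖ ≤ 1
  | 0, U => by simp [truncatedProduct]
  | m + 1, U => by
    rw [truncatedProduct_zero_succ, ← add_smul]
    exact (norm_smul_le _ _).trans (mul_le_one₀ hcs (norm_nonneg _)
      (norm_truncatedProduct_zero_le hcs m _))

theorem norm_fullProduct_le {m : ℕ} {U : Fin m → 𝔸}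
    (hU : ∀ i, ‖(c : ℂ) • (1 : 𝔸) + ((s : ℂ) * Complex.I) • U i‖ ≤ 1) :
    ‖fullProduct (c : ℂ) (s * Complex.I) m U‖ ≤ 1 := by
  refine norm_list_prod_le_one fun a ha => ?_
  obtain ⟨i, -, rfl⟩ := List.mem_map.1 (List.mem_reverse.1 ha)
  exact hU i

/-- Splitting off the first factor bounds the error `e (w + 1, m + 1)` by `e (w + 1, m) + s e (w,
m)`, which is Pascal's rule weighted by powers of `s`. For `w = 0` each further factor costs at most
`2 s`, as both the truncated and the full product have norm at most `1`; this is the origin of the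
constant `2`. -/
theorem norm_truncatedProduct_sub_le (hc : 0 ≤ c) (hc1 : c ≤ 1) (hs : 0 ≤ s)
    (hcs : ‖(c : ℂ) + s * Complex.I‖ ≤ 1) :
    ∀ (w m : ℕ) (U : Fin m → 𝔸), (∀ i, ‖U i‖ ≤ 1) →
      (∀ i, ‖(c : ℂ) • (1 : 𝔸) + ((s : ℂ) * Complex.I) • U i‖ ≤ 1) →
      ‖truncatedProduct (c : ℂ) (s * Complex.I) w m U - fullProduct (c : ℂ) (s * Complex.I) m U‖
        ≤ 2 * s ^ (w + 1) * m.choose (w + 1)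
  | w, 0, U, _, _ => by simp [truncatedProduct, fullProduct]
  | 0, m + 1, U, hU, hU' => by
    have ih := norm_truncatedProduct_sub_le hc hc1 hs hcs 0 m (fun i => U i.succ)
      (fun i => hU _) (fun i => hU' _)
    have h0 := norm_truncatedProduct_zero_le (𝔸 := 𝔸) hcs m fun i => U i.succ
    have h1 := norm_fullProduct_le (c := c) (s := s) (U := fun i => U (Fin.succ i))
      fun i => hU' _
    rw [truncatedProduct_zero_succ, fullProduct_succ]
    set F := truncatedProduct (c : ℂ) (s * Complex.I) 0 m fun i => U i.succ
    set P := fullProduct (c : ℂ) (s * Complex.I) m fun i => U i.succ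
    have e : (c : ℂ) • F + ((s : ℂ) * Complex.I) • F -
        P * ((c : ℂ) • (1 : 𝔸) + ((s : ℂ) * Complex.I) • U 0) =
        (c : ℂ) • (F - P) + ((s : ℂ) * Complex.I) • (F - P * U 0) := by
      rw [mul_add, mul_smul_comm, mul_smul_comm, mul_one]; module
    have hPU : ‖P * U 0‖ ≤ 1 := (norm_mul_le _ _).trans (mul_le_one₀ h1 (norm_nonneg _) (hU 0))
    rw [e]
    calc _ ≤ ‖(c : ℂ) • (F - P)‖ + ‖((s : ℂ) * Complex.I) • (F - P * U 0)‖ := norm_add_le _ _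
      _ = c * ‖F - P‖ + s * ‖F - P * U 0‖ := by
          rw [norm_smul, norm_smul, norm_mul, Complex.norm_I, mul_one, Complex.norm_real,
            Complex.norm_real, Real.norm_of_nonneg hc, Real.norm_of_nonneg hs]
      _ ≤ 1 * (2 * s ^ (0 + 1) * m.choose (0 + 1)) + s * (1 + 1) := by
          gcongr
          exact (norm_sub_le _ _).trans (add_le_add h0 hPU)
      _ = 2 * s ^ (0 + 1) * ((m + 1).choose (0 + 1)) := by
          simp; ring
  | w + 1, m + 1, U, hU, hU' => by
    have ih := norm_truncatedProduct_sub_le hc hc1 hs hcs (w + 1) m (fun i => U i.succ)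
      (fun i => hU _) (fun i => hU' _)
    have ih' := norm_truncatedProduct_sub_le hc hc1 hs hcs w m (fun i => U i.succ)
      (fun i => hU _) (fun i => hU' _)
    rw [truncatedProduct_succ_succ, fullProduct_succ]
    set F := truncatedProduct (c : ℂ) (s * Complex.I) (w + 1) m fun i => U i.succ
    set F' := truncatedProduct (c : ℂ) (s * Complex.I) w m fun i => U i.succ
    set P := fullProduct (c : ℂ) (s * Complex.I) m fun i => U i.succ
    have e : (c : ℂ) • F + ((s : ℂ) * Complex.I) • (F' * U 0) -
        P * ((c : ℂ) • (1 : 𝔸) + ((s : ℂ) * Complex.I) • U 0) =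
        (c : ℂ) • (F - P) + ((s : ℂ) * Complex.I) • ((F' - P) * U 0) := by
      rw [mul_add, mul_smul_comm, mul_smul_comm, mul_one, sub_mul]; module
    rw [e]
    calc _ ≤ ‖(c : ℂ) • (F - P)‖ + ‖((s : ℂ) * Complex.I) • ((F' - P) * U 0)‖ :=
          norm_add_le _ _
      _ = c * ‖F - P‖ + s * ‖(F' - P) * U 0‖ := by
          rw [norm_smul, norm_smul, norm_mul, Complex.norm_I, mul_one, Complex.norm_real,
            Complex.norm_real, Real.norm_of_nonneg hc, Real.norm_of_nonneg hs]
      _ ≤ 1 * (2 * s ^ (w + 1 + 1) * m.choose (w + 1 + 1)) +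
            s * ((2 * s ^ (w + 1) * m.choose (w + 1)) * 1) := by
          gcongr
          exact (norm_mul_le _ _).trans (mul_le_mul ih' (hU 0) (norm_nonneg _) (by positivity))
      _ = 2 * s ^ (w + 1 + 1) * ((m + 1).choose (w + 1 + 1)) := by
          rw [Nat.choose_succ_succ' m (w + 1)]; push_cast; ring

end truncation

/-! ### The Lie product formula -/

section lie

variable {𝔸 : Type*} [NormedRing 𝔸] [NormedAlgebra ℂ 𝔸]

open Filter Topology

/-- The value at `0` is carried along because the product rule in the induction needs it. -/
theorem hasDerivAt_prod_cos_sin (τ : ℝ) (l : List 𝔸) :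
    HasDerivAt (fun a : ℝ => (l.map fun C => (Real.cos (a * τ) : ℂ) • (1 : 𝔸) +
      (-(Real.sin (a * τ) * Complex.I) : ℂ) • C).prod)
      ((-(τ * Complex.I) : ℂ) • l.sum) 0 ∧
    (l.map fun C => (Real.cos (0 * τ) : ℂ) • (1 : 𝔸) +
      (-(Real.sin (0 * τ) * Complex.I) : ℂ) • C).prod = 1 := by
  induction l with
  | nil => simpa using hasDerivAt_const (0 : ℝ) (1 : 𝔸)
  | cons C l ih =>
    have hlin : HasDerivAt (fun a : ℝ => a * τ) τ 0 := by
      simpa using (hasDerivAt_id (0 : ℝ)).mul_const τ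
    have hc : HasDerivAt (fun a : ℝ => (Real.cos (a * τ) : ℂ)) ((0 : ℝ) : ℂ) 0 := by
      have := hlin.cos
      simp only [zero_mul, Real.sin_zero, neg_zero] at this
      exact this.ofReal_comp
    have hs : HasDerivAt (fun a : ℝ => (-(Real.sin (a * τ) * Complex.I) : ℂ))
        (-(τ * Complex.I)) 0 := by
      have := hlin.sin
      simp only [zero_mul, Real.cos_zero, one_mul] at this
      exact (this.ofReal_comp.mul_const Complex.I).neg
    have h1 := (hc.smul_const (1 : 𝔸)).add (hs.smul_const C)
    have h2 := h1.mul ih.1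
    refine ⟨?_, ?_⟩
    · simp only [List.map_cons, List.prod_cons]
      convert h2 using 1
      · rfl
      · rw [ih.2]
        simp
    · rw [List.map_cons, List.prod_cons, ih.2]
      simp

theorem eventually_norm_le_of_hasDerivAt {h : ℝ → 𝔸} {D : 𝔸} (hD : HasDerivAt h D 0)
    (h0 : h 0 = 0) {κ η : ℝ} (hκ : ‖D‖ ≤ κ) (hη : 0 < η) :
    ∀ᶠ a in 𝓝 (0 : ℝ), ‖h a‖ ≤ (κ + η) * |a| := by
  have := hD.isLittleO.def hη
  filter_upwards [this] with a ha
  rw [h0, sub_zero, sub_zero, Real.norm_eq_abs] at ha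
  calc ‖h a‖ = ‖(h a - a • D) + a • D‖ := by rw [sub_add_cancel]
    _ ≤ η * |a| + |a| * κ := by
        refine (norm_add_le _ _).trans (add_le_add ha ?_)
        rw [norm_smul, Real.norm_eq_abs]
        gcongr
    _ = (κ + η) * |a| := by ring

variable [NormOneClass 𝔸] [CompleteSpace 𝔸]

/-- The Lie product of `exp (-i a C)`, for `C` with square one, compared with `exp Y`. -/
theorem eventually_norm_lieProduct_sub_exp_le (τ : ℝ) (l : List 𝔸) (Y : 𝔸) {κ η : ℝ}
    (hl : ∀ C ∈ l, ∀ a : ℝ,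
      ‖(Real.cos a : ℂ) • (1 : 𝔸) + (-(Real.sin a * Complex.I) : ℂ) • C‖ ≤ 1)
    (hY : ∀ a : ℝ, ‖NormedSpace.exp (a • Y)‖ ≤ 1)
    (hκ : ‖(-(τ * Complex.I) : ℂ) • l.sum - Y‖ ≤ κ) (hη : 0 < η) :
    ∀ᶠ M : ℕ in atTop,
      ‖(l.map fun C => (Real.cos (τ / M) : ℂ) • (1 : 𝔸) +
        (-(Real.sin (τ / M) * Complex.I) : ℂ) • C).prod ^ M - NormedSpace.exp Y‖ ≤ κ + η := by
  -- The difference of one Lie step and `exp (a Y)` vanishes at `a = 0` and has a derivative of norm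
  -- at most `κ`. At `a = 1 / M` it is thus at most `(κ + η) / M`, and taking `M`-th powers of
  -- contractions multiplies this by at most `M`. Nothing requires `Y` to be the exact generator, so
  -- the rounding error is absorbed into `κ`.
  obtain ⟨h1, h2⟩ := hasDerivAt_prod_cos_sin τ l
  have h3 := hasDerivAt_exp_smul_const (𝕂 := ℝ) Y (0 : ℝ)
  have h4 := h1.sub h3
  rw [zero_smul, NormedSpace.exp_zero, one_mul] at h4
  have h5 := eventually_norm_le_of_hasDerivAt h4
    (by rw [Pi.sub_apply, h2, zero_smul, NormedSpace.exp_zero, sub_self]) hκ hη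
  have h6 : Tendsto (fun M : ℕ => 1 / (M : ℝ)) atTop (𝓝 0) :=
    tendsto_one_div_atTop_nhds_zero_nat
  filter_upwards [h6.eventually h5, eventually_gt_atTop 0] with M hM hM0
  have hM0' : (0 : ℝ) < M := by exact_mod_cast hM0
  simp only [Pi.sub_apply, one_div_mul_eq_div] at hM
  let := NormedAlgebra.restrictScalars ℚ ℂ 𝔸
  have hexp : NormedSpace.exp Y = NormedSpace.exp ((1 / (M : ℝ)) • Y) ^ M := by
    rw [← NormedSpace.exp_nsmul, ← Nat.cast_smul_eq_nsmul ℝ, smul_smul,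
      mul_one_div_cancel hM0'.ne', one_smul]
  rw [hexp]
  refine (norm_pow_sub_pow_le ?_ (hY _) M).trans ?_
  · refine norm_list_prod_le_one fun a ha => ?_
    obtain ⟨C, hC, rfl⟩ := List.mem_map.1 ha
    exact hl C hC _
  · calc (M : ℝ) * _ ≤ M * ((κ + η) * |1 / (M : ℝ)|) := by gcongr
      _ = κ + η := by
        rw [abs_of_pos (by positivity)]
        field_simp

end lie

end HamSim
end

open scoped NNReal

noncomputable section

namespace HamSim

set_option linter.unusedSectionVars false

open Matrix

/-! ### Rounding -/

section level

variable {γ : ℝ}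

theorem level_zero : level γ 0 = 0 := by
  rw [level, Nat.floor_eq_zero]
  norm_num

theorem level_neg (v : ℝ) : level γ (-v) = level γ v := by
  rw [level, level, abs_neg]

theorem level_le (hγ : 0 < γ) (v : ℝ) : 2 * γ * level γ v ≤ |v| + γ := by
  have h := Nat.floor_le (a := |v| / (2 * γ) + 1 / 2) (by positivity)
  calc 2 * γ * level γ v ≤ 2 * γ * (|v| / (2 * γ) + 1 / 2) := by
        rw [level]; gcongr
    _ = |v| + γ := by field_simp

theorem le_level (hγ : 0 < γ) (v : ℝ) : |v| ≤ 2 * γ * level γ v + γ := by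
  have h := (Nat.lt_floor_add_one (|v| / (2 * γ) + 1 / 2)).le
  have h2 : 2 * γ * (|v| / (2 * γ) + 1 / 2) ≤ 2 * γ * ((level γ v : ℝ) + 1) := by
    rw [level]; gcongr
  have h3 : 2 * γ * (|v| / (2 * γ) + 1 / 2) = |v| + γ := by field_simp
  linarith

theorem abs_round_sub_le (hγ : 0 < γ) (v : ℝ) :
    |2 * γ * level γ v * Real.sign v - v| ≤ γ := by
  have h1 := level_le hγ v
  have h2 := le_level hγ v
  rcases lt_trichotomy v 0 with h | h | h
  · rw [Real.sign_of_neg h, abs_le]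
    rw [abs_of_neg h] at h1 h2
    constructor <;> linarith
  · subst h
    simpa using hγ.le
  · rw [Real.sign_of_pos h, abs_le]
    rw [abs_of_pos h] at h1 h2
    constructor <;> linarith

end level

/-! ### Parts of a one-sparse matrix and their sign matrices -/

section parts

instance : Fintype Part :=
  ⟨⟨{.X, .Y, .Z}, by simp⟩, fun ξ => by cases ξ <;> simp⟩

theorem Part.sum_eq {M : Type*} [AddCommMonoid M] (f : Part → M) :
    ∑ ξ, f ξ = f .X + f .Y + f .Z := by
  change (Multiset.map f {.X, .Y, .Z}).sum = _
  simp [add_assoc]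

variable {S : Type} [Fintype S] [DecidableEq S] {A : Matrix S S ℂ} {γ : ℝ}

theorem Part.val_eq_zero (ξ : Part) {p q : S} (h : A p q = 0) : ξ.val A p q = 0 := by
  cases ξ <;> simp [Part.val, h]

theorem Part.abs_val_le (ξ : Part) (p q : S) : |ξ.val A p q| ≤ ‖A p q‖ := by
  cases ξ <;> simp only [Part.val] <;> split_ifs <;>
    simp [Complex.abs_re_le_norm, Complex.abs_im_le_norm]

/-- The entry of `signMatrix` at a position whose level is large enough. -/
def Part.phase (A : Matrix S S ℂ) (ξ : Part) (p q : S) : ℂ := (Real.sign (ξ.val A p q) : ℂ) * ξ.unit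

theorem Part.level_symm (hA : A.IsHermitian) (ξ : Part) (p q : S) :
    level γ (ξ.val A q p) = level γ (ξ.val A p q) := by
  have h := hA.apply p q
  cases ξ <;> simp only [Part.val, eq_comm (a := q)] <;> split_ifs with hpq
  · rfl
  · rw [← h]; simp
  · rfl
  · rw [← h]; simp [level_neg]
  · rw [hpq]
  · rfl

/-- For the imaginary part two signs cancel: its entries are antisymmetric, and the unit `i` is
conjugated to `-i`. -/
theorem Part.star_phase (hA : A.IsHermitian) (ξ : Part) (p q : S) :
    star (ξ.phase A q p) = ξ.phase A p q := by
  have h := hA.apply p q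
  cases ξ <;> simp only [Part.phase, Part.val, Part.unit, eq_comm (a := q)] <;>
    split_ifs with hpq
  · simp
  · rw [← h]; simp
  · simp
  · rw [← h]; simp [Real.sign_neg]
  · rw [hpq]; simp
  · simp

theorem Part.phase_mul_star (ξ : Part) {p q : S} (h : ξ.val A p q ≠ 0) :
    ξ.phase A p q * star (ξ.phase A p q) = 1 := by
  have hs : ((Real.sign (ξ.val A p q) : ℝ) : ℂ) * (Real.sign (ξ.val A p q) : ℝ) = 1 := by
    rcases Real.sign_apply_eq_of_ne_zero _ h with h | h <;> rw [h] <;> simp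
  have hu : ξ.unit * star ξ.unit = 1 := by cases ξ <;> simp [Part.unit]
  rw [Part.phase, star_mul']
  have : star ((Real.sign (ξ.val A p q) : ℝ) : ℂ) = (Real.sign (ξ.val A p q) : ℝ) :=
    Complex.conj_ofReal _
  rw [this]
  linear_combination (ξ.unit * star ξ.unit) * hs + hu

theorem signMatrix_apply (ξ : Part) (l : ℕ) (σ : Bool) (p q : S) :
    signMatrix γ A ξ l σ p q =
      if p = q ∧ ∀ q', level γ (ξ.val A p q') ≤ l then (if σ then 1 else -1)
      else if l < level γ (ξ.val A p q) then ξ.phase A p q else 0 := rfl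

theorem val_ne_zero_of_lt_level {l : ℕ} {v : ℝ} (h : l < level γ v) : v ≠ 0 := by
  rintro rfl
  rw [level_zero] at h
  omega

theorem signMatrix_isHermitian (hA : A.IsHermitian) (ξ : Part) (l : ℕ) (σ : Bool) :
    (signMatrix γ A ξ l σ).IsHermitian := by
  ext p q
  rw [Matrix.conjTranspose_apply, signMatrix_apply, signMatrix_apply]
  by_cases hpq : p = q
  · subst hpq
    by_cases h : ∀ q', level γ (ξ.val A p q') ≤ l
    · rw [if_pos ⟨rfl, h⟩]
      cases σ <;> simp
    · rw [if_neg fun h' => h h'.2]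
      by_cases h' : l < level γ (ξ.val A p p)
      · rw [if_pos h', Part.star_phase hA]
      · rw [if_neg h', star_zero]
  · rw [if_neg (fun h => hpq h.1.symm : ¬ (q = p ∧ _)), if_neg (fun h => hpq h.1 : ¬ (p = q ∧ _)),
      Part.level_symm hA]
    by_cases h' : l < level γ (ξ.val A p q)
    · rw [if_pos h', if_pos h', Part.star_phase hA]
    · rw [if_neg h', if_neg h', star_zero]

/-- By one-sparseness and symmetry, the positions of level above `l` pair each row with at most one
partner, possibly itself. A paired row contributes a phase times its conjugate, and an unpaired row
the square of its diagonal entry `±1`. -/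
theorem signMatrix_mul_self (hA : A.IsHermitian)
    (hone : ∀ p q q', A p q ≠ 0 → A p q' ≠ 0 → q = q') (ξ : Part) (l : ℕ) (σ : Bool) :
    signMatrix γ A ξ l σ * signMatrix γ A ξ l σ = 1 := by
  have huniq : ∀ p q q', l < level γ (ξ.val A p q) → l < level γ (ξ.val A p q') → q = q' :=
    fun p q q' h h' => hone p q q' (fun e => val_ne_zero_of_lt_level h (ξ.val_eq_zero e))
      fun e => val_ne_zero_of_lt_level h' (ξ.val_eq_zero e)
  have hrow : ∀ p q, l < level γ (ξ.val A p q) → ∀ r,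
      signMatrix γ A ξ l σ p r = if r = q then ξ.phase A p q else 0 := by
    intro p q h r
    rw [signMatrix_apply, if_neg fun h' => (h'.2 q).not_gt h]
    by_cases hr : r = q
    · rw [hr, if_pos h, if_pos rfl]
    · rw [if_neg fun h' => hr (huniq p r q h' h), if_neg hr]
  ext p r
  rw [Matrix.mul_apply, Matrix.one_apply]
  by_cases h : ∃ q, l < level γ (ξ.val A p q)
  · obtain ⟨q, hq⟩ := h
    have hq' : l < level γ (ξ.val A q p) := by rwa [Part.level_symm hA]
    rw [Finset.sum_eq_single q, hrow p q hq, if_pos rfl, hrow q p hq', ← Part.star_phase hA ξ q p]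
    · by_cases hr : r = p
      · rw [if_pos hr, if_pos hr.symm, Part.phase_mul_star _ (val_ne_zero_of_lt_level hq)]
      · rw [if_neg hr, if_neg fun h => hr h.symm, mul_zero]
    · intro q' _ hq'
      rw [hrow p q hq, if_neg hq', zero_mul]
    · simp
  · have h' : ∀ q, level γ (ξ.val A p q) ≤ l := by simpa using h
    have hrow' : ∀ r, signMatrix γ A ξ l σ p r =
        if p = r then (if σ then 1 else -1) else 0 := by
      intro r
      rw [signMatrix_apply, if_neg (h' r).not_gt]
      exact if_congr (and_iff_left h') rfl rfl
    rw [Finset.sum_eq_single p, hrow' p, if_pos rfl, hrow' r]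
    · by_cases hr : p = r
      · rw [if_pos hr, if_pos hr]
        cases σ <;> simp
      · rw [if_neg hr, if_neg hr, mul_zero]
    · intro q _ hq
      rw [hrow' q, if_neg hq.symm, zero_mul]
    · simp

/-- The filler entries `1` and `-1` cancel between the two matrices of a level, and the true entry
occurs twice at each level below its own. The bound `N` is free because all parts are summed up to
`maxLevel`. -/
theorem sum_signMatrix (ξ : Part) (p q : S) {N : ℕ} (hN : level γ (ξ.val A p q) ≤ N) :
    ∑ l ∈ Finset.range N, (signMatrix γ A ξ l true p q + signMatrix γ A ξ l false p q) =
      2 * level γ (ξ.val A p q) * ξ.phase A p q := by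
  have h : ∀ l, signMatrix γ A ξ l true p q + signMatrix γ A ξ l false p q =
      if l < level γ (ξ.val A p q) then 2 * ξ.phase A p q else 0 := by
    intro l
    rw [signMatrix_apply, signMatrix_apply]
    by_cases h : p = q ∧ ∀ q', level γ (ξ.val A p q') ≤ l
    · rw [if_pos h, if_pos h, if_neg (h.2 q).not_gt]
      simp
    · rw [if_neg h, if_neg h]
      split_ifs <;> ring
  simp only [h]
  rw [← Finset.sum_filter, Finset.sum_const]
  have : (Finset.range N).filter (· < level γ (ξ.val A p q)) =
      Finset.range (level γ (ξ.val A p q)) := by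
    ext l
    simp only [Finset.mem_filter, Finset.mem_range]
    omega
  rw [this, Finset.card_range, nsmul_eq_mul]
  ring

theorem level_le_maxLevel (ξ : Part) (p q : S) :
    level γ (ξ.val A p q) ≤ maxLevel γ A ξ :=
  Finset.le_sup (f := fun pq : S × S => level γ (ξ.val A pq.1 pq.2)) (Finset.mem_univ (p, q))

theorem sum_phase (hA : A.IsHermitian) (p q : S) :
    Part.X.val A p q * Part.X.unit + Part.Y.val A p q * Part.Y.unit +
      Part.Z.val A p q * Part.Z.unit = A p q := by
  by_cases h : p = q
  · subst h
    have := hA.coe_re_apply_self p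
    simpa [Part.val, Part.unit] using this
  · simp [Part.val, Part.unit, h, Complex.re_add_im]

/-- Rounding loses at most `γ` in each of two parts off the diagonal, and in one part on it. -/
theorem norm_le_sum_level (hγ : 0 < γ) (hA : A.IsHermitian) (p q : S) :
    ‖A p q‖ ≤ 2 * γ * (level γ (Part.X.val A p q) + level γ (Part.Y.val A p q) +
      level γ (Part.Z.val A p q)) + 2 * γ := by
  by_cases h : p = q
  · subst h
    have h1 := le_level hγ (Part.Z.val A p p)
    have h2 : ‖A p p‖ = |Part.Z.val A p p| := by
      conv_lhs => rw [← hA.coe_re_apply_self p]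
      simp [Part.val]
    rw [h2]
    have h3 : (0 : ℝ) ≤ 2 * γ * (level γ (Part.X.val A p p) + level γ (Part.Y.val A p p)) := by
      positivity
    linarith
  · have h1 := le_level hγ (Part.X.val A p q)
    have h2 := le_level hγ (Part.Y.val A p q)
    have h3 : ‖A p q‖ ≤ |Part.X.val A p q| + |Part.Y.val A p q| := by
      simpa [Part.val, h] using Complex.norm_le_abs_re_add_abs_im (A p q)
    have h4 : (0 : ℝ) ≤ 2 * γ * level γ (Part.Z.val A p q) := by positivity
    linarith

end parts

/-! ### The one-sparse pieces of an edge coloring -/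

namespace EdgeColoring

variable {S : Type} [DecidableEq S] {H : Matrix S S ℂ} {nc : ℕ} (χ : EdgeColoring H nc)

theorem piece_isHermitian (hH : H.IsHermitian) (j : Fin nc) : (χ.piece j).IsHermitian := by
  ext p q
  have := hH.apply p q
  simp only [piece, Matrix.conjTranspose_apply, Matrix.of_apply, χ.symm q p]
  split_ifs
  · exact this
  · exact star_zero _

theorem piece_oneSparse (j : Fin nc) (p q q' : S) (h : χ.piece j p q ≠ 0)
    (h' : χ.piece j p q' ≠ 0) : q = q' := by
  simp only [piece, Matrix.of_apply, ne_eq, ite_eq_right_iff, not_forall] at h h'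
  obtain ⟨h1, h2⟩ := h
  obtain ⟨h1', h2'⟩ := h'
  exact χ.proper p q q' h2 h2' (h1.trans h1'.symm)

theorem val_piece (ξ : Part) (j : Fin nc) (p q : S) :
    ξ.val (χ.piece j) p q = if χ.color p q = j then ξ.val H p q else 0 := by
  by_cases h : χ.color p q = j <;> cases ξ <;> simp [Part.val, piece, h]

end EdgeColoring

/-- The Schur test. -/
theorem norm_toLp_mulVec_le {S : Type} [Fintype S] (A : Matrix S S ℂ) {R : ℝ} (hR : 0 ≤ R)
    (hrow : ∀ p, ∑ q, ‖A p q‖ ≤ R) (hcol : ∀ q, ∑ p, ‖A p q‖ ≤ R) (x : S → ℂ) :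
    ‖WithLp.toLp 2 (A *ᵥ x)‖ ≤ R * ‖WithLp.toLp 2 x‖ := by
  rw [EuclideanSpace.norm_eq, EuclideanSpace.norm_eq,
    ← Real.sqrt_sq hR, ← Real.sqrt_mul (sq_nonneg R)]
  apply Real.sqrt_le_sqrt
  -- Cauchy–Schwarz with weights `‖A p q‖`; the row sums are used here and the column sums after
  -- exchanging the order of summation.
  have h1 : ∀ p, ‖(A *ᵥ x) p‖ ^ 2 ≤ R * ∑ q, ‖A p q‖ * ‖x q‖ ^ 2 := by
    intro p
    have h2 : ‖(A *ᵥ x) p‖ ≤ ∑ q, ‖A p q‖ * ‖x q‖ := by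
      refine (norm_sum_le _ _).trans_eq ?_
      simp only [norm_mul]
    calc ‖(A *ᵥ x) p‖ ^ 2 ≤ (∑ q, ‖A p q‖ * ‖x q‖) ^ 2 := by gcongr
      _ ≤ (∑ q, ‖A p q‖) * ∑ q, ‖A p q‖ * ‖x q‖ ^ 2 :=
          Finset.sum_sq_le_sum_mul_sum_of_sq_le_mul _ (fun _ _ => by positivity)
            (fun _ _ => by positivity) fun _ _ => le_of_eq (by ring)
      _ ≤ R * ∑ q, ‖A p q‖ * ‖x q‖ ^ 2 := by
          gcongr
          exact hrow p
  calc ∑ p, ‖(A *ᵥ x) p‖ ^ 2 ≤ ∑ p, R * ∑ q, ‖A p q‖ * ‖x q‖ ^ 2 :=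
        Finset.sum_le_sum fun p _ => h1 p
    _ = R * ∑ q, (∑ p, ‖A p q‖) * ‖x q‖ ^ 2 := by
        rw [← Finset.mul_sum, Finset.sum_comm]
        simp only [Finset.sum_mul]
    _ ≤ R * ∑ q, R * ‖x q‖ ^ 2 := by
        gcongr with q
        exact hcol q
    _ = R ^ 2 * ∑ q, ‖x q‖ ^ 2 := by
        rw [← Finset.mul_sum]; ring

theorem sum_map_flatMap {α β M : Type*} [AddCommMonoid M] (l : List α) (f : α → List β)
    (φ : β → M) : ((l.flatMap f).map φ).sum = (l.map fun a => ((f a).map φ).sum).sum := by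
  induction l with
  | nil => simp
  | cons a l ih => simp [List.flatMap_cons, ih]

/-! ### The error of the rounding, and bounds for the number of matrices -/

namespace Run

variable {n : ℕ} (D : Run n)

theorem sum_map_range {M : Type*} [AddCommMonoid M] (N : ℕ) (φ : ℕ → M) :
    ((List.range N).map φ).sum = ∑ i ∈ Finset.range N, φ i := rfl

/-- A sum over all matrices of a run, arranged by colors, parts and levels. -/
theorem sum_map_signMatrices {M : Type*} [AddCommMonoid M]
    (φ : Matrix (BitState (Fin n)) (BitState (Fin n)) ℂ → M) :
    (D.signMatrices.map φ).sum = ∑ j : Fin D.nc, ∑ ξ : Part,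
      ∑ l ∈ Finset.range (maxLevel D.γ (D.χ.piece j) ξ),
        (φ (signMatrix D.γ (D.χ.piece j) ξ l true) +
          φ (signMatrix D.γ (D.χ.piece j) ξ l false)) := by
  rw [signMatrices, sum_map_flatMap, ← Fin.sum_univ_def]
  refine Finset.sum_congr rfl fun j _ => ?_
  rw [Part.sum_eq]
  simp only [sum_map_flatMap, List.map_cons, List.map_nil, List.sum_cons, List.sum_nil, add_zero,
    sum_map_range, add_assoc]

theorem mem_signMatrices {C : Matrix (BitState (Fin n)) (BitState (Fin n)) ℂ}
    (hC : C ∈ D.signMatrices) : ∃ j ξ l σ, C = signMatrix D.γ (D.χ.piece j) ξ l σ := by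
  simp only [signMatrices, List.mem_flatMap] at hC
  obtain ⟨j, -, ξ, -, l, -, h⟩ := hC
  simp only [List.mem_cons, List.not_mem_nil, or_false] at h
  rcases h with rfl | rfl
  · exact ⟨j, ξ, l, true, rfl⟩
  · exact ⟨j, ξ, l, false, rfl⟩

theorem isHermitian_of_mem_signMatrices (hH : D.H.IsHermitian)
    {C : Matrix (BitState (Fin n)) (BitState (Fin n)) ℂ} (hC : C ∈ D.signMatrices) :
    C.IsHermitian := by
  obtain ⟨j, ξ, l, σ, rfl⟩ := D.mem_signMatrices hC
  exact signMatrix_isHermitian (D.χ.piece_isHermitian hH j) ξ l σ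

theorem mul_self_of_mem_signMatrices (hH : D.H.IsHermitian)
    {C : Matrix (BitState (Fin n)) (BitState (Fin n)) ℂ} (hC : C ∈ D.signMatrices) :
    C * C = 1 := by
  obtain ⟨j, ξ, l, σ, rfl⟩ := D.mem_signMatrices hC
  exact signMatrix_mul_self (D.χ.piece_isHermitian hH j) (D.χ.piece_oneSparse j) ξ l σ

theorem Ω_eq : D.Ω = ∑ j : Fin D.nc, ∑ ξ : Part,
    2 * maxLevel D.γ (D.χ.piece j) ξ := by
  have h := D.sum_map_signMatrices fun _ => 1
  rw [List.map_const', List.sum_replicate, smul_eq_mul, mul_one] at h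
  rw [Ω, h]
  simp [mul_comm]

theorem sum_signMatrices_apply (p q : BitState (Fin n)) :
    D.signMatrices.sum p q = ∑ ξ : Part,
      2 * level D.γ (ξ.val D.H p q) * ξ.phase D.H p q := by
  have h := D.sum_map_signMatrices fun C => C p q
  have h' : (D.signMatrices.map fun C => C p q).sum = D.signMatrices.sum p q := by
    generalize D.signMatrices = l
    induction l with
    | nil => simp
    | cons C l ih => simp [ih]
  rw [← h', h, Finset.sum_eq_single (D.χ.color p q)]
  · refine Finset.sum_congr rfl fun ξ _ => ?_
    rw [sum_signMatrix ξ p q (level_le_maxLevel ξ p q), Part.phase, D.χ.val_piece, if_pos rfl]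
    rfl
  · intro j _ hj
    refine Finset.sum_eq_zero fun ξ _ => ?_
    rw [sum_signMatrix ξ p q (level_le_maxLevel ξ p q), D.χ.val_piece, if_neg hj.symm, level_zero]
    simp
  · simp

/-- The error of the rounding of an entry. -/
theorem norm_rounding_apply_le (hγ : 0 < D.γ) (hH : D.H.IsHermitian) (p q : BitState (Fin n)) :
    ‖((D.γ : ℂ) • D.signMatrices.sum - D.H) p q‖ ≤ if D.H p q = 0 then 0 else 3 * D.γ := by
  have h1 : ((D.γ : ℂ) • D.signMatrices.sum - D.H) p q = ∑ ξ : Part,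
      ((2 * D.γ * level D.γ (ξ.val D.H p q) * Real.sign (ξ.val D.H p q) - ξ.val D.H p q : ℝ) : ℂ)
        * ξ.unit := by
    rw [Matrix.sub_apply, Matrix.smul_apply, D.sum_signMatrices_apply]
    conv_lhs => rw [← sum_phase hH p q]
    rw [Part.sum_eq, Part.sum_eq]
    simp only [Part.phase, smul_eq_mul]
    push_cast
    ring
  have hu : ∀ ξ : Part, ‖ξ.unit‖ = 1 := by intro ξ; cases ξ <;> simp [Part.unit]
  rw [h1]
  split_ifs with h
  · have : ∀ ξ : Part, ξ.val D.H p q = 0 := fun ξ => ξ.val_eq_zero h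
    simp [this]
  -- A crude count: `γ` for each of the three parts, although at most two of them are nonzero at a
  -- given position.
  · refine (norm_sum_le_of_le (n := fun _ => D.γ) _ fun ξ _ => ?_).trans ?_
    · rw [norm_mul, hu, mul_one, Complex.norm_real]
      exact abs_round_sub_le hγ _
    · rw [Part.sum_eq]
      linarith

variable {d : ℕ}

theorem sum_ite_le_of_isSparse {S : Type} [Fintype S] {H : Matrix S S ℂ}
    (hs : IsSparse d H) {r : ℝ} (hr : 0 ≤ r) (p : S) :
    ∑ q, (if H p q = 0 then 0 else r) ≤ d * r := by
  classical
  rw [Finset.sum_ite, Finset.sum_const_zero, zero_add, Finset.sum_const, nsmul_eq_mul]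
  gcongr
  have := hs p
  rwa [Set.ncard_eq_toFinset_card', Set.toFinset_ofPred] at this

theorem norm_rounding_mulVec_le (hγ : 0 < D.γ) (hH : D.H.IsHermitian)
    (hs : IsSparse d D.H) (x : BitState (Fin n) → ℂ) :
    ‖WithLp.toLp 2 (((D.γ : ℂ) • D.signMatrices.sum - D.H) *ᵥ x)‖ ≤
      d * (3 * D.γ) * ‖WithLp.toLp 2 x‖ := by
  refine norm_toLp_mulVec_le _ (by positivity) (fun p => ?_) (fun q => ?_) x
  · exact (Finset.sum_le_sum fun q _ => D.norm_rounding_apply_le hγ hH p q).trans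
      (sum_ite_le_of_isSparse hs (by positivity) p)
  · refine (Finset.sum_le_sum fun p _ => D.norm_rounding_apply_le hγ hH p q).trans ?_
    have h : ∀ p, D.H p q = 0 ↔ D.H q p = 0 := fun p => by
      rw [← hH.apply p q, star_eq_zero]
    simp only [h]
    exact sum_ite_le_of_isSparse hs (by positivity) q

theorem norm_le_maxNorm {S : Type} [Finite S] (H : Matrix S S ℂ) (p q : S) :
    ‖H p q‖ ≤ maxNorm H :=
  (le_ciSup (f := fun q => ‖H p q‖) (Set.finite_range _).bddAbove q).trans
    (le_ciSup (f := fun p => ⨆ q, ‖H p q‖) (Set.finite_range _).bddAbove p)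

theorem maxNorm_pos {S : Type} [Finite S] {H : Matrix S S ℂ} (h : H ≠ 0) : 0 < maxNorm H := by
  have : ∃ p q, H p q ≠ 0 := by
    by_contra! h'
    exact h (Matrix.ext h')
  obtain ⟨p, q, hpq⟩ := this
  exact (norm_pos_iff.2 hpq).trans_le (norm_le_maxNorm H p q)

theorem Ω_le (hγ : 0 < D.γ) (hH0 : D.H ≠ 0) (hnc : D.nc ≤ d ^ 2) :
    (D.Ω : ℝ) ≤ 6 * (d : ℝ) ^ 2 * ⌈maxNorm D.H / D.γ⌉ := by
  have hpos := maxNorm_pos hH0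
  have h1 : (1 : ℝ) ≤ ⌈maxNorm D.H / D.γ⌉ := by
    have : 0 < ⌈maxNorm D.H / D.γ⌉ := Int.ceil_pos.2 (by positivity)
    exact_mod_cast this
  have h2 := Int.le_ceil (maxNorm D.H / D.γ)
  have hlev : ∀ j ξ, (maxLevel D.γ (D.χ.piece j) ξ : ℝ) ≤ ⌈maxNorm D.H / D.γ⌉ := by
    intro j ξ
    obtain ⟨pq, -, hpq⟩ := Finset.exists_mem_eq_sup (Finset.univ : Finset (_ × _))
      Finset.univ_nonempty fun pq : _ × _ => level D.γ (ξ.val (D.χ.piece j) pq.1 pq.2)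
    rw [maxLevel, hpq]
    have h3 := level_le hγ (ξ.val (D.χ.piece j) pq.1 pq.2)
    have h4 : |ξ.val (D.χ.piece j) pq.1 pq.2| ≤ maxNorm D.H := by
      rw [D.χ.val_piece]
      split_ifs
      · exact (ξ.abs_val_le _ _).trans (norm_le_maxNorm _ _ _)
      · simpa using hpos.le
    rw [div_le_iff₀ hγ] at h2
    -- The level times `2 γ` is at most `‖H‖_max + γ`, and the extra `γ` is absorbed since the
    -- ceiling is at least `1`, as `H ≠ 0`.
    have h5 : 2 * D.γ * (level D.γ (ξ.val (D.χ.piece j) pq.1 pq.2) : ℝ) ≤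
        2 * D.γ * ⌈maxNorm D.H / D.γ⌉ := by nlinarith
    exact le_of_mul_le_mul_left h5 (by positivity)
  rw [D.Ω_eq]
  push_cast
  calc _ ≤ ∑ j : Fin D.nc, ∑ ξ : Part,
        2 * (⌈maxNorm D.H / D.γ⌉ : ℝ) := by
        gcongr with j _ ξ _
        exact hlev j ξ
    _ = D.nc * (3 * (2 * (⌈maxNorm D.H / D.γ⌉ : ℝ))) := by
        simp only [Part.sum_eq]
        simp only [Finset.sum_const, Finset.card_univ, Fintype.card_fin, nsmul_eq_mul]
        ring
    _ ≤ ((d ^ 2 : ℕ) : ℝ) * (3 * (2 * (⌈maxNorm D.H / D.γ⌉ : ℝ))) := by gcongr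
    _ = _ := by push_cast; ring

/-- The entries of a column have different colors, and a color contributes at least twice the level
of each part of its entry to `Ω`. Rounding loses at most `2 γ` per nonzero entry, in total `2 d γ ≤
d² γ` since `d ≥ 2`. -/
theorem oneNorm_sub_le (hγ : 0 < D.γ) (hH : D.H.IsHermitian) (hs : IsSparse d D.H)
    (hd : 2 ≤ d) : oneNorm D.H - (d : ℝ) ^ 2 * D.γ ≤ D.γ * D.Ω := by
  classical
  have hd' : (2 : ℝ) ≤ d := by exact_mod_cast hd
  have key : ∀ q, ∑ p, ‖D.H p q‖ ≤ D.γ * D.Ω + d * (2 * D.γ) := by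
    intro q
    set g : Fin D.nc → ℝ := fun j => ∑ ξ : Part,
      2 * (maxLevel D.γ (D.χ.piece j) ξ : ℝ) with hg
    have h0 : ∀ p, D.H p q = 0 ↔ D.H q p = 0 := fun p => by
      rw [← hH.apply p q, star_eq_zero]
    have h1 : ∀ p, ‖D.H p q‖ ≤ (if D.H q p = 0 then 0 else D.γ * g (D.χ.color p q)) +
        if D.H q p = 0 then 0 else 2 * D.γ := by
      intro p
      by_cases h : D.H q p = 0
      · rw [if_pos h, if_pos h, (h0 p).2 h]; simp
      · rw [if_neg h, if_neg h]
        refine (norm_le_sum_level hγ hH p q).trans ?_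
        have hl : ∀ ξ : Part, (level D.γ (ξ.val D.H p q) : ℝ) ≤
            maxLevel D.γ (D.χ.piece (D.χ.color p q)) ξ := by
          intro ξ
          have := level_le_maxLevel (A := D.χ.piece (D.χ.color p q)) (γ := D.γ) ξ p q
          rw [D.χ.val_piece, if_pos rfl] at this
          exact_mod_cast this
        have hX := hl .X
        have hY := hl .Y
        have hZ := hl .Z
        rw [hg]
        dsimp only
        rw [Part.sum_eq]
        nlinarith
    -- Properness makes `p ↦ color p q` injective on the nonzero entries, so the sum over rows is a
    -- partial sum over colors.
    have h2 : ∑ p, (if D.H q p = 0 then 0 else D.γ * g (D.χ.color p q)) ≤ D.γ * D.Ω := by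
      rw [Finset.sum_ite, Finset.sum_const_zero, zero_add, ← Finset.mul_sum]
      gcongr
      rw [← Finset.sum_image (f := g) (g := fun p => D.χ.color p q)]
      · rw [D.Ω_eq]
        push_cast
        exact Finset.sum_le_sum_of_subset_of_nonneg (Finset.subset_univ _)
          fun _ _ _ => Finset.sum_nonneg fun _ _ => by positivity
      · intro p hp p' hp' h
        simp only [Finset.coe_filter, Finset.mem_univ, true_and, Set.mem_ofPred_eq] at hp hp'
        refine D.χ.proper q p p' hp hp' ?_
        rw [D.χ.symm q p, D.χ.symm q p']
        exact h
    calc ∑ p, ‖D.H p q‖ ≤ _ := Finset.sum_le_sum fun p _ => h1 p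
      _ ≤ _ := by
        rw [Finset.sum_add_distrib]
        exact add_le_add h2 (sum_ite_le_of_isSparse hs (by positivity) q)
  have h3 : oneNorm D.H ≤ D.γ * D.Ω + d * (2 * D.γ) := ciSup_le key
  nlinarith [mul_nonneg (mul_nonneg (by linarith : (0 : ℝ) ≤ d) (by linarith : (0 : ℝ) ≤ d - 2))
    hγ.le]

end Run

end HamSim
end

open scoped NNReal

noncomputable section

namespace HamSim

set_option linter.unusedSectionVars false

open Matrix

/-! ### Existence of edge colorings -/

/-- Greedy coloring. -/
theorem exists_coloring {V : Type*} [Finite V] {R : V → V → Prop} (hR : ∀ u v, R u v → R v u)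
    {k : ℕ} (hk : ∀ v, {u | u ≠ v ∧ R v u}.ncard < k) :
    ∃ c : V → Fin k, ∀ u v, u ≠ v → R u v → c u ≠ c v := by
  classical
  cases nonempty_fintype V
  rcases isEmpty_or_nonempty V with hV | ⟨⟨v₀⟩⟩
  · exact ⟨fun v => (hV.false v).elim, fun u => (hV.false u).elim⟩
  have hk0 : 0 < k := (Nat.zero_le _).trans_lt (hk v₀)
  have key : ∀ s : Finset V, ∃ c : V → Fin k, ∀ u ∈ s, ∀ v ∈ s, u ≠ v → R u v → c u ≠ c v := by
    intro s
    induction s using Finset.induction_on with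
    | empty => exact ⟨fun _ => ⟨0, hk0⟩, by simp⟩
    | insert a s ha ih =>
      obtain ⟨c, hc⟩ := ih
      have hfree : ∃ x, x ∉ c '' {u | u ≠ a ∧ R a u} := by
        by_contra! h
        have h1 : (Set.univ : Set (Fin k)).ncard ≤ (c '' {u | u ≠ a ∧ R a u}).ncard :=
          Set.ncard_le_ncard (fun x _ => h x) (Set.toFinite _)
        have h2 := Set.ncard_image_le (f := c) (Set.toFinite {u | u ≠ a ∧ R a u})
        rw [Set.ncard_univ, Nat.card_eq_fintype_card, Fintype.card_fin] at h1
        have := hk a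
        omega
      obtain ⟨x, hx⟩ := hfree
      have hx' : ∀ u, u ≠ a → R a u → c u ≠ x := fun u hu h e => hx ⟨u, ⟨hu, h⟩, e⟩
      refine ⟨Function.update c a x, fun u hu v hv huv h => ?_⟩
      rcases Finset.mem_insert.1 hu with rfl | hu
      · rw [Function.update_self, Function.update_of_ne huv.symm]
        exact (hx' v huv.symm h).symm
      · have hua : u ≠ a := fun e => ha (e ▸ hu)
        rw [Function.update_of_ne hua]
        rcases Finset.mem_insert.1 hv with rfl | hv
        · rw [Function.update_self]
          exact hx' u huv (hR _ _ h)
        · have hva : v ≠ a := fun e => ha (e ▸ hv)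
          rw [Function.update_of_ne hva]
          exact hc u hu v hv huv h
  obtain ⟨c, hc⟩ := key Finset.univ
  exact ⟨c, fun u v => hc u (Finset.mem_univ u) v (Finset.mem_univ v)⟩

/-- Greedy coloring of unordered pairs. The edges at `p` or at `q`, with `{p, q}` itself removed,
number at most `2 d - 1`, which is less than `d²` for `d ≥ 2`. Pairs that are not edges conflict
with nothing. -/
theorem exists_edgeColoring {S : Type} [Fintype S] {H : Matrix S S ℂ} (hH : H.IsHermitian)
    {d : ℕ} (hd : 2 ≤ d) (hs : IsSparse d H) : Nonempty (EdgeColoring H (d ^ 2)) := by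
  classical
  have hsymm : ∀ p q, H p q ≠ 0 → H q p ≠ 0 := fun p q h h' => by
    rw [← hH.apply p q, h', star_zero] at h
    exact h rfl
  set R : Sym2 S → Sym2 S → Prop := fun e f =>
    ∃ p q q', H p q ≠ 0 ∧ H p q' ≠ 0 ∧ e = s(p, q) ∧ f = s(p, q') with hRdef
  have hR : ∀ e f, R e f → R f e := by
    rintro e f ⟨p, q, q', h, h', rfl, rfl⟩
    exact ⟨p, q', q, h', h, rfl, rfl⟩
  have hcard : ∀ e, {f | f ≠ e ∧ R e f}.ncard < d ^ 2 := by
    intro e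
    induction e using Sym2.ind with
    | _ p q =>
    by_cases hpq : H p q = 0
    · have : {f | f ≠ s(p, q) ∧ R s(p, q) f} = ∅ := by
        rw [Set.eq_empty_iff_forall_notMem]
        rintro f ⟨-, p', q', q'', h, -, he, -⟩
        rcases Sym2.eq_iff.1 he with ⟨rfl, rfl⟩ | ⟨rfl, rfl⟩
        · exact h hpq
        · exact hsymm _ _ h hpq
      rw [this, Set.ncard_empty]
      positivity
    · set T : Set (Sym2 S) := (fun x => s(p, x)) '' {x | H p x ≠ 0} ∪
        (fun x => s(q, x)) '' {x | H q x ≠ 0} with hT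
      have hTcard : T.ncard ≤ d + d :=
        (Set.ncard_union_le _ _).trans (add_le_add
          ((Set.ncard_image_le (Set.toFinite _)).trans (hs p))
          ((Set.ncard_image_le (Set.toFinite _)).trans (hs q)))
      have hmem : s(p, q) ∈ T := Or.inl ⟨q, hpq, rfl⟩
      have hsub : {f | f ≠ s(p, q) ∧ R s(p, q) f} ⊆ T \ {s(p, q)} := by
        rintro f ⟨hf, p', q', q'', -, h', he, rfl⟩
        refine ⟨?_, hf⟩
        rcases Sym2.eq_iff.1 he with ⟨rfl, rfl⟩ | ⟨rfl, rfl⟩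
        · exact Or.inl ⟨q'', h', rfl⟩
        · exact Or.inr ⟨q'', h', rfl⟩
      have h1 := Set.ncard_le_ncard hsub (Set.toFinite _)
      have h2 := Set.ncard_sdiff_singleton_add_one hmem (Set.toFinite _)
      nlinarith
  obtain ⟨c, hc⟩ := exists_coloring hR hcard
  refine ⟨⟨fun p q => c s(p, q), fun p q => by rw [Sym2.eq_swap], fun p q q' h h' e => ?_⟩⟩
  by_contra hne
  refine hc s(p, q) s(p, q') (fun e => hne ?_) ⟨p, q, q', h, h', rfl, rfl⟩ e
  exact Sym2.congr_right.1 e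

/-! ### The cost of the algorithm -/

namespace Run

variable {n : ℕ} {D : Run n} {K : ℕ} (S : D.Compilation K) (κ : GateCosts)

theorem le_cost_trial : D.w * S.oracleCircuit.cost κ ≤ S.trial.cost κ := by
  have h1 : D.w * S.oracleCircuit.cost κ ≤ Circuit.cost κ
      ((List.finRange D.w).flatMap fun s => S.load s ++ S.oracleCircuit ++ S.load s) := by
    rw [Circuit.cost_flatMap, ← Fin.sum_univ_def]
    calc D.w * S.oracleCircuit.cost κ = ∑ _s : Fin D.w, S.oracleCircuit.cost κ := by simp
      _ ≤ _ := by
        gcongr with s _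
        rw [Circuit.cost_append, Circuit.cost_append]
        have := Circuit.cost_nonneg κ (S.load s)
        linarith
  rw [Compilation.trial]
  simp only [Circuit.cost_append]
  have h2 := Circuit.cost_nonneg κ S.prepare
  have h3 := Circuit.cost_nonneg κ [S.flagGate]
  have h4 := Circuit.cost_nonneg κ S.phases
  linarith

theorem le_cost_segment : 3 * (D.w * S.oracleCircuit.cost κ) ≤ S.segment.cost κ := by
  rw [Compilation.segment]
  simp only [Circuit.cost_append, Circuit.cost_inv]
  have h1 := le_cost_trial S κ
  have h2 := Circuit.cost_nonneg κ S.reflect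
  have h3 := Circuit.cost_nonneg κ [Gate.one negGate (Wire.flag : D.W K)]
  linarith

/-- There are at least `5 γ t Ω` segments, each with three trials of `w` oracle calls; one trial per
segment suffices for the bound. -/
theorem le_cost_algorithm {a : ℝ} (ha : a ≤ D.γ * D.Ω) (ht : 0 ≤ D.t) :
    5 * D.t * a * D.w * S.oracleCircuit.cost κ ≤ S.algorithm.cost κ := by
  have hq : 0 ≤ D.w * S.oracleCircuit.cost κ :=
    mul_nonneg (Nat.cast_nonneg _) (Circuit.cost_nonneg κ _)
  have hN : 5 * D.γ * D.t * D.Ω ≤ D.numSegments := Nat.le_ceil _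
  rw [Compilation.algorithm, Circuit.cost_rep]
  calc 5 * D.t * a * D.w * S.oracleCircuit.cost κ
      = 5 * D.t * a * (D.w * S.oracleCircuit.cost κ) := by ring
    _ ≤ 5 * D.t * (D.γ * D.Ω) * (D.w * S.oracleCircuit.cost κ) := by gcongr
    _ = 5 * D.γ * D.t * D.Ω * (D.w * S.oracleCircuit.cost κ) := by ring
    _ ≤ D.numSegments * (D.w * S.oracleCircuit.cost κ) := by gcongr
    _ ≤ D.numSegments * S.segment.cost κ := by
      gcongr
      linarith [le_cost_segment S κ]

theorem le_cost_oracleCircuit :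
    D.Ω * (2 * ((D.indexBits - 1 : ℕ) * (κ.toffoli : ℝ))) ≤ S.oracleCircuit.cost κ := by
  rw [Compilation.oracleCircuit, Circuit.cost_flatMap, ← Fin.sum_univ_def]
  have hladder : (D.ladder K).cost κ = (D.indexBits - 1 : ℕ) * (κ.toffoli : ℝ) := by
    have : (Gate.cost κ : Gate (D.W K) → ℝ) ∘ (fun (i : Fin (D.indexBits - 1)) =>
        Gate.toffoli (Wire.conj i (by omega)) (.idx ⟨i + 1, by omega⟩) (.anc i)
          (by obtain ⟨i, hi⟩ := i; cases i <;> simp [Wire.conj])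
          (by obtain ⟨i, hi⟩ := i; cases i <;> simp [Wire.conj]) (by simp)) =
        fun _ => (κ.toffoli : ℝ) := rfl
    rw [Circuit.cost, ladder, List.map_map, this]
    simp
  calc (D.Ω : ℝ) * (2 * ((D.indexBits - 1 : ℕ) * (κ.toffoli : ℝ)))
      = ∑ _k : Fin D.Ω, 2 * ((D.indexBits - 1 : ℕ) * (κ.toffoli : ℝ)) := by simp
    _ ≤ _ := by
      gcongr with k _
      simp only [Circuit.cost_append, Circuit.cost_inv, hladder]
      have h1 := Circuit.cost_nonneg κ (D.flips K k)
      have h2 := Circuit.cost_nonneg κ (S.query k)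
      linarith

/-- From `x ≤ Ω < 2 ^ indexBits` the logarithm is at most the number of index bits. A single one of
the `Ω` query blocks, with its ladder and inverse ladder, is enough. -/
theorem le_cost_oracleCircuit_of_le {x : ℝ} (hx : 0 < x) (hxΩ : x ≤ D.Ω) :
    2 * ((⌈Real.logb 2 x⌉ : ℝ) - 1) * κ.toffoli ≤ S.oracleCircuit.cost κ := by
  have hΩ : 1 ≤ D.Ω := by
    have : (0 : ℝ) < D.Ω := hx.trans_le hxΩ
    exact_mod_cast this
  have hL : 1 ≤ D.indexBits := D.indexBits_pos ⟨0, hΩ⟩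
  have hlog : ⌈Real.logb 2 x⌉ ≤ (D.indexBits : ℤ) := by
    rw [Int.ceil_le, Real.logb_le_iff_le_rpow (by norm_num) hx]
    have h1 : (D.Ω : ℝ) ≤ 2 ^ D.indexBits := by exact_mod_cast D.Ω_lt_two_pow.le
    have h2 : (2 : ℝ) ^ ((D.indexBits : ℤ) : ℝ) = 2 ^ D.indexBits := by
      rw [Int.cast_natCast, Real.rpow_natCast]
    rw [h2]
    exact hxΩ.trans h1
  have hlog' : (⌈Real.logb 2 x⌉ : ℝ) ≤ D.indexBits := by exact_mod_cast hlog
  have hL' : ((D.indexBits - 1 : ℕ) : ℝ) = D.indexBits - 1 := by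
    rw [Nat.cast_sub hL, Nat.cast_one]
  have hκ : (0 : ℝ) ≤ κ.toffoli := κ.toffoli.2
  calc 2 * ((⌈Real.logb 2 x⌉ : ℝ) - 1) * κ.toffoli
      ≤ 2 * ((D.indexBits : ℝ) - 1) * κ.toffoli := by gcongr
    _ = 1 * (2 * ((D.indexBits - 1 : ℕ) * (κ.toffoli : ℝ))) := by rw [hL']; ring
    _ ≤ D.Ω * (2 * ((D.indexBits - 1 : ℕ) * (κ.toffoli : ℝ))) := by
      gcongr
      exact_mod_cast hΩ
    _ ≤ _ := le_cost_oracleCircuit S κ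

end Run

end HamSim
end

/-! ### Exponentials, unitarity and operator norms -/

open scoped NNReal

noncomputable section

namespace HamSim

set_option linter.unusedSectionVars false

open Matrix
open scoped Matrix.Norms.L2Operator

/-- With the idempotent `P = (1 + C) / 2`, the map `(a, b) ↦ a P + b (1 - P)` is a continuous ring
homomorphism, so the exponential is computed in `ℂ × ℂ`: `exp (i π P) = -P + (1 - P) = -C`. -/
theorem exp_smul_one_add_involution {𝔸 : Type*} [NormedRing 𝔸] [NormedAlgebra ℂ 𝔸]
    [CompleteSpace 𝔸] {C : 𝔸} (hC : C * C = 1) :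
    NormedSpace.exp (Complex.I • ((Real.pi / 2 : ℝ) : ℂ) • (1 + C)) = -C := by
  set P : 𝔸 := (1 / 2 : ℂ) • (1 + C) with hP
  have hPP : P * P = P := by
    rw [hP, smul_mul_smul_comm, add_mul, mul_add, mul_add, hC, one_mul, mul_one, one_mul]
    module
  let f : ℂ × ℂ →+* 𝔸 :=
    { toFun := fun a => a.1 • P + a.2 • (1 - P)
      map_one' := by simp
      map_zero' := by simp
      map_add' := fun a b => by simp only [Prod.fst_add, Prod.snd_add]; module
      map_mul' := fun a b => by
        have h1 : P * (1 - P) = 0 := by rw [mul_sub, hPP, mul_one, sub_self]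
        have h2 : (1 - P) * P = 0 := by rw [sub_mul, hPP, one_mul, sub_self]
        have h3 : (1 - P) * (1 - P) = 1 - P := by rw [mul_sub, h2, mul_one, sub_zero]
        simp only [add_mul, mul_add, smul_mul_smul_comm, hPP, h1, h2, h3, smul_zero, add_zero,
          zero_add, Prod.fst_mul, Prod.snd_mul] }
  have hf : Continuous f := by
    change Continuous fun a : ℂ × ℂ => a.1 • P + a.2 • (1 - P)
    fun_prop
  let := NormedAlgebra.restrictScalars ℚ ℂ 𝔸
  have h1 : Complex.I • ((Real.pi / 2 : ℝ) : ℂ) • (1 + C) = f (Real.pi * Complex.I, 0) := by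
    change _ = ((Real.pi * Complex.I : ℂ) • P + (0 : ℂ) • (1 - P))
    rw [hP, zero_smul, add_zero, smul_smul, smul_smul]
    congr 1
    push_cast
    ring
  have h2 : NormedSpace.exp ((Real.pi * Complex.I, 0) : ℂ × ℂ) = (-1, 1) := by
    ext1
    · rw [Prod.fst_exp, ← Complex.exp_eq_exp_ℂ]
      exact Complex.exp_pi_mul_I
    · rw [Prod.snd_exp]
      exact NormedSpace.exp_zero
  rw [h1, ← NormedSpace.map_exp f hf, h2]
  change (-1 : ℂ) • P + (1 : ℂ) • (1 - P) = -C
  rw [hP]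
  module

section norms

variable {m n : Type} [Fintype m] [DecidableEq m] [Fintype n] [DecidableEq n] [Nonempty n]

theorem norm_le_one_of_isometry {A : Matrix m n ℂ} (h : Aᴴ * A = 1) : ‖A‖ ≤ 1 := by
  have h1 := Matrix.l2_opNorm_conjTranspose_mul_self A
  rw [h, CStarRing.norm_one] at h1
  nlinarith [norm_nonneg A]

theorem norm_le_of_forall_mulVec {A : Matrix m n ℂ} {R : ℝ} (hR : 0 ≤ R)
    (h : ∀ x : n → ℂ, ‖WithLp.toLp 2 (A *ᵥ x)‖ ≤ R * ‖WithLp.toLp 2 x‖) : ‖A‖ ≤ R := by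
  rw [Matrix.l2_opNorm_def]
  refine ContinuousLinearMap.opNorm_le_bound _ hR fun x => ?_
  exact h (WithLp.ofLp x)

theorem conjTranspose_mul_self_list_prod {l : List (Matrix n n ℂ)}
    (h : ∀ A ∈ l, Aᴴ * A = 1) : l.prodᴴ * l.prod = 1 := by
  have : l.prod ∈ Matrix.unitaryGroup n ℂ :=
    list_prod_mem fun A hA => Matrix.mem_unitaryGroup_iff'.2 (h A hA)
  exact Matrix.mem_unitaryGroup_iff'.1 this

theorem cos_sin_isometry {C : Matrix n n ℂ} (hH : C.IsHermitian) (hC : C * C = 1) (a : ℝ) :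
    ((Real.cos a : ℂ) • (1 : Matrix n n ℂ) + (-(Real.sin a * Complex.I) : ℂ) • C)ᴴ *
      ((Real.cos a : ℂ) • (1 : Matrix n n ℂ) + (-(Real.sin a * Complex.I) : ℂ) • C) = 1 := by
  have h1 : (Real.cos a : ℂ) * Real.cos a + Real.sin a * Real.sin a = 1 := by
    norm_cast
    nlinarith [Real.sin_sq_add_cos_sq a]
  rw [Matrix.conjTranspose_add, Matrix.conjTranspose_smul, Matrix.conjTranspose_smul, hH.eq,
    Matrix.conjTranspose_one]
  simp only [Complex.star_def, map_neg, map_mul, Complex.conj_ofReal, Complex.conj_I]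
  rw [add_mul, mul_add, mul_add]
  simp only [smul_mul_smul_comm, hC, one_mul, mul_one]
  have h2 : (-((Real.sin a : ℂ) * -Complex.I)) * (-(Real.sin a * Complex.I)) =
      (Real.sin a : ℂ) * Real.sin a := by
    linear_combination -((Real.sin a : ℂ) * Real.sin a) * Complex.I_mul_I
  rw [h2]
  have h3 : (1 : Matrix n n ℂ) = ((Real.cos a : ℂ) * Real.cos a + Real.sin a * Real.sin a) • 1 := by
    rw [h1, one_smul]
  conv_rhs => rw [h3]
  module

theorem exp_smul_isometry {H : Matrix n n ℂ} (hH : H.IsHermitian) (t a : ℝ) :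
    (NormedSpace.exp (a • (-(Complex.I * t)) • H))ᴴ *
      NormedSpace.exp (a • (-(Complex.I * t)) • H) = 1 := by
  rw [← Matrix.exp_conjTranspose]
  have h : (a • (-(Complex.I * t)) • H)ᴴ = -(a • (-(Complex.I * t)) • H) := by
    rw [Matrix.conjTranspose_smul, Matrix.conjTranspose_smul, hH.eq]
    simp
  rw [h]
  set X : Matrix n n ℂ := a • (-(Complex.I * t)) • H
  have hc : Commute (-X) X := (Commute.refl X).neg_left
  rw [← Matrix.exp_add_of_commute _ _ hc, neg_add_cancel, NormedSpace.exp_zero]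

end norms

end HamSim
end

/-! ### The Lie product of a segment and the propagation of errors -/

open scoped NNReal

noncomputable section

namespace HamSim

set_option linter.unusedSectionVars false

open Matrix
open scoped Matrix.Norms.L2Operator

theorem map_finRange_modNat {α β : Type*} (l : List α) (f : α → β) (r : ℕ) :
    (List.finRange (r * l.length)).map (fun i => f (l.get i.modNat)) =
      (List.replicate r (l.map f)).flatten := by
  rw [← List.ofFn_eq_map, List.ofFn_mul, ← List.ofFn_const]
  congr 2
  funext i
  conv_rhs => rw [← List.ofFn_get l, List.map_ofFn]
  congr 1
  funext j
  have : (Fin.modNat ⟨i * l.length + j, by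
      calc (i : ℕ) * l.length + j < (i + 1) * l.length := by
            rw [Nat.add_mul, Nat.one_mul]; exact Nat.add_lt_add_left j.prop _
        _ ≤ r * l.length := Nat.mul_le_mul_right _ i.prop⟩ : Fin l.length) = j := by
    ext
    simp [Fin.modNat, Nat.mod_eq_of_lt j.prop]
  exact congrArg (fun k => f (l.get k)) this

theorem prod_reverse_flatten_replicate {M : Type*} [Monoid M] (l : List M) (r : ℕ) :
    (List.replicate r l).flatten.reverse.prod = l.reverse.prod ^ r := by
  induction r with
  | zero => simp
  | succ r ih => rw [List.replicate_succ, List.flatten_cons, List.reverse_append, List.prod_append,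
      ih, pow_succ]

namespace Run

variable {n : ℕ} (D : Run n)

theorem queryUnitary_eq (hH : D.H.IsHermitian) (k : Fin D.Ω) :
    D.queryUnitary k = -D.signMatrices.get k :=
  exp_smul_one_add_involution (D.mul_self_of_mem_signMatrices hH (List.get_mem _ _))

/-- The Lie product over all matrices, with the first matrix on the right. -/
def lieStep (D : Run n) (θ : ℝ) : Matrix (BitState (Fin n)) (BitState (Fin n)) ℂ :=
  (D.signMatrices.reverse.map fun C =>
    (Real.cos θ : ℂ) • (1 : Matrix (BitState (Fin n)) (BitState (Fin n)) ℂ) +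
      (-(Real.sin θ * Complex.I) : ℂ) • C).prod

/-- The query is `-C`, so `c + i s (-C)` is `exp (-i θ C)`; the indices modulo `Ω` run through the
whole list `r` times. -/
theorem fullProduct_queryUnitary (hH : D.H.IsHermitian) (θ : ℝ) :
    fullProduct (Real.cos θ : ℂ) (Real.sin θ * Complex.I) D.numFactors
      (fun i => D.queryUnitary (D.factorMatrix i)) = D.lieStep θ ^ D.r := by
  set f : Matrix (BitState (Fin n)) (BitState (Fin n)) ℂ →
    Matrix (BitState (Fin n)) (BitState (Fin n)) ℂ := fun C =>
    (Real.cos θ : ℂ) • (1 : Matrix (BitState (Fin n)) (BitState (Fin n)) ℂ) +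
      (-(Real.sin θ * Complex.I) : ℂ) • C with hf
  have h1 : ∀ i, (Real.cos θ : ℂ) • (1 : Matrix _ _ ℂ) +
      ((Real.sin θ : ℂ) * Complex.I) • D.queryUnitary (D.factorMatrix i) =
      f (D.signMatrices.get (D.factorMatrix i)) := fun i => by
    rw [queryUnitary_eq D hH, smul_neg, ← neg_smul]
  simp only [fullProduct, h1]
  rw [lieStep, List.map_reverse, ← prod_reverse_flatten_replicate, ← map_finRange_modNat]
  rfl

/-- A control qubit contributes `c / (c + s)` or `i s / (c + s)`, and the flag contributes `(c + s)
^ m / 2`, which cancels the denominators. The hypothesis `hm` makes the flag amplitude at most `1`,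
so that the `arccos` in its gate is undone by the cosine. -/
theorem two_smul_trialBlock {K : ℕ} (S : D.Compilation K) (hc : 0 < Real.cos D.angle)
    (hs : 0 ≤ Real.sin D.angle)
    (hm : (Real.cos D.angle + Real.sin D.angle) ^ D.numFactors ≤ 2) :
    (2 : ℂ) • trialBlock S =
      truncatedProduct (Real.cos D.angle : ℂ) (Real.sin D.angle * Complex.I) D.w D.numFactors
        (fun i => D.queryUnitary (D.factorMatrix i)) := by
  set c := Real.cos D.angle with hcdef
  set s := Real.sin D.angle with hsdef
  have hcs : 0 < c + s := by linarith
  have hflag : (D.flagUnitary.1 false false : ℂ) = (((c + s) ^ D.numFactors / 2 : ℝ) : ℂ) := by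
    change ((Real.cos (Real.arccos _) : ℝ) : ℂ) = _
    rw [Real.cos_arccos]
    · have : 0 ≤ (c + s) ^ D.numFactors := by positivity
      linarith
    · linarith
  have hle : c / (c + s) ≤ 1 := by rw [div_le_one hcs]; linarith
  have h1 : (D.prepareGate.1 false false : ℂ) = ((Real.sqrt (c / (c + s)) : ℝ) : ℂ) := by
    change ((Real.cos (Real.arccos _) : ℝ) : ℂ) = _
    rw [Real.cos_arccos]
    · linarith [Real.sqrt_nonneg (c / (c + s))]
    · exact Real.sqrt_le_one.2 hle
  have hsin : Real.sin (Real.arccos (Real.sqrt (c / (c + s)))) = Real.sqrt (s / (c + s)) := by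
    rw [Real.sin_arccos, Real.sq_sqrt (by positivity)]
    congr 1
    field_simp
    ring
  have h2 : (D.prepareGate.1 false true : ℂ) = ((Real.sqrt (s / (c + s)) : ℝ) : ℂ) := by
    rw [← hsin]; rfl
  have h3 : (D.prepareGate.1 true false : ℂ) = ((Real.sqrt (s / (c + s)) : ℝ) : ℂ) := by
    rw [← hsin]; rfl
  rw [trialBlock_eq, truncatedProduct, Finset.smul_sum]
  refine Finset.sum_congr rfl fun b _ => ?_
  rw [smul_smul]
  congr 1
  rw [hflag]
  have key : ∀ i, ((c + s : ℝ) : ℂ) * ((D.prepareGate.1 false (b i) * phaseGate.1 (b i) (b i)) *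
      D.prepareGate.1 (b i) false) = if b i then (s : ℂ) * Complex.I else c := by
    intro i
    cases b i
    · rw [h1]
      have : ((c + s : ℝ) : ℂ) * ((Real.sqrt (c / (c + s)) : ℝ) * (Real.sqrt (c / (c + s)) : ℝ)) =
          c := by
        rw [← Complex.ofReal_mul, ← Complex.ofReal_mul, Real.mul_self_sqrt (by positivity)]
        congr 1
        field_simp
      simpa [phaseGate] using this
    · rw [h2, h3]
      have : ((c + s : ℝ) : ℂ) * ((Real.sqrt (s / (c + s)) : ℝ) * (Real.sqrt (s / (c + s)) : ℝ)) =
          s := by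
        rw [← Complex.ofReal_mul, ← Complex.ofReal_mul, Real.mul_self_sqrt (by positivity)]
        congr 1
        field_simp
      have h4 : phaseGate.1 true true = Complex.I := by simp [phaseGate]
      rw [h4, if_pos rfl, ← this]
      ring
  simp only [← key, Finset.prod_mul_distrib, Finset.prod_const, Finset.card_univ, Fintype.card_fin]
  push_cast
  ring

end Run

section segments

variable {m n : Type} [Fintype m] [DecidableEq m] [Fintype n] [DecidableEq n] [Nonempty n]
  [Nonempty m]

/-- As `L` is unitary, `1 - V† V = -(L† (V - L) + (V - L)† V)` has norm at most `δ (2 + δ)`; the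
term `J (V - L)` adds another `δ`. -/
theorem norm_amplified_sub_le {E A : Matrix m m ℂ} {J : Matrix m n ℂ} {V L : Matrix n n ℂ} {δ : ℝ}
    (hE : E * J = J * V + A * J * (1 - Vᴴ * V)) (hA : ‖A‖ ≤ 1) (hJ : ‖J‖ ≤ 1)
    (hL : Lᴴ * L = 1) (hVL : ‖V - L‖ ≤ δ) : ‖E * J - J * L‖ ≤ δ * (3 + δ) := by
  have hδ : 0 ≤ δ := (norm_nonneg _).trans hVL
  have hL1 := norm_le_one_of_isometry hL
  have hV1 : ‖V‖ ≤ 1 + δ := by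
    calc ‖V‖ = ‖L + (V - L)‖ := by rw [add_sub_cancel]
      _ ≤ 1 + δ := (norm_add_le _ _).trans (add_le_add hL1 hVL)
  have h1 : 1 - Vᴴ * V = -(Lᴴ * (V - L) + (V - L)ᴴ * V) := by
    rw [Matrix.conjTranspose_sub, Matrix.mul_sub, Matrix.sub_mul, hL]
    abel
  have h2 : ‖1 - Vᴴ * V‖ ≤ δ * (2 + δ) := by
    rw [h1, norm_neg]
    calc ‖Lᴴ * (V - L) + (V - L)ᴴ * V‖ ≤ ‖Lᴴ‖ * ‖V - L‖ + ‖(V - L)ᴴ‖ * ‖V‖ :=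
          (norm_add_le _ _).trans
            (add_le_add (Matrix.l2_opNorm_mul _ _) (Matrix.l2_opNorm_mul _ _))
      _ ≤ 1 * δ + δ * (1 + δ) := by
          rw [Matrix.l2_opNorm_conjTranspose, Matrix.l2_opNorm_conjTranspose]
          gcongr
      _ = δ * (2 + δ) := by ring
  have h3 : E * J - J * L = J * (V - L) + A * J * (1 - Vᴴ * V) := by
    rw [hE, Matrix.mul_sub J]
    abel
  rw [h3]
  calc ‖J * (V - L) + A * J * (1 - Vᴴ * V)‖
      ≤ ‖J‖ * ‖V - L‖ + ‖A‖ * ‖J‖ * ‖1 - Vᴴ * V‖ := by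
        refine (norm_add_le _ _).trans (add_le_add (Matrix.l2_opNorm_mul _ _)
          ((Matrix.l2_opNorm_mul _ _).trans ?_))
        gcongr
        exact Matrix.l2_opNorm_mul _ _
    _ ≤ 1 * δ + 1 * 1 * (δ * (2 + δ)) := by gcongr
    _ = δ * (3 + δ) := by ring

theorem norm_pow_mul_sub_le {E : Matrix m m ℂ} {J : Matrix m n ℂ} {L : Matrix n n ℂ} {β : ℝ}
    (hE : ‖E‖ ≤ 1) (hL : ‖L‖ ≤ 1) (h : ‖E * J - J * L‖ ≤ β) (k : ℕ) :
    ‖E ^ k * J - J * L ^ k‖ ≤ k * β := by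
  induction k with
  | zero => simp
  | succ k ih =>
    have h1 : E ^ (k + 1) * J - J * L ^ (k + 1) =
        E ^ k * (E * J - J * L) + (E ^ k * J - J * L ^ k) * L := by
      rw [pow_succ, pow_succ, Matrix.mul_sub, Matrix.sub_mul]
      simp only [Matrix.mul_assoc]
      abel
    rw [h1]
    calc _ ≤ ‖E ^ k‖ * ‖E * J - J * L‖ + ‖E ^ k * J - J * L ^ k‖ * ‖L‖ :=
          (norm_add_le _ _).trans
            (add_le_add (Matrix.l2_opNorm_mul _ _) (Matrix.l2_opNorm_mul _ _))
      _ ≤ 1 * β + k * β * 1 := by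
          gcongr
          · exact norm_pow_le_one hE k
          · exact (norm_nonneg _).trans ih
      _ = ((k + 1 : ℕ) : ℝ) * β := by push_cast; ring

end segments

end HamSim
end

/-! ### The error budget -/

open scoped NNReal

noncomputable section

namespace HamSim

set_option linter.unusedSectionVars false

open Matrix
open scoped Matrix.Norms.L2Operator

/-- The term `w ^ w / w!` of the exponential series gives `1 / w! ≤ e ^ w / w ^ w ≤ δ ^ 2 / 2`, and
passing to `(w + 1)!` gains a factor `2`. -/
theorem IsTruncationOrder.inv_factorial_le {δ : ℝ} {w : ℕ} (h : IsTruncationOrder δ w)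
    (hδ : 0 < δ) :
    1 ≤ w ∧ ((w + 1).factorial : ℝ)⁻¹ ≤ 1 / 2 ∧ ((w + 1).factorial : ℝ)⁻¹ ≤ δ / 2 := by
  obtain ⟨hw, h⟩ := h.1
  have hw' : (1 : ℝ) ≤ w := by exact_mod_cast hw
  have hf : (0 : ℝ) < w.factorial := by exact_mod_cast w.factorial_pos
  have hf1 : (1 : ℝ) ≤ w.factorial := by exact_mod_cast w.factorial_pos
  have h1 := Real.pow_div_factorial_le_exp (w : ℝ) (by linarith) w
  have h2 : (w.factorial : ℝ)⁻¹ ≤ δ ^ 2 / 2 := by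
    refine le_trans ?_ h
    rw [le_div_iff₀ (by positivity), inv_mul_eq_div]
    exact h1
  have h3 : ((w + 1).factorial : ℝ)⁻¹ ≤ (w.factorial : ℝ)⁻¹ / 2 := by
    rw [Nat.factorial_succ, Nat.cast_mul, mul_inv, div_eq_inv_mul]
    gcongr
    push_cast
    linarith
  have h4 : (w.factorial : ℝ)⁻¹ ≤ 1 := inv_le_one_of_one_le₀ hf1
  have h5 : 0 < ((w + 1).factorial : ℝ)⁻¹ := by positivity
  refine ⟨hw, by linarith, ?_⟩
  -- If `q = 1 / (w + 1)!` exceeded `δ / 2`, then `q ≤ δ ^ 2 / 4 < q ^ 2`, contradicting `q ≤ 1 /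
  -- 2`.
  by_contra! h6
  nlinarith

theorem pow_mul_choose_le {s θ : ℝ} (hs : 0 ≤ s) (hsθ : s ≤ θ) {m w : ℕ} (hw : 1 ≤ w)
    (hm : m * θ ≤ 1) :
    s ^ (w + 1) * m.choose (w + 1) ≤ (m * θ) ^ 2 * ((w + 1).factorial : ℝ)⁻¹ := by
  have hθ : 0 ≤ θ := hs.trans hsθ
  calc s ^ (w + 1) * m.choose (w + 1)
      ≤ θ ^ (w + 1) * ((m : ℝ) ^ (w + 1) / (w + 1).factorial) := by
        gcongr
        exact Nat.choose_le_pow_div (α := ℝ) _ _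
    _ = (m * θ) ^ (w + 1) * ((w + 1).factorial : ℝ)⁻¹ := by rw [mul_pow]; ring
    _ ≤ (m * θ) ^ 2 * ((w + 1).factorial : ℝ)⁻¹ := by
        gcongr ?_ * _
        exact pow_le_pow_of_le_one (by positivity) hm (by omega)

theorem cos_add_sin_pow_le {θ : ℝ} (hθ : 0 ≤ θ) {m : ℕ} (hm : m * θ ≤ 1 / 2)
    (h0 : 0 ≤ Real.cos θ + Real.sin θ) : (Real.cos θ + Real.sin θ) ^ m ≤ 2 := by
  have h1 : Real.cos θ + Real.sin θ ≤ Real.exp θ := by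
    have := Real.add_one_le_exp θ
    have := Real.sin_le hθ
    have := Real.cos_le_one θ
    linarith
  calc (Real.cos θ + Real.sin θ) ^ m ≤ Real.exp θ ^ m := by gcongr
    _ = Real.exp (m * θ) := by rw [← Real.exp_nat_mul]
    _ ≤ Real.exp (Real.log 2) := by
        gcongr
        have := Real.log_two_gt_d9
        linarith
    _ = 2 := Real.exp_log two_pos

namespace Run

variable {n : ℕ} {D : Run n} {K : ℕ}

theorem norm_lieStep_factor_le (hH : D.H.IsHermitian)
    {C : Matrix (BitState (Fin n)) (BitState (Fin n)) ℂ} (hC : C ∈ D.signMatrices) (a : ℝ) :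
    ‖(Real.cos a : ℂ) • (1 : Matrix (BitState (Fin n)) (BitState (Fin n)) ℂ) +
      (-(Real.sin a * Complex.I) : ℂ) • C‖ ≤ 1 :=
  norm_le_one_of_isometry (cos_sin_isometry (D.isHermitian_of_mem_signMatrices hH hC)
    (D.mul_self_of_mem_signMatrices hH hC) a)

theorem norm_queryUnitary_le (hH : D.H.IsHermitian) (k : Fin D.Ω) : ‖D.queryUnitary k‖ ≤ 1 := by
  have hk : D.signMatrices.get k ∈ D.signMatrices := List.get_mem _ _
  rw [queryUnitary_eq D hH, norm_neg]
  refine norm_le_one_of_isometry ?_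
  rw [(D.isHermitian_of_mem_signMatrices hH hk).eq, D.mul_self_of_mem_signMatrices hH hk]

theorem lieStep_isometry (hH : D.H.IsHermitian) (θ : ℝ) :
    (D.lieStep θ)ᴴ * D.lieStep θ = 1 := by
  refine conjTranspose_mul_self_list_prod fun A hA => ?_
  obtain ⟨C, hC, rfl⟩ := List.mem_map.1 hA
  rw [List.mem_reverse] at hC
  exact cos_sin_isometry (D.isHermitian_of_mem_signMatrices hH hC)
    (D.mul_self_of_mem_signMatrices hH hC) θ

theorem norm_segment_mul_sub_le (S : D.Compilation K) (hH : D.H.IsHermitian)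
    (hc : 0 < Real.cos D.angle) (hs : 0 ≤ Real.sin D.angle)
    (hm : (Real.cos D.angle + Real.sin D.angle) ^ D.numFactors ≤ 2) {δ : ℝ}
    (hδ : 2 * Real.sin D.angle ^ (D.w + 1) * D.numFactors.choose (D.w + 1) ≤ δ) :
    ‖S.segment.mat * D.zeroEmbedding K - D.zeroEmbedding K * D.lieStep D.angle ^ D.r‖ ≤
      δ * (3 + δ) := by
  have hL : (D.lieStep D.angle ^ D.r)ᴴ * D.lieStep D.angle ^ D.r = 1 := by
    have h : D.lieStep D.angle ∈ Matrix.unitaryGroup (BitState (Fin n)) ℂ :=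
      Matrix.mem_unitaryGroup_iff'.2 (lieStep_isometry hH _)
    exact Matrix.mem_unitaryGroup_iff'.1 (pow_mem h D.r)
  refine norm_amplified_sub_le (segment_mul_embedding S)
    (norm_le_one_of_isometry (Circuit.conjTranspose_mul_self _))
    (norm_le_one_of_isometry (Wire.embedding_isometry _)) hL ?_
  rw [two_smul_trialBlock D S hc hs hm, ← fullProduct_queryUnitary D hH]
  refine (norm_truncatedProduct_sub_le hc.le (Real.cos_le_one _) hs ?_ _ _ _
    (fun i => norm_queryUnitary_le hH _) fun i => ?_).trans hδ
  · rw [Complex.ofReal_cos, Complex.ofReal_sin, ← Complex.exp_mul_I,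
      Complex.norm_exp_ofReal_mul_I]
  · rw [queryUnitary_eq D hH, smul_neg, ← neg_smul]
    exact norm_lieStep_factor_le hH (List.get_mem _ _) _

/-- The total angle `μ = γ t Ω / N` of a segment is at most `1 / 5`. A segment errs by at most `8 μ
^ 2 q`; over `N` segments one factor `μ` combines with `N` to `γ t Ω`, and the other is bounded by
`1 / 5`. -/
theorem norm_algorithm_mul_sub_le (S : D.Compilation K) (hH : D.H.IsHermitian) (hγ : 0 < D.γ)
    (ht : 0 < D.t) (hr : 0 < D.r) (hw : 1 ≤ D.w) {q : ℝ}
    (hq : q = ((D.w + 1).factorial : ℝ)⁻¹) (hq2 : q ≤ 1 / 2) :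
    ‖S.algorithm.mat * D.zeroEmbedding K -
      D.zeroEmbedding K * D.lieStep (D.γ * D.t / ((D.r * D.numSegments : ℕ) : ℝ)) ^
        (D.r * D.numSegments)‖ ≤ 8 / 5 * (D.γ * D.t * D.Ω) * q := by
  have hq0 : 0 < q := by rw [hq]; positivity
  have hangle : D.γ * D.t / ((D.r * D.numSegments : ℕ) : ℝ) = D.angle := by
    rw [angle, Nat.cast_mul]
  rw [hangle, Compilation.algorithm, Circuit.mat_rep, pow_mul]
  -- Without segments the angle is a division by zero, but the circuit is empty and the power is
  -- trivial.
  rcases Nat.eq_zero_or_pos D.numSegments with hN | hN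
  · rw [hN, pow_zero, pow_zero, Matrix.one_mul, Matrix.mul_one, sub_self, norm_zero]
    positivity
  have hN' : (0 : ℝ) < D.numSegments := by exact_mod_cast hN
  have hr' : (0 : ℝ) < D.r := by exact_mod_cast hr
  have hNΩ : 5 * D.γ * D.t * D.Ω ≤ D.numSegments := Nat.le_ceil _
  have hΩ : 1 ≤ D.Ω := by
    by_contra! h
    have h0 : D.Ω = 0 := by omega
    have : D.numSegments = 0 := by simp [numSegments, h0]
    omega
  have hθ : 0 < D.angle := by rw [angle]; positivity
  set μ : ℝ := D.numFactors * D.angle with hμ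
  have hμ1 : μ * D.numSegments = D.γ * D.t * D.Ω := by
    rw [hμ, angle, numFactors, Nat.cast_mul]
    field_simp
  have hμ0 : 0 ≤ μ := by positivity
  have hμ5 : μ ≤ 1 / 5 := by
    by_contra! h
    have := mul_lt_mul_of_pos_right h hN'
    linarith
  have hm1 : (1 : ℝ) ≤ D.numFactors := by
    have : 1 ≤ D.r * D.Ω := Nat.mul_pos hr hΩ
    exact_mod_cast this
  have hθ5 : D.angle ≤ 1 / 5 := (le_mul_of_one_le_left hθ.le hm1).trans hμ5
  have hpi := Real.pi_gt_three
  have hc : 0 < Real.cos D.angle := Real.cos_pos_of_mem_Ioo ⟨by linarith, by linarith⟩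
  have hs : 0 ≤ Real.sin D.angle := Real.sin_nonneg_of_nonneg_of_le_pi hθ.le (by linarith)
  have hδ : 2 * Real.sin D.angle ^ (D.w + 1) * D.numFactors.choose (D.w + 1) ≤ 2 * (μ ^ 2 * q) := by
    rw [mul_assoc, hq]
    exact mul_le_mul_of_nonneg_left
      (pow_mul_choose_le hs (Real.sin_le hθ.le) hw (by linarith)) two_pos.le
  have hseg := norm_segment_mul_sub_le S hH hc hs
    (cos_add_sin_pow_le hθ.le (by linarith) (by linarith)) hδ
  have hL := norm_pow_le_one (norm_le_one_of_isometry (lieStep_isometry hH D.angle)) D.r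
  refine (norm_pow_mul_sub_le (norm_le_one_of_isometry (Circuit.conjTranspose_mul_self _)) hL hseg
    _).trans ?_
  have hδ1 : 2 * (μ ^ 2 * q) ≤ 1 := by nlinarith
  calc D.numSegments * (2 * (μ ^ 2 * q) * (3 + 2 * (μ ^ 2 * q)))
      ≤ D.numSegments * (2 * (μ ^ 2 * q) * (3 + 1)) := by gcongr
    _ = 8 * μ * (μ * D.numSegments) * q := by ring
    _ ≤ 8 * (1 / 5) * (D.γ * D.t * D.Ω) * q := by rw [hμ1]; gcongr
    _ = _ := by ring

theorem norm_hamiltonian_sub_le {d : ℕ} (hγ : 0 < D.γ) (ht : 0 < D.t) (hH : D.H.IsHermitian)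
    (hs : IsSparse d D.H) :
    ‖(-(((D.γ * D.t : ℝ) : ℂ) * Complex.I)) • D.signMatrices.reverse.sum -
      (-(Complex.I * D.t)) • D.H‖ ≤ D.t * (d * (3 * D.γ)) := by
  have h1 : (-(((D.γ * D.t : ℝ) : ℂ) * Complex.I)) • D.signMatrices.reverse.sum -
      (-(Complex.I * D.t)) • D.H =
      (-(Complex.I * D.t)) • ((D.γ : ℂ) • D.signMatrices.sum - D.H) := by
    rw [List.sum_reverse, smul_sub, smul_smul]
    congr 2
    push_cast
    ring
  rw [h1, norm_smul, norm_neg, norm_mul, Complex.norm_I, one_mul, Complex.norm_real,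
    Real.norm_of_nonneg ht.le]
  gcongr
  exact norm_le_of_forall_mulVec (by positivity) (D.norm_rounding_mulVec_le hγ hH hs)

theorem simulates_of_norm_le (S : D.Compilation K) {ε : ℝ}
    (h : ‖S.algorithm.mat * D.zeroEmbedding K -
      D.zeroEmbedding K * NormedSpace.exp ((-(Complex.I * D.t)) • D.H)‖ ≤ ε) :
    S.Simulates ε := by
  intro ψ
  rw [← Wire.embedding_mulVec, ← Wire.embedding_mulVec, Matrix.mulVec_mulVec,
    Matrix.mulVec_mulVec, ← Matrix.sub_mulVec]
  refine (Matrix.l2_opNorm_mulVec _ _).trans ?_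
  exact mul_le_mul_of_nonneg_right h (norm_nonneg _)

end Run

theorem precision_pos {d : ℕ} (hd : 2 ≤ d) {ε t : ℝ} (hε : 0 < ε) (ht : 0 < t) :
    0 < precision d ε t := by
  have : (0 : ℝ) < d := by exact_mod_cast (by omega : 0 < d)
  unfold precision
  positivity

theorem mul_precision_le {d : ℕ} (hd : 2 ≤ d) {ε t : ℝ} (hε : 0 < ε) (ht : 0 < t) :
    t * (d * (3 * precision d ε t)) ≤ 3 / 5 * ε := by
  have hd' : (2 : ℝ) ≤ d := by exact_mod_cast hd
  have h2 : (5 / 4 : ℝ) ≤ Real.sqrt 2 := Real.le_sqrt_of_sq_le (by norm_num)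
  have h : t * (d * (3 * precision d ε t)) = 3 * ε / (Real.sqrt 2 * (d : ℝ) ^ 2) := by
    unfold precision
    field_simp
  rw [h, div_le_iff₀ (by positivity)]
  -- This is `5 / 4 · 4`, using `d ≥ 2`.
  have : (5 : ℝ) ≤ Real.sqrt 2 * (d : ℝ) ^ 2 := by nlinarith
  nlinarith

namespace Run

variable {n d : ℕ} {D : Run n}

/-- If rounding leaves no matrix, there are no segments and `r N = 0` never becomes large. Then all
Lie products are `1`, and the bound at `M₀` carries over to every `M`. -/
theorem exists_norm_lieStep_pow_sub_le (hγ : 0 < D.γ) (ht : 0 < D.t) (hH : D.H.IsHermitian)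
    (hs : IsSparse d D.H) {η : ℝ} (hη : 0 < η) :
    ∃ M₀ : ℕ, ∀ M : ℕ, M₀ ≤ M ∨ D.Ω = 0 →
      ‖D.lieStep (D.γ * D.t / M) ^ M - NormedSpace.exp ((-(Complex.I * D.t)) • D.H)‖ ≤
        D.t * (d * (3 * D.γ)) + η := by
  obtain ⟨M₀, hM⟩ := Filter.eventually_atTop.1 <|
    eventually_norm_lieProduct_sub_exp_le (D.γ * D.t) D.signMatrices.reverse
      ((-(Complex.I * D.t)) • D.H)
      (fun C hC a => norm_lieStep_factor_le hH (List.mem_reverse.1 hC) a)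
      (fun a => norm_le_one_of_isometry (exp_smul_isometry hH D.t a))
      (norm_hamiltonian_sub_le hγ ht hH hs) hη
  refine ⟨M₀, fun M h => h.elim (fun h => hM M h) fun h => ?_⟩
  have h1 : ∀ θ k, D.lieStep θ ^ k = 1 := fun θ k => by
    rw [lieStep, List.length_eq_zero_iff.1 h, List.reverse_nil, List.map_nil, List.prod_nil,
      one_pow]
  have h2 := hM M₀ le_rfl
  rw [← lieStep, h1] at h2
  rwa [h1]

/-- The budget: `ε / 10` for truncation and amplification, `3 ε / 5` for rounding, `ε / 10` for the
Lie product. -/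
theorem simulates_of_norm_lieStep_le {K : ℕ} (S : D.Compilation K) (hd : 2 ≤ d) {ε : ℝ}
    (hε : 0 < ε) (ht : 0 < D.t) (hγ : D.γ = precision d ε D.t) (hH : D.H.IsHermitian)
    (hH0 : D.H ≠ 0) (hnc : D.nc ≤ d ^ 2)
    (hw : IsTruncationOrder (segmentPrecision D.H d ε D.t) D.w) (hr : 0 < D.r)
    (h : ‖D.lieStep (D.γ * D.t / ((D.r * D.numSegments : ℕ) : ℝ)) ^ (D.r * D.numSegments) -
      NormedSpace.exp ((-(Complex.I * D.t)) • D.H)‖ ≤ D.t * (d * (3 * D.γ)) + ε / 10) :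
    S.Simulates ε := by
  refine simulates_of_norm_le S ?_
  have hγ0 : 0 < D.γ := hγ ▸ precision_pos hd hε ht
  have hd0 : (0 : ℝ) < d := by exact_mod_cast (by omega : 0 < d)
  set B : ℝ := 6 * (d : ℝ) ^ 2 * ⌈maxNorm D.H / D.γ⌉ with hB
  have hBpos : 0 < B := by
    have : (0 : ℝ) < ⌈maxNorm D.H / D.γ⌉ := by
      exact_mod_cast Int.ceil_pos.2 (div_pos (maxNorm_pos hH0) hγ0)
    positivity
  have hδ : segmentPrecision D.H d ε D.t = 1 / 3 * (1 / B) * (ε / (5 * D.γ * D.t)) := by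
    rw [segmentPrecision, hB, hγ]
  rw [hδ] at hw
  obtain ⟨hw1, hq2, hq⟩ := hw.inv_factorial_le (by positivity)
  have hΩ : (D.Ω : ℝ) ≤ B := D.Ω_le hγ0 hH0 hnc
  have h1 := norm_algorithm_mul_sub_le S hH hγ0 ht hr hw1 rfl hq2
  set J := D.zeroEmbedding K
  set X := D.lieStep (D.γ * D.t / ((D.r * D.numSegments : ℕ) : ℝ)) ^ (D.r * D.numSegments)
  set Y := NormedSpace.exp ((-(Complex.I * D.t)) • D.H)
  have h3 : S.algorithm.mat * J - J * Y = (S.algorithm.mat * J - J * X) + J * (X - Y) := by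
    rw [Matrix.mul_sub]
    abel
  have h4 : 8 / 5 * (D.γ * D.t * D.Ω) * ((D.w + 1).factorial : ℝ)⁻¹ ≤ ε / 10 := by
    calc 8 / 5 * (D.γ * D.t * D.Ω) * ((D.w + 1).factorial : ℝ)⁻¹
        ≤ 8 / 5 * (D.γ * D.t * B) * (1 / 3 * (1 / B) * (ε / (5 * D.γ * D.t)) / 2) := by
          gcongr
      _ = 4 / 75 * ε := by field_simp; norm_num
      _ ≤ ε / 10 := by linarith
  have h5 := mul_precision_le hd hε ht
  rw [← hγ] at h5
  have hJ : ‖J‖ ≤ 1 := norm_le_one_of_isometry (Wire.embedding_isometry _)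
  rw [h3]
  calc _ ≤ ‖S.algorithm.mat * J - J * X‖ + ‖J‖ * ‖X - Y‖ :=
        (norm_add_le _ _).trans (add_le_add le_rfl (Matrix.l2_opNorm_mul _ _))
    _ ≤ ε / 10 + 1 * (D.t * (d * (3 * D.γ)) + ε / 10) := by
        gcongr
        exact h1.trans h4
    _ ≤ ε := by linarith

theorem exists_simulates {H : Matrix (BitState (Fin n)) (BitState (Fin n)) ℂ}
    (hd : 2 ≤ d) (hH : H.IsHermitian) (hH0 : H ≠ 0)
    (hs : IsSparse d H) {ε t γ : ℝ} (hε : 0 < ε) (ht : 0 < t) (hγ : γ = precision d ε t) {w : ℕ}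
    (hw : IsTruncationOrder (segmentPrecision H d ε t) w) {nc : ℕ} (hnc : nc ≤ d ^ 2)
    (χ : EdgeColoring H nc) :
    ∃ r₀ : ℕ, ∀ r ≥ r₀, ∀ (K : ℕ) (S : Compilation ⟨H, nc, χ, γ, t, w, r⟩ K),
      S.Simulates ε := by
  have hγ0 : 0 < γ := hγ ▸ precision_pos hd hε ht
  -- The threshold must precede `r`. The Lie step does not depend on `r`, so the run with `r = 0`
  -- serves for all of them.
  obtain ⟨M₀, hM⟩ := exists_norm_lieStep_pow_sub_le (D := ⟨H, nc, χ, γ, t, w, 0⟩) hγ0 ht hH hs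
    (show 0 < ε / 10 by positivity)
  refine ⟨max 1 M₀, fun r hr K S => ?_⟩
  have hr1 : 0 < r := (le_max_left 1 M₀).trans hr
  have hrM : M₀ ≤ r := (le_max_right 1 M₀).trans hr
  refine simulates_of_norm_lieStep_le S hd hε ht hγ hH hH0 hnc hw hr1 ?_
  refine hM _ ?_
  rcases Nat.eq_zero_or_pos (numSegments ⟨H, nc, χ, γ, t, w, r⟩) with hN | hN
  · right
    change Ω ⟨H, nc, χ, γ, t, w, r⟩ = 0
    have hN' := Nat.ceil_eq_zero.1 hN
    by_contra h
    have : (0 : ℝ) < Ω ⟨H, nc, χ, γ, t, w, r⟩ := by exact_mod_cast Nat.pos_of_ne_zero h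
    exact absurd hN' (not_le.2 (by positivity))
  · exact Or.inl (hrM.trans (Nat.le_mul_of_pos_right r hN))

end Run

end HamSim
end

/-! ### The theorem -/

theorem mainTheorem2 (n d : ℕ) (hd : 2 ≤ d)
    (H : Matrix (HamSim.BitState (Fin n)) (HamSim.BitState (Fin n)) ℂ)
    (hH : H.IsHermitian) (hH0 : H ≠ 0) (hsparse : HamSim.IsSparse d H)
    (ε t : ℝ) (hε : 0 < ε) (ht : 0 < t)
    (γ : ℝ) (hγ : γ = HamSim.precision d ε t)
    (w : ℕ) (hw : HamSim.IsTruncationOrder (HamSim.segmentPrecision H d ε t) w) :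
    (∃ nc ≤ d ^ 2, Nonempty (HamSim.EdgeColoring H nc)) ∧
    ∀ nc ≤ d ^ 2, ∀ χ : HamSim.EdgeColoring H nc,
      (∃ r₀ : ℕ, ∀ r ≥ r₀, ∀ (K : ℕ)
          (S : HamSim.Run.Compilation ⟨H, nc, χ, γ, t, w, r⟩ K), S.Simulates ε) ∧
      ∀ (r K : ℕ) (S : HamSim.Run.Compilation ⟨H, nc, χ, γ, t, w, r⟩ K)
          (κ : HamSim.GateCosts),
        S.algorithm.cost κ ≥
          5 * t * (HamSim.oneNorm H - (d : ℝ) ^ 2 * γ) * w * S.oracleCircuit.cost κ ∧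
        S.oracleCircuit.Implements HamSim.Wire.IsAncilla (HamSim.Run.oracle _ K) ∧
        (0 < HamSim.oneNorm H / γ - (d : ℝ) ^ 2 →
          S.oracleCircuit.cost κ ≥
            2 * ((⌈Real.logb 2 (HamSim.oneNorm H / γ - (d : ℝ) ^ 2)⌉ : ℝ) - 1) *
              κ.toffoli) := by
  have hγ0 : 0 < γ := hγ ▸ HamSim.precision_pos hd hε ht
  refine ⟨⟨d ^ 2, le_rfl, HamSim.exists_edgeColoring hH hd hsparse⟩, fun nc hnc χ =>
    ⟨HamSim.Run.exists_simulates hd hH hH0 hsparse hε ht hγ hw hnc χ, fun r K S κ => ?_⟩⟩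
  have h := HamSim.Run.oneNorm_sub_le
    (D := ⟨H, nc, χ, γ, t, w, r⟩) hγ0 hH hsparse hd
  refine ⟨HamSim.Run.le_cost_algorithm S κ h ht.le,
    HamSim.Run.oracleCircuit_implements S, fun hx =>
    HamSim.Run.le_cost_oracleCircuit_of_le S κ hx ?_⟩
  rw [sub_le_iff_le_add, div_le_iff₀ hγ0]
  linarith
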